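/- \textbf{Setting.} Let $M$ and $E$ be smooth (Hausdorff, second countable, boundaryless) manifolds with $\dim M=m$, $\dim E=m+n$, let $\pi\colon E\to M$ be a smooth surjective submersion (for instance a fibre bundle), and let $\mathrm{vol}$ be a smooth nowhere vanishing $m$-form on $M$. Let $\pi^1\colon J^1\pi\to E$ be the first-order jet bundle, $\bar\pi^1=\pi\circ\pi^1$, and let $J^1\pi^*=\Lambda^m_2(T^*E)/\Lambda^m_1(T^*E)$ be the reduced dual jet bundle, with projections $\pi_E\colon J^1\pi^*\to E$, $\bar\pi_E=\pi\circ\pi_E$ (here $\Lambda^m_k(T^*E)$ is the bundle of $m$-forms on $E$ that vanish on any $k$ $\pi$-vertical vectors). Let $\mathcal L=L\,\mathrm{vol}$ be a Lagrangian density with $L\colon J^1\pi\to\mathbb R$ smooth. In natural coordinates $(x^i,y^\alpha,y^\alpha_i)$ with $\mathrm{vol}=d^mx$, and with $d^{m-1}x_i=i(\partial/\partial x^i)d^mx$, its extended Legendre map $\widetilde{FL}\colon J^1\pi\to\Lambda^m_2(T^*E)$ sends a point to the form $\frac{\partial L}{\partial y^\alpha_i}dy^\alpha\wedge d^{m-1}x_i-\big(\frac{\partial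 L}{\partial y^\alpha_i}y^\alpha_i-L\big)d^mx$; its Legendre map $FL\colon J^1\pi\to J^1\pi^*$ is the composition of $\widetilde{FL}$ with the quotient map, $FL(x^i,y^\alpha,y^\alpha_i)=(x^i,y^\alpha,\partial L/\partial y^\alpha_i)$. Put $\Theta_L=\widetilde{FL}{}^*\Theta$ and $\Omega_L=-d\Theta_L$, where $\Theta$ is the tautological $m$-form of $\Lambda^m_2(T^*E)$. $L$ is \emph{regular} if $FL$ is a local diffeomorphism and \emph{hyperregular} if $FL$ is a diffeomorphism of $J^1\pi$ onto $J^1\pi^*$. On a set where $FL^{-1}$ is defined, put $h=\widetilde{FL}\circ FL^{-1}$ and $\Omega_h=-d(h^*\Theta)$. \textbf{Definitions.} Let $N$ be a manifold with a projection onto $M$ and let $W\subset N$ be open. An \emph{integrable transverse distribution} on $W$ is a smooth $m$-dimensional distribution $D$ on $W$, complementary to the vertical spaces of $N\to M$, such that through each point of $W$ there passes an integral section, i.e. a smooth local section $\psi$ of $N\to M$, defined on an open subset of $M$ and with values in $W$, such that $T_{\psi(x)}\,\mathrm{Im}\,\psi=D_{\psi(x)}$ for every $x$. A \emph{solution to the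 Lagrangian problem} on an open $W\subset J^1\pi$ is an integrable transverse distribution $D_L$ on $W$ all of whose integral sections $\psi$ are holonomic ($\psi=j^1(\pi^1\circ\psi)$) and satisfy $\psi^*i(X)\Omega_L=0$ for every vector field $X$. A \emph{solution to the Hamiltonian problem} on an open $W'\subset J^1\pi^*$ (on which $h$ is defined) is an integrable transverse distribution $D_h$ on $W'$ all of whose integral sections $\psi$ satisfy $\psi^*i(X)\Omega_h=0$ for every vector field $X$. Let $O\subset E$ be open. Given a solution $D_L$ to the Lagrangian problem on $W$, a \emph{solution on $O$ to the generalized Lagrangian Hamilton--Jacobi problem} is a pair $(\Psi,D)$ of a smooth section $\Psi\colon O\to W$ of $\pi^1$ and an integrable transverse distribution $D$ on $O$ such that $\Psi\circ\gamma$ is an integral section of $D_L$ for every integral section $\gamma$ of $D$. It is a \emph{solution to the Lagrangian Hamilton--Jacobi problem} if moreover $\Psi^*\Omega_L=0$ on $O$. Likewise, given a solution $D_h$ to the Hamiltonian problem on $W'$, a \emph{solution on $O$ to the generalized Hamiltonian Hamilton--Jacobi problem} is a pair $(s,D)$ of a smooth section $s\colon O\to W'$ of $\pi_E$ and an integrable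 transverse distribution $D$ on $O$ such that $s\circ\gamma$ is an integral section of $D_h$ for every integral section $\gamma$ of $D$; it is a \emph{solution to the Hamiltonian Hamilton--Jacobi problem} if moreover $s^*\Omega_h=0$ on $O$. \textbf{Theorem.} (a) Let $L$ be regular, let $W\subset J^1\pi$ be any open set on which $FL$ is injective, let $FL^{-1}\colon FL(W)\to W$ be the inverse of $FL|_W$ and $h=\widetilde{FL}\circ FL^{-1}$ on $FL(W)$, and let $O\subset E$ be open. (1) If $(\Psi,D)$ solves on $O$ the generalized Lagrangian Hamilton--Jacobi problem for a solution $D_L$ to the Lagrangian problem on $W$, then $D_h=FL_*D_L$ is a solution to the Hamiltonian problem on $FL(W)$ and $(s,D)$, with $s=FL\circ\Psi$, solves on $O$ the generalized Hamiltonian Hamilton--Jacobi problem for $D_h$. If $(\Psi,D)$ solves the Lagrangian Hamilton--Jacobi problem, then $(s,D)$ solves the Hamiltonian Hamilton--Jacobi problem. (2) Conversely, if $(s,D)$ solves on $O$ the generalized Hamiltonian Hamilton--Jacobi problem for a solution $D_h$ to the Hamiltonian problem on $FL(W)$, then $D_L=(FL^{-1})_*D_h$ is a solution to the Lagrangian problem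 on $W$ and $(\Psi,D)$, with $\Psi=FL^{-1}\circ s$, solves on $O$ the generalized Lagrangian Hamilton--Jacobi problem for $D_L$. If $(s,D)$ solves the Hamiltonian Hamilton--Jacobi problem, then $(\Psi,D)$ solves the Lagrangian Hamilton--Jacobi problem. (b) If $L$ is hyperregular, then (1) and (2) hold globally, with $W=J^1\pi$, $FL(W)=J^1\pi^*$ and $O=E$. -/

import Mathlib

open scoped Manifold ContDiff
open Set
noncomputable section

namespace Multisymplectic

/-- A smooth atlas, with charts in the normed space `V`, on a set `N` without topology. -/
structure SmoothAtlas (V : Type*) [NormedAddCommGroup V] [NormedSpace ℝ V] (N : Type*)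
    (ι : Type*) where
  chart : ι → PartialEquiv N V
  indexAt : N → ι
  mem_source : ∀ p, p ∈ (chart (indexAt p)).source
  open_source : ∀ i j, IsOpen ((chart i).symm.trans (chart j)).source
  smooth : ∀ i j, ContDiffOn ℝ ∞ ((chart i).symm.trans (chart j))
    ((chart i).symm.trans (chart j)).source

namespace SmoothAtlas
variable {V : Type*} [NormedAddCommGroup V] [NormedSpace ℝ V] {N ι : Type*}
  (A : SmoothAtlas V N ι)

/-- The topology and the charted space structure defined by a smooth atlas. -/
def core : ChartedSpaceCore V N where
  atlas := range A.chart
  chartAt p := A.chart (A.indexAt p)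
  mem_chart_source := A.mem_source
  chart_mem_atlas p := ⟨_, rfl⟩
  open_source := by
    rintro _ _ ⟨i, rfl⟩ ⟨j, rfl⟩
    exact A.open_source i j
  continuousOn_toFun := by
    rintro _ _ ⟨i, rfl⟩ ⟨j, rfl⟩
    exact (A.smooth i j).continuousOn

theorem isManifold :
    @IsManifold ℝ _ V _ _ V _ 𝓘(ℝ, V) ∞ N A.core.toTopologicalSpace A.core.toChartedSpace := by
  let : TopologicalSpace N := A.core.toTopologicalSpace
  let : ChartedSpace V N := A.core.toChartedSpace
  refine isManifold_of_contDiffOn 𝓘(ℝ, V) ∞ N ?_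
  intro e e' he he'
  have h1 : e ∈ ⋃ (e : PartialEquiv N V) (he : e ∈ A.core.atlas),
    {A.core.openPartialHomeomorph e he} := he
  have h2 : e' ∈ ⋃ (e : PartialEquiv N V) (he : e ∈ A.core.atlas),
    {A.core.openPartialHomeomorph e he} := he'
  simp only [mem_iUnion, mem_singleton_iff] at h1 h2
  obtain ⟨_, ⟨i, rfl⟩, rfl⟩ := h1
  obtain ⟨_, ⟨j, rfl⟩, rfl⟩ := h2
  simp only [modelWithCornersSelf_coe, modelWithCornersSelf_coe_symm, Function.comp_id,
    Function.id_comp, preimage_id, range_id, inter_univ]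
  exact A.smooth i j
end SmoothAtlas


section SubQuot
variable {X Y : Type*} [AddCommGroup X] [Module ℝ X] [AddCommGroup Y] [Module ℝ Y]

/-- The quotient `B / A` of two subspaces `A ⊆ B` of a vector space. -/
def SubQuot (A B : Submodule ℝ X) : Type _ := B ⧸ A.comap B.subtype

variable (A B : Submodule ℝ X)
instance : AddCommGroup (SubQuot A B) := inferInstanceAs (AddCommGroup (B ⧸ A.comap B.subtype))
instance : Module ℝ (SubQuot A B) := inferInstanceAs (Module ℝ (B ⧸ A.comap B.subtype))

/-- The projection `B → B / A`. -/
def SubQuot.mk : B →ₗ[ℝ] SubQuot A B := (A.comap B.subtype).mkQ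

theorem SubQuot.mk_surjective : Function.Surjective (SubQuot.mk A B) :=
  Submodule.mkQ_surjective _

variable {A B}
/-- The map `B / A → B' / A'` induced by a linear map `B → B'`. -/
def SubQuot.map {A' B' : Submodule ℝ Y} (f : B →ₗ[ℝ] B')
    (h : ∀ b : B, (b : X) ∈ A → (f b : Y) ∈ A') : SubQuot A B →ₗ[ℝ] SubQuot A' B' :=
  Submodule.mapQ (A.comap B.subtype) (A'.comap B'.subtype) f h

theorem SubQuot.exists_retraction (B : Submodule ℝ X) : ∃ r : X →ₗ[ℝ] B, ∀ b : B, r b = b := by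
  obtain ⟨r, hr⟩ := LinearMap.exists_leftInverse_of_injective B.subtype
    (LinearMap.ker_eq_bot.2 Subtype.val_injective)
  exact ⟨r, LinearMap.congr_fun hr⟩

theorem SubQuot.map_mk {A' B' : Submodule ℝ Y} (f : B →ₗ[ℝ] B')
    (h : ∀ b : B, (b : X) ∈ A → (f b : Y) ∈ A') (b : B) :
    SubQuot.map f h (SubQuot.mk A B b) = SubQuot.mk A' B' (f b) := rfl
end SubQuot

section SubQuotNormed
variable {X : Type*} [NormedAddCommGroup X] [NormedSpace ℝ X] [FiniteDimensional ℝ X]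
  (A B : Submodule ℝ X)

instance : IsClosed ((A.comap B.subtype : Submodule ℝ B) : Set B) :=
  Submodule.closed_of_finiteDimensional _
instance : NormedAddCommGroup (SubQuot A B) :=
  inferInstanceAs (NormedAddCommGroup (B ⧸ A.comap B.subtype))
instance : NormedSpace ℝ (SubQuot A B) := inferInstanceAs (NormedSpace ℝ (B ⧸ A.comap B.subtype))
instance : FiniteDimensional ℝ (SubQuot A B) :=
  inferInstanceAs (FiniteDimensional ℝ (B ⧸ A.comap B.subtype))
end SubQuotNormed

section LinearAlgebra
variable (k : ℕ) {V V' V'' : Type*}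
  [AddCommGroup V] [Module ℝ V] [TopologicalSpace V]
  [AddCommGroup V'] [Module ℝ V'] [TopologicalSpace V']
  [AddCommGroup V''] [Module ℝ V''] [TopologicalSpace V'']

/-- The `k`-forms on `V` which vanish when two of their arguments lie in `K`. -/
def Lambda2 (K : Submodule ℝ V) : Submodule ℝ (V [⋀^Fin k]→L[ℝ] ℝ) where
  carrier := {α | ∀ (v : Fin k → V) (i j : Fin k), i ≠ j → v i ∈ K → v j ∈ K → α v = 0}
  add_mem' {α β} hα hβ v i j hij hi hj := by simp [hα v i j hij hi hj, hβ v i j hij hi hj]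
  zero_mem' _ _ _ _ _ _ := rfl
  smul_mem' c α hα v i j hij hi hj := by simp [hα v i j hij hi hj]

/-- The `k`-forms on `V` which vanish when one of their arguments lies in `K`. -/
def Lambda1 (K : Submodule ℝ V) : Submodule ℝ (V [⋀^Fin k]→L[ℝ] ℝ) where
  carrier := {α | ∀ (v : Fin k → V) (i : Fin k), v i ∈ K → α v = 0}
  add_mem' {α β} hα hβ v i hi := by simp [hα v i hi, hβ v i hi]
  zero_mem' _ _ _ := rfl
  smul_mem' c α hα v i hi := by simp [hα v i hi]

/-- The quotient of `Lambda2` by `Lambda1`. -/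
def ReducedLambda (K : Submodule ℝ V) : Type _ := SubQuot (Lambda1 k K) (Lambda2 k K)

variable (K : Submodule ℝ V)
instance : AddCommGroup (ReducedLambda k K) :=
  inferInstanceAs (AddCommGroup (SubQuot (Lambda1 k K) (Lambda2 k K)))
instance : Module ℝ (ReducedLambda k K) :=
  inferInstanceAs (Module ℝ (SubQuot (Lambda1 k K) (Lambda2 k K)))

/-- The projection onto the quotient. -/
def ReducedLambda.mk : Lambda2 k K →ₗ[ℝ] ReducedLambda k K := SubQuot.mk _ _

theorem ReducedLambda.mk_surjective : Function.Surjective (ReducedLambda.mk k K) :=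
  SubQuot.mk_surjective _ _

variable {K}
/-- Pull-back of forms by a linear map with `f(K) ⊆ K'` . -/
def Lambda2.pull {K' : Submodule ℝ V'} (f : V →L[ℝ] V')
    (hf : ∀ v ∈ K, f v ∈ K') : Lambda2 k K' →ₗ[ℝ] Lambda2 k K where
  toFun α := ⟨α.1.compContinuousLinearMap f, fun v i j hij hi hj =>
    α.2 (f ∘ v) i j hij (hf _ hi) (hf _ hj)⟩
  map_add' _ _ := rfl
  map_smul' _ _ := rfl

theorem Lambda2.pull_mem {K' : Submodule ℝ V'} (f : V →L[ℝ] V') (hf : ∀ v ∈ K, f v ∈ K')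
    (α : Lambda2 k K') (hα : (α : V' [⋀^Fin k]→L[ℝ] ℝ) ∈ Lambda1 k K') :
    (Lambda2.pull k f hf α : V [⋀^Fin k]→L[ℝ] ℝ) ∈ Lambda1 k K :=
  fun v i hi => hα (f ∘ v) i (hf _ hi)

/-- Pull-back of classes of forms by a linear map with `f(K) ⊆ K'` . -/
def ReducedLambda.map {K' : Submodule ℝ V'} (f : V →L[ℝ] V')
    (hf : ∀ v ∈ K, f v ∈ K') : ReducedLambda k K' →ₗ[ℝ] ReducedLambda k K :=
  SubQuot.map (Lambda2.pull k f hf) (Lambda2.pull_mem k f hf)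

open Classical in
/-- Pull-back of classes of forms by a linear map with `f(K) ⊆ K'` (zero for other maps). -/
def ReducedLambda.pull (K : Submodule ℝ V) (K' : Submodule ℝ V') (f : V →L[ℝ] V') :
    ReducedLambda k K' →ₗ[ℝ] ReducedLambda k K :=
  if hf : ∀ v ∈ K, f v ∈ K' then
    ReducedLambda.map k f hf
  else 0

theorem ReducedLambda.pull_mk {K' : Submodule ℝ V'} (f : V →L[ℝ] V')
    (hf : ∀ v ∈ K, f v ∈ K') (α : Lambda2 k K') :
    pull k K K' f (mk k K' α) = mk k K (Lambda2.pull k f hf α) := by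
  rw [pull, dif_pos hf]; rfl

theorem ReducedLambda.pull_pull (K : Submodule ℝ V) (K' : Submodule ℝ V') (K'' : Submodule ℝ V'')
    (f : V →L[ℝ] V') (g : V' →L[ℝ] V'') (hf : ∀ v ∈ K, f v ∈ K') (hg : ∀ v ∈ K', g v ∈ K'')
    (q : ReducedLambda k K'') :
    pull k K K' f (pull k K' K'' g q) = pull k K K'' (g.comp f) q := by
  have hgf : ∀ v ∈ K, (g.comp f) v ∈ K'' := fun v hv => hg _ (hf v hv)
  obtain ⟨α, rfl⟩ := mk_surjective k K'' q
  rw [pull_mk k g hg, pull_mk k f hf, pull_mk k _ hgf]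
  rfl

theorem ReducedLambda.pull_id (K : Submodule ℝ V) (q : ReducedLambda k K) :
    pull k K K (.id ℝ V) q = q := by
  obtain ⟨α, rfl⟩ := mk_surjective k K q
  rw [pull_mk k _ fun v hv => hv]
  rfl
end LinearAlgebra

section Normed
variable (k : ℕ) {V : Type*} [NormedAddCommGroup V] [NormedSpace ℝ V] [FiniteDimensional ℝ V]

theorem finiteDimensional_cmm :
    FiniteDimensional ℝ (ContinuousMultilinearMap ℝ (fun _ : Fin k => V) ℝ) := by
  refine FiniteDimensional.of_injective
    (ContinuousMultilinearMap.toMultilinearMapLinear :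
      ContinuousMultilinearMap ℝ (fun _ : Fin k => V) ℝ →ₗ[ℝ] MultilinearMap ℝ (fun _ : Fin k => V) ℝ)
    ContinuousMultilinearMap.toMultilinearMap_injective

instance : FiniteDimensional ℝ (V [⋀^Fin k]→L[ℝ] ℝ) :=
  have := finiteDimensional_cmm k (V := V)
  FiniteDimensional.of_injective
    (ContinuousAlternatingMap.toContinuousMultilinearMapCLM ℝ : (V [⋀^Fin k]→L[ℝ] ℝ) →L[ℝ] _).toLinearMap
    ContinuousAlternatingMap.toContinuousMultilinearMap_injective

variable (K : Submodule ℝ V)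
instance : NormedAddCommGroup (ReducedLambda k K) :=
  inferInstanceAs (NormedAddCommGroup (SubQuot (Lambda1 k K) (Lambda2 k K)))
instance : NormedSpace ℝ (ReducedLambda k K) :=
  inferInstanceAs (NormedSpace ℝ (SubQuot (Lambda1 k K) (Lambda2 k K)))
instance : FiniteDimensional ℝ (ReducedLambda k K) :=
  inferInstanceAs (FiniteDimensional ℝ (SubQuot (Lambda1 k K) (Lambda2 k K)))

variable {K}
theorem contDiff_pullback : ContDiff ℝ ∞ (fun p : (V [⋀^Fin k]→L[ℝ] ℝ) × (V →L[ℝ] V) =>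
      p.1.compContinuousLinearMap p.2) := by
  have := finiteDimensional_cmm k (V := V)
  obtain ⟨r, hr⟩ := LinearMap.exists_leftInverse_of_injective
    (ContinuousAlternatingMap.toContinuousMultilinearMapCLM ℝ :
      (V [⋀^Fin k]→L[ℝ] ℝ) →L[ℝ] ContinuousMultilinearMap ℝ (fun _ : Fin k => V) ℝ).toLinearMap
    (LinearMap.ker_eq_bot.2 ContinuousAlternatingMap.toContinuousMultilinearMap_injective)
  have h : (fun p : (V [⋀^Fin k]→L[ℝ] ℝ) × (V →L[ℝ] V) => p.1.compContinuousLinearMap p.2) =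
      fun p => LinearMap.toContinuousLinearMap r
        ((ContinuousMultilinearMap.compContinuousLinearMapContinuousMultilinear ℝ
          (fun _ : Fin k => V) (fun _ => V) ℝ (fun _ => p.2))
        (ContinuousAlternatingMap.toContinuousMultilinearMapCLM ℝ p.1)) := by
    funext p
    exact (LinearMap.congr_fun hr (p.1.compContinuousLinearMap p.2)).symm
  rw [h]
  refine (LinearMap.toContinuousLinearMap r).contDiff.comp (ContDiff.clm_apply ?_ ?_)
  · exact (ContinuousMultilinearMap.contDiff _).comp (contDiff_pi.2 fun _ => contDiff_snd)
  · exact (ContinuousLinearMap.contDiff _).comp contDiff_fst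

theorem contDiffOn_pull {Z : Type*} [NormedAddCommGroup Z] [NormedSpace ℝ Z]
    {s : Set Z} {f : Z → V →L[ℝ] V} {q : Z → ReducedLambda k K}
    (hf : ContDiffOn ℝ ∞ f s) (hq : ContDiffOn ℝ ∞ q s) (hK : ∀ z ∈ s, ∀ v ∈ K, f z v ∈ K) :
    ContDiffOn ℝ ∞ (fun z => ReducedLambda.pull k K K (f z) (q z)) s := by
  obtain ⟨σ, hσ⟩ := LinearMap.exists_rightInverse_of_surjective
    (ReducedLambda.mk k K) (LinearMap.range_eq_top.2 (ReducedLambda.mk_surjective k K))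
  obtain ⟨r, hr⟩ := SubQuot.exists_retraction (Lambda2 k K)
  have h1 : ContDiffOn ℝ ∞ (fun z => LinearMap.toContinuousLinearMap
      ((ReducedLambda.mk k K) ∘ₗ r)
      ((LinearMap.toContinuousLinearMap ((Lambda2 k K).subtype ∘ₗ σ) (q z)).compContinuousLinearMap
        (f z))) s :=
    (ContinuousLinearMap.contDiff _).comp_contDiffOn
      ((contDiff_pullback k).comp_contDiffOn
        (((ContinuousLinearMap.contDiff _).comp_contDiffOn hq).prodMk hf))
  refine h1.congr fun z hz => ?_
  have e1 : q z = ReducedLambda.mk k K (σ (q z)) := (LinearMap.congr_fun hσ (q z)).symm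
  have e2 : r (Lambda2.pull k (f z) (hK z hz) (σ (q z))).1 = _ :=
    hr (Lambda2.pull k (f z) (hK z hz) (σ (q z)))
  conv_lhs => rw [e1]
  rw [ReducedLambda.pull_mk k _ (hK z hz)]
  exact congrArg (ReducedLambda.mk k K) e2.symm
end Normed

section FibredManifold
/-- The model space `ℝ^m`. -/
abbrev Base (m : ℕ) : Type := EuclideanSpace ℝ (Fin m)

variable {m n : ℕ} {M E : Type*}
  [TopologicalSpace M] [ChartedSpace (EuclideanSpace ℝ (Fin m)) M]
  [TopologicalSpace E] [ChartedSpace (EuclideanSpace ℝ (Fin (m + n))) E]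

variable (m n) in
/-- `π : E → M` is a surjective submersion, with `dim M = m` and `dim E = m + n`. Every smooth fibre
bundle is one. -/
class IsFibredManifold (π : E → M) : Prop where
  surjective : Function.Surjective π
  submersion : Manifold.IsSubmersion (𝓡 (m + n)) (𝓡 m) ∞ π

variable (m n) in
/-- Coordinates adapted to `π`: smooth charts `tot = (x^i, y^α)` of `E` and `base = (x^i)` of `M`
in which `π` is the projection `(x, y) ↦ x`. -/
structure FibredChart (π : E → M) where
  tot : OpenPartialHomeomorph E (Base m × Base n)
  base : OpenPartialHomeomorph M (Base m)
  contMDiffOn_tot : ContMDiffOn (𝓡 (m + n)) 𝓘(ℝ, Base m × Base n) ∞ tot tot.source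
  contMDiffOn_tot_symm : ContMDiffOn 𝓘(ℝ, Base m × Base n) (𝓡 (m + n)) ∞ tot.symm tot.target
  contMDiffOn_base : ContMDiffOn (𝓡 m) (𝓡 m) ∞ base base.source
  contMDiffOn_base_symm : ContMDiffOn (𝓡 m) (𝓡 m) ∞ base.symm base.target
  proj_mem : ∀ e ∈ tot.source, π e ∈ base.source
  fst_tot : ∀ e ∈ tot.source, (tot e).1 = base (π e)

theorem exists_fibredChart [IsManifold (𝓡 m) ∞ M] [IsManifold (𝓡 (m + n)) ∞ E]
    (π : E → M) [h : IsFibredManifold m n π] (e : E) :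
    ∃ c : FibredChart m n π, e ∈ c.tot.source := by
  obtain ⟨F, _, _, hF⟩ := h.submersion
  specialize hF e
  have : FiniteDimensional ℝ (Base m × F) := hF.equiv.toLinearEquiv.finiteDimensional
  have : FiniteDimensional ℝ F :=
    FiniteDimensional.of_surjective (LinearMap.snd ℝ (Base m) F) LinearMap.snd_surjective
  have hd : Module.finrank ℝ F = Module.finrank ℝ (Base n) := by
    have := hF.equiv.toLinearEquiv.finrank_eq
    simp only [finrank_euclideanSpace, Fintype.card_fin, Module.finrank_prod] at this ⊢
    omega
  let ψ : EuclideanSpace ℝ (Fin (m + n)) ≃L[ℝ] Base m × Base n :=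
    hF.equiv.trans ((ContinuousLinearEquiv.refl ℝ (Base m)).prodCongr
      (ContinuousLinearEquiv.ofFinrankEq hd))
  refine ⟨⟨hF.domChart.trans ψ.toHomeomorph.toOpenPartialHomeomorph, hF.codChart, ?_, ?_, ?_, ?_,
    ?_, ?_⟩, ?_⟩
  · have h1 := contMDiffOn_of_mem_maximalAtlas hF.domChart_mem_maximalAtlas
    have := (ψ.contDiff (n := ∞)).contMDiff.comp_contMDiffOn h1
    simpa [Function.comp_def] using this
  · have h1 := contMDiffOn_symm_of_mem_maximalAtlas hF.domChart_mem_maximalAtlas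
    have := h1.comp (ψ.symm.contDiff (n := ∞)).contMDiff.contMDiffOn (s := ψ.symm ⁻¹' hF.domChart.target)
      (fun _ h => h)
    simpa [Function.comp_def] using this
  · exact contMDiffOn_of_mem_maximalAtlas hF.codChart_mem_maximalAtlas
  · exact contMDiffOn_symm_of_mem_maximalAtlas hF.codChart_mem_maximalAtlas
  · intro e' he'
    exact hF.source_subset_preimage_source (by simpa using he')
  · intro e' he'
    have he' : e' ∈ hF.domChart.source := by simpa using he'
    have := hF.writtenInCharts (show hF.domChart e' ∈ (hF.domChart.extend (𝓡 (m + n))).target by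
      simpa using hF.domChart.map_source he')
    simp [hF.domChart.left_inv he'] at this
    simp [ψ, this]
  · simpa using hF.mem_domChart_source

namespace FibredChart
variable {π : E → M} (c : FibredChart m n π)

/-- The differential of total space coordinates. -/
def dTot (e : E) : TangentSpace (𝓡 (m + n)) e →L[ℝ] Base m × Base n :=
  mfderiv (𝓡 (m + n)) 𝓘(ℝ, Base m × Base n) c.tot e

/-- The differential of base coordinates. -/
def dBase (x : M) : TangentSpace (𝓡 m) x →L[ℝ] Base m :=
  mfderiv (𝓡 m) (𝓡 m) c.base x

theorem mdiff_tot : c.tot.MDifferentiable (𝓡 (m + n)) 𝓘(ℝ, Base m × Base n) :=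
  ⟨c.contMDiffOn_tot.mdifferentiableOn (by simp), c.contMDiffOn_tot_symm.mdifferentiableOn (by simp)⟩

theorem mdiff_base : c.base.MDifferentiable (𝓡 m) (𝓡 m) :=
  ⟨c.contMDiffOn_base.mdifferentiableOn (by simp),
    c.contMDiffOn_base_symm.mdifferentiableOn (by simp)⟩

theorem dTot_inv {e : E} (he : e ∈ c.tot.source) :
    (c.dTot e).inverse.comp (c.dTot e) = .id ℝ _ ∧ (c.dTot e).comp (c.dTot e).inverse = .id ℝ _ := by
  have h : (c.dTot e).IsInvertible := ⟨c.mdiff_tot.mfderiv he, rfl⟩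
  obtain ⟨A, hA⟩ := h
  rw [← hA, ContinuousLinearMap.inverse_equiv]
  exact ⟨by ext; simp, by ext <;> simp⟩

theorem dBase_inv {x : M} (hx : x ∈ c.base.source) :
    (c.dBase x).inverse.comp (c.dBase x) = .id ℝ _ ∧
      (c.dBase x).comp (c.dBase x).inverse = .id ℝ _ := by
  have h : (c.dBase x).IsInvertible := ⟨c.mdiff_base.mfderiv hx, rfl⟩
  obtain ⟨A, hA⟩ := h
  rw [← hA, ContinuousLinearMap.inverse_equiv]
  exact ⟨by ext; simp, by ext; simp⟩

theorem fst_dTot (hπ : MDifferentiable (𝓡 (m + n)) (𝓡 m) π) {e : E} (he : e ∈ c.tot.source) :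
    (ContinuousLinearMap.fst ℝ (Base m) (Base n)).comp (c.dTot e) =
      (c.dBase (π e)).comp (mfderiv (𝓡 (m + n)) (𝓡 m) π e) := by
  have h1 : HasMFDerivAt (𝓡 (m + n)) (𝓡 m) (fun y => (c.tot y).1) e
      ((ContinuousLinearMap.fst ℝ (Base m) (Base n)).comp (c.dTot e)) :=
    HasMFDerivAt.comp e (ContinuousLinearMap.hasMFDerivAt (ContinuousLinearMap.fst ℝ (Base m) (Base n)))
      (c.mdiff_tot.mdifferentiableAt he).hasMFDerivAt
  have h2 : HasMFDerivAt (𝓡 (m + n)) (𝓡 m) (fun y => c.base (π y)) e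
      ((c.dBase (π e)).comp (mfderiv (𝓡 (m + n)) (𝓡 m) π e)) :=
    HasMFDerivAt.comp e (c.mdiff_base.mdifferentiableAt (c.proj_mem e he)).hasMFDerivAt
      (hπ e).hasMFDerivAt
  have h3 := h2.congr_of_eventuallyEq (f₁ := fun y => (c.tot y).1) (by
    filter_upwards [c.tot.open_source.mem_nhds he] with y hy using c.fst_tot y hy)
  exact hasMFDerivAt_unique h1 h3

theorem contDiffOn_tot_change (c' : FibredChart m n π) :
    ContDiffOn ℝ ∞ (c'.tot ∘ c.tot.symm) (c.tot.symm.trans c'.tot).source := by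
  rw [← contMDiffOn_iff_contDiffOn]
  refine c'.contMDiffOn_tot.comp (c.contMDiffOn_tot_symm.mono ?_) ?_
  · intro z hz; exact hz.1
  · intro z hz; exact hz.2

theorem contDiffOn_base_change (c' : FibredChart m n π) :
    ContDiffOn ℝ ∞ (c'.base ∘ c.base.symm) (c.base.symm.trans c'.base).source := by
  rw [← contMDiffOn_iff_contDiffOn]
  refine c'.contMDiffOn_base.comp (c.contMDiffOn_base_symm.mono ?_) ?_
  · intro z hz; exact hz.1
  · intro z hz; exact hz.2

theorem dTot_change (c' : FibredChart m n π) {e : E} (he : e ∈ c.tot.source)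
    (he' : e ∈ c'.tot.source) :
    (c'.dTot e).comp (c.dTot e).inverse = fderiv ℝ (c'.tot ∘ c.tot.symm) (c.tot e) := by
  have hz : c.tot e ∈ (c.tot.symm.trans c'.tot).source :=
    ⟨c.tot.map_source he, by simpa [c.tot.left_inv he] using he'⟩
  have h1 : DifferentiableAt ℝ (c'.tot ∘ c.tot.symm) (c.tot e) :=
    ((c.contDiffOn_tot_change c').contDiffAt
      ((c.tot.symm.trans c'.tot).open_source.mem_nhds hz)).differentiableAt (by simp)
  have h2 := HasMFDerivAt.comp e h1.hasFDerivAt.hasMFDerivAt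
    (c.mdiff_tot.mdifferentiableAt he).hasMFDerivAt
  have h3 := h2.congr_of_eventuallyEq (f₁ := c'.tot) (by
    filter_upwards [c.tot.open_source.mem_nhds he] with y hy
    simp [c.tot.left_inv hy])
  have h4 : c'.dTot e = (fderiv ℝ (c'.tot ∘ c.tot.symm) (c.tot e)).comp (c.dTot e) := h3.mfderiv
  rw [h4, ContinuousLinearMap.comp_assoc, (c.dTot_inv he).2, ContinuousLinearMap.comp_id]

theorem dBase_change (c' : FibredChart m n π) {x : M} (hx : x ∈ c.base.source)
    (hx' : x ∈ c'.base.source) :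
    (c'.dBase x).comp (c.dBase x).inverse = fderiv ℝ (c'.base ∘ c.base.symm) (c.base x) := by
  have hz : c.base x ∈ (c.base.symm.trans c'.base).source :=
    ⟨c.base.map_source hx, by simpa [c.base.left_inv hx] using hx'⟩
  have h1 : DifferentiableAt ℝ (c'.base ∘ c.base.symm) (c.base x) :=
    ((c.contDiffOn_base_change c').contDiffAt
      ((c.base.symm.trans c'.base).open_source.mem_nhds hz)).differentiableAt (by simp)
  have h2 := HasMFDerivAt.comp x h1.hasFDerivAt.hasMFDerivAt
    (c.mdiff_base.mdifferentiableAt hx).hasMFDerivAt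
  have h3 := h2.congr_of_eventuallyEq (f₁ := c'.base) (by
    filter_upwards [c.base.open_source.mem_nhds hx] with y hy
    simp [c.base.left_inv hy])
  have h4 : c'.dBase x = (fderiv ℝ (c'.base ∘ c.base.symm) (c.base x)).comp (c.dBase x) :=
    h3.mfderiv
  rw [h4, ContinuousLinearMap.comp_assoc, (c.dBase_inv hx).2, ContinuousLinearMap.comp_id]
end FibredChart
end FibredManifold

section Jets
variable (m n : ℕ) {M E : Type*}
  [TopologicalSpace M] [ChartedSpace (EuclideanSpace ℝ (Fin m)) M]
  [TopologicalSpace E] [ChartedSpace (EuclideanSpace ℝ (Fin (m + n))) E]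
  (π : E → M)

/-- A point of the first jet bundle `J¹π`: a point `e` of `E` and a linear right inverse
`T_{π(e)} M → T_e E` of the differential of `π` at `e` (the differential of a local section). -/
structure Jet where
  pt : E
  lin : TangentSpace (𝓡 m) (π pt) →L[ℝ] TangentSpace (𝓡 (m + n)) pt
  comp_lin : (mfderiv (𝓡 (m + n)) (𝓡 m) π pt).comp lin = .id ℝ (TangentSpace (𝓡 m) (π pt))

/-- The model space of `J¹π`, with coordinates `(x^i, y^α, y^α_i)`. -/
abbrev JetModel : Type := (Base m × Base n) × (Base m →L[ℝ] Base n)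

variable {m n π}

theorem Jet.mk_eq_mk
    (L : ∀ e : E, TangentSpace (𝓡 m) (π e) →L[ℝ] TangentSpace (𝓡 (m + n)) e)
    {e e' : E} (he : e = e') (σ : TangentSpace (𝓡 m) (π e') →L[ℝ] TangentSpace (𝓡 (m + n)) e')
    (h) (hσ) (hL : L e' = σ) : (⟨e, L e, h⟩ : Jet m n π) = ⟨e', σ, hσ⟩ := by
  subst he
  subst hL
  rfl

/-- The linear map `T_{π(e)} M → T_e E` with coordinates `y^α_i = A`. -/
def FibredChart.jetLin (c : FibredChart m n π) (A : Base m →L[ℝ] Base n) (e : E) :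
    TangentSpace (𝓡 m) (π e) →L[ℝ] TangentSpace (𝓡 (m + n)) e :=
  (c.dTot e).inverse.comp (((ContinuousLinearMap.id ℝ (Base m)).prod A).comp (c.dBase (π e)))

theorem FibredChart.comp_jetLin (hπ : MDifferentiable (𝓡 (m + n)) (𝓡 m) π)
    (c : FibredChart m n π) (A : Base m →L[ℝ] Base n) {e : E} (he : e ∈ c.tot.source) :
    (mfderiv (𝓡 (m + n)) (𝓡 m) π e).comp (c.jetLin A e) = .id ℝ (TangentSpace (𝓡 m) (π e)) := by
  have h1 := (c.dBase_inv (c.proj_mem e he)).1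
  have h2 := (c.dTot_inv he).2
  have h3 := c.fst_dTot hπ he
  have key : (c.dBase (π e)).comp ((mfderiv (𝓡 (m + n)) (𝓡 m) π e).comp (c.jetLin A e)) =
      c.dBase (π e) := by
    rw [← ContinuousLinearMap.comp_assoc, ← h3, jetLin, ContinuousLinearMap.comp_assoc,
      ← ContinuousLinearMap.comp_assoc (c.dTot e), h2]
    rfl
  calc _ = ((c.dBase (π e)).inverse.comp (c.dBase (π e))).comp
        ((mfderiv (𝓡 (m + n)) (𝓡 m) π e).comp (c.jetLin A e)) := by rw [h1]; rfl
    _ = _ := by rw [ContinuousLinearMap.comp_assoc, key, h1]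

/-- The coordinates `y^α_i` of a linear map `T_{π(e)} M → T_e E`. -/
def FibredChart.jetCoord (c : FibredChart m n π) (e : E)
    (σ : TangentSpace (𝓡 m) (π e) →L[ℝ] TangentSpace (𝓡 (m + n)) e) : Base m →L[ℝ] Base n :=
  (ContinuousLinearMap.snd ℝ (Base m) (Base n)).comp
    ((c.dTot e).comp (σ.comp (c.dBase (π e)).inverse))

theorem FibredChart.jetLin_jetCoord (hπ : MDifferentiable (𝓡 (m + n)) (𝓡 m) π)
    (c : FibredChart m n π) (j : Jet m n π) (hj : j.pt ∈ c.tot.source) :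
    c.jetLin (c.jetCoord j.pt j.lin) j.pt = j.lin := by
  have h1 := (c.dBase_inv (c.proj_mem _ hj)).1
  have h2 := (c.dTot_inv hj).1
  have h3 := c.fst_dTot hπ hj
  have h4 : (c.dTot j.pt).comp j.lin = ((ContinuousLinearMap.id ℝ (Base m)).prod
      (c.jetCoord j.pt j.lin)).comp (c.dBase (π j.pt)) := by
    ext v : 1
    refine Prod.ext ?_ ?_
    · have := congrArg (fun T => T (j.lin v)) h3
      have h5 := congrArg (fun T => T v) j.comp_lin
      simp only [ContinuousLinearMap.comp_apply] at this h5
      simp only [ContinuousLinearMap.comp_apply, ContinuousLinearMap.prod_apply]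
      refine this.trans ?_
      rw [h5]; rfl
    · have := congrArg (fun T => T v) h1
      simp only [ContinuousLinearMap.comp_apply] at this
      simp only [jetCoord, ContinuousLinearMap.comp_apply, ContinuousLinearMap.prod_apply]
      rw [this]; rfl
  rw [FibredChart.jetLin, ← h4, ← ContinuousLinearMap.comp_assoc, h2]
  rfl

theorem FibredChart.snd_dTot_jetLin (c : FibredChart m n π) (A : Base m →L[ℝ] Base n) {e : E}
    (he : e ∈ c.tot.source) :
    (c.dTot e).comp (c.jetLin A e) =
      ((ContinuousLinearMap.id ℝ (Base m)).prod A).comp (c.dBase (π e)) := by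
  rw [jetLin, ← ContinuousLinearMap.comp_assoc, (c.dTot_inv he).2]
  rfl

theorem FibredChart.jetCoord_jetLin (c : FibredChart m n π) (A : Base m →L[ℝ] Base n) {e : E}
    (he : e ∈ c.tot.source) : c.jetCoord e (c.jetLin A e) = A := by
  rw [jetCoord, ← ContinuousLinearMap.comp_assoc (c.dTot e), c.snd_dTot_jetLin A he,
    ContinuousLinearMap.comp_assoc, (c.dBase_inv (c.proj_mem e he)).2]
  rfl

open Classical in
/-- The jet with coordinates `p`. -/
def FibredChart.toJet (hπ : MDifferentiable (𝓡 (m + n)) (𝓡 m) π)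
    (c : FibredChart m n π) (j₀ : Jet m n π) (p : JetModel m n) : Jet m n π :=
  if h : p.1 ∈ c.tot.target then
    ⟨c.tot.symm p.1, c.jetLin p.2 _, c.comp_jetLin hπ p.2 (c.tot.map_target h)⟩ else j₀

/-- The natural coordinates `(x^i, y^α, y^α_i)` of `J¹π` induced by adapted coordinates (`j₀` is a
value for the inverse outside its domain). -/
def FibredChart.jetChart (hπ : MDifferentiable (𝓡 (m + n)) (𝓡 m) π)
    (c : FibredChart m n π) (j₀ : Jet m n π) : PartialEquiv (Jet m n π) (JetModel m n) where
  toFun j := (c.tot j.pt, c.jetCoord j.pt j.lin)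
  invFun := c.toJet hπ j₀
  source := {j | j.pt ∈ c.tot.source}
  target := {p | p.1 ∈ c.tot.target}
  map_source' j hj := c.tot.map_source hj
  map_target' p (hp : p.1 ∈ c.tot.target) := by
    rw [FibredChart.toJet, dif_pos hp]
    exact c.tot.map_target hp
  left_inv' j hj := by
    rw [FibredChart.toJet, dif_pos (c.tot.map_source hj)]
    exact Jet.mk_eq_mk (c.jetLin _) (c.tot.left_inv hj) j.lin _ j.comp_lin (c.jetLin_jetCoord hπ j hj)
  right_inv' p (hp : p.1 ∈ c.tot.target) := by
    rw [FibredChart.toJet, dif_pos hp]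
    exact Prod.ext (c.tot.right_inv hp) (c.jetCoord_jetLin p.2 (c.tot.map_target hp))

theorem FibredChart.jetChart_change (hπ : MDifferentiable (𝓡 (m + n)) (𝓡 m) π)
    (c c' : FibredChart m n π) (j₀ j₀' : Jet m n π) (p : JetModel m n)
    (hp : p ∈ ((c.jetChart hπ j₀).symm.trans (c'.jetChart hπ j₀')).source) :
    ((c.jetChart hπ j₀).symm.trans (c'.jetChart hπ j₀')) p =
      ((c'.tot ∘ c.tot.symm) p.1,
        (ContinuousLinearMap.snd ℝ (Base m) (Base n)).comp
          ((fderiv ℝ (c'.tot ∘ c.tot.symm) p.1).comp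
            (((ContinuousLinearMap.id ℝ (Base m)).prod p.2).comp
              (fderiv ℝ (c.base ∘ c'.base.symm) ((c'.tot ∘ c.tot.symm) p.1).1)))) := by
  have h1 : p.1 ∈ c.tot.target := hp.1
  have he := c.tot.map_target h1
  have h2 : (c.toJet hπ j₀ p).pt ∈ c'.tot.source := hp.2
  change ((c'.tot (c.toJet hπ j₀ p).pt, c'.jetCoord (c.toJet hπ j₀ p).pt (c.toJet hπ j₀ p).lin) :
    JetModel m n) = _
  rw [toJet, dif_pos h1] at h2 ⊢
  change c.tot.symm p.1 ∈ c'.tot.source at h2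
  refine Prod.ext rfl ?_
  have h3 := c.dTot_change c' he h2
  have h4 := c'.dBase_change c (c'.proj_mem _ h2) (c.proj_mem _ he)
  rw [c.tot.right_inv h1] at h3
  rw [← c'.fst_tot _ h2] at h4
  change c'.jetCoord (c.tot.symm p.1) (c.jetLin p.2 (c.tot.symm p.1)) = _
  simp only [Function.comp_apply]
  rw [← h3, ← h4]
  rfl

theorem FibredChart.jetChart_source (hπ : MDifferentiable (𝓡 (m + n)) (𝓡 m) π)
    (c c' : FibredChart m n π) (j₀ j₀' : Jet m n π) :
    ((c.jetChart hπ j₀).symm.trans (c'.jetChart hπ j₀')).source =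
      Prod.fst ⁻¹' (c.tot.symm.trans c'.tot).source := by
  ext p
  constructor
  · rintro ⟨h1, h2⟩
    refine ⟨h1, ?_⟩
    change p.1 ∈ c.tot.target at h1
    change (c.toJet hπ j₀ p).pt ∈ c'.tot.source at h2
    rwa [toJet, dif_pos h1] at h2
  · rintro ⟨h1, h2⟩
    refine ⟨h1, ?_⟩
    change p.1 ∈ c.tot.target at h1
    change (c.toJet hπ j₀ p).pt ∈ c'.tot.source
    rwa [toJet, dif_pos h1]

theorem FibredChart.contDiffOn_jetChart (hπ : MDifferentiable (𝓡 (m + n)) (𝓡 m) π)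
    (c c' : FibredChart m n π) (j₀ j₀' : Jet m n π) :
    ContDiffOn ℝ ∞ ((c.jetChart hπ j₀).symm.trans (c'.jetChart hπ j₀'))
      ((c.jetChart hπ j₀).symm.trans (c'.jetChart hπ j₀')).source := by
  refine ContDiffOn.congr ?_ (c.jetChart_change hπ c' j₀ j₀')
  rw [c.jetChart_source hπ c']
  have h1 : ContDiffOn ℝ ∞ (fun p : JetModel m n => (c'.tot ∘ c.tot.symm) p.1)
      (Prod.fst ⁻¹' (c.tot.symm.trans c'.tot).source) :=
    (c.contDiffOn_tot_change c').comp contDiffOn_fst fun _ h => h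
  have h2 : ContDiffOn ℝ ∞ (fun p : JetModel m n => fderiv ℝ (c'.tot ∘ c.tot.symm) p.1)
      (Prod.fst ⁻¹' (c.tot.symm.trans c'.tot).source) :=
    ((c.contDiffOn_tot_change c').fderiv_of_isOpen (c.tot.symm.trans c'.tot).open_source
      (by simp)).comp contDiffOn_fst fun _ h => h
  have h3 : ContDiffOn ℝ ∞ (fun p : JetModel m n => fderiv ℝ (c.base ∘ c'.base.symm)
      ((c'.tot ∘ c.tot.symm) p.1).1) (Prod.fst ⁻¹' (c.tot.symm.trans c'.tot).source) := by
    refine ((c'.contDiffOn_base_change c).fderiv_of_isOpen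
      (c'.base.symm.trans c.base).open_source (by simp)).comp h1.fst ?_
    rintro p ⟨hp1, hp2⟩
    change c.tot.symm p.1 ∈ c'.tot.source at hp2
    have he := c.tot.map_target hp1
    change ((c'.tot (c.tot.symm p.1)).1 ∈ _)
    rw [c'.fst_tot _ hp2]
    refine ⟨c'.base.map_source (c'.proj_mem _ hp2), ?_⟩
    change c'.base.symm _ ∈ c.base.source
    rw [c'.base.left_inv (c'.proj_mem _ hp2)]
    exact c.proj_mem _ he
  have h4 : ContDiffOn ℝ ∞ (fun p : JetModel m n => (ContinuousLinearMap.id ℝ (Base m)).prod p.2)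
      (Prod.fst ⁻¹' (c.tot.symm.trans c'.tot).source) := by
    have : (fun p : JetModel m n => (ContinuousLinearMap.id ℝ (Base m)).prod p.2) = fun p =>
        (ContinuousLinearMap.inl ℝ (Base m) (Base n)) +
          (ContinuousLinearMap.inr ℝ (Base m) (Base n)).comp p.2 := by
      funext p; ext v : 1; refine Prod.ext ?_ ?_ <;> simp
    rw [this]
    exact contDiffOn_const.add (contDiffOn_const.clm_comp contDiffOn_snd)
  exact h1.prodMk (contDiffOn_const.clm_comp (h2.clm_comp (h4.clm_comp h3)))

theorem IsFibredManifold.contMDiff (π : E → M) [h : IsFibredManifold m n π] :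
    ContMDiff (𝓡 (m + n)) (𝓡 m) ∞ π := h.submersion.contMDiff

variable (π) [IsManifold (𝓡 m) ∞ M] [IsManifold (𝓡 (m + n)) ∞ E] [IsFibredManifold m n π]
/-- The atlas of natural coordinates on `J¹π`. -/
def jetAtlas : SmoothAtlas (JetModel m n) (Jet m n π) (FibredChart m n π × Jet m n π) where
  chart i := i.1.jetChart ((IsFibredManifold.contMDiff π).mdifferentiable (by simp)) i.2
  indexAt j := ((exists_fibredChart π j.pt).choose, j)
  mem_source j := (exists_fibredChart π j.pt).choose_spec
  open_source i i' := by
    rw [FibredChart.jetChart_source]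
    exact (i.1.tot.symm.trans i'.1.tot).open_source.preimage continuous_fst
  smooth i i' := i.1.contDiffOn_jetChart _ i'.1 i.2 i'.2

instance : TopologicalSpace (Jet m n π) := (jetAtlas π).core.toTopologicalSpace
instance : ChartedSpace (JetModel m n) (Jet m n π) := (jetAtlas π).core.toChartedSpace
instance : IsManifold 𝓘(ℝ, JetModel m n) ∞ (Jet m n π) := (jetAtlas π).isManifold

end Jets

section DualJets
variable (m n : ℕ) {M E : Type*}
  [TopologicalSpace M] [ChartedSpace (EuclideanSpace ℝ (Fin m)) M]
  [TopologicalSpace E] [ChartedSpace (EuclideanSpace ℝ (Fin (m + n))) E]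
  (π : E → M)

/-- The `π`-vertical space at `e`. -/
def verticalSpace (e : E) : Submodule ℝ (TangentSpace (𝓡 (m + n)) e) :=
  LinearMap.ker (mfderiv (𝓡 (m + n)) (𝓡 m) π e).toLinearMap

/-- The vertical space of the projection `ℝ^m × ℝ^n → ℝ^m`. -/
def modelVertical : Submodule ℝ (Base m × Base n) :=
  LinearMap.ker (ContinuousLinearMap.fst ℝ (Base m) (Base n)).toLinearMap

/-- A point of the bundle `Λ^m_2(T^*E)` over `E`: an `m`-form at a point of `E` which vanishes on
pairs of `π`-vertical vectors. -/
structure ExtendedMomentum where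
  pt : E
  form : Lambda2 m (verticalSpace m n π pt)

/-- A point of the reduced dual jet bundle `J¹π^* = Λ^m_2(T^*E) / Λ^m_1(T^*E)`. -/
structure DualJet where
  pt : E
  cls : ReducedLambda m (verticalSpace m n π pt)

/-- The model space of `J¹π^*`; the quotient of the model forms has the coordinates `p_α^i`
(the coefficients of `dy^α ∧ d^{m-1}x_i`). -/
abbrev DualJetModel : Type :=
  (Base m × Base n) × ReducedLambda m (modelVertical m n)

variable {m n π}

theorem DualJet.mk_eq_mk (L : ∀ e : E, ReducedLambda m (verticalSpace m n π e)) {e e' : E}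
    (he : e = e') (q : ReducedLambda m (verticalSpace m n π e')) (hq : L e' = q) :
    (⟨e, L e⟩ : DualJet m n π) = ⟨e', q⟩ := by
  subst he
  subst hq
  rfl

/-- The projection `μ : Λ^m_2(T^*E) → J¹π^*`. -/
def ExtendedMomentum.toDualJet (a : ExtendedMomentum m n π) : DualJet m n π :=
  ⟨a.pt, ReducedLambda.mk m _ a.form⟩

theorem FibredChart.dTot_vertical (hπ : MDifferentiable (𝓡 (m + n)) (𝓡 m) π)
    (c : FibredChart m n π) {e : E} (he : e ∈ c.tot.source) :
    ∀ v ∈ verticalSpace m n π e, c.dTot e v ∈ modelVertical m n := by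
  intro v hv
  have h := congrArg (fun T => T v) (c.fst_dTot hπ he)
  have hv' : mfderiv (𝓡 (m + n)) (𝓡 m) π e v = 0 := hv
  simp only [ContinuousLinearMap.comp_apply] at h
  rw [hv', map_zero] at h
  exact h

theorem FibredChart.dTot_inverse_vertical (hπ : MDifferentiable (𝓡 (m + n)) (𝓡 m) π)
    (c : FibredChart m n π) {e : E} (he : e ∈ c.tot.source) :
    ∀ v ∈ modelVertical m n, (c.dTot e).inverse v ∈ verticalSpace m n π e := by
  intro v hv
  have h := congrArg (fun T => T ((c.dTot e).inverse v)) (c.fst_dTot hπ he)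
  have h1 := congrArg (fun T => T v) (c.dTot_inv he).2
  simp only [ContinuousLinearMap.comp_apply] at h h1
  rw [h1] at h
  have hv' : (ContinuousLinearMap.fst ℝ (Base m) (Base n)) v = 0 := hv
  have h2 : c.dBase (π e) (mfderiv (𝓡 (m + n)) (𝓡 m) π e ((c.dTot e).inverse v)) = 0 :=
    h.symm.trans hv'
  have h3 := congrArg (fun T => T (mfderiv (𝓡 (m + n)) (𝓡 m) π e ((c.dTot e).inverse v)))
    (c.dBase_inv (c.proj_mem e he)).1
  simp only [ContinuousLinearMap.comp_apply] at h3
  rw [h2, map_zero] at h3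
  exact h3.symm

/-- The natural coordinates of `J¹π^*` induced by adapted coordinates. -/
def FibredChart.dualChart (hπ : MDifferentiable (𝓡 (m + n)) (𝓡 m) π)
    (c : FibredChart m n π) : PartialEquiv (DualJet m n π) (DualJetModel m n) where
  toFun a := (c.tot a.pt, ReducedLambda.pull m (modelVertical m n) (verticalSpace m n π a.pt)
    (c.dTot a.pt).inverse a.cls)
  invFun p := ⟨c.tot.symm p.1, ReducedLambda.pull m (verticalSpace m n π _) (modelVertical m n)
    (c.dTot (c.tot.symm p.1)) p.2⟩
  source := {a | a.pt ∈ c.tot.source}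
  target := {p | p.1 ∈ c.tot.target}
  map_source' a ha := c.tot.map_source ha
  map_target' p hp := c.tot.map_target hp
  left_inv' a (ha : a.pt ∈ c.tot.source) := by
    refine DualJet.mk_eq_mk (fun e => ReducedLambda.pull m (verticalSpace m n π e)
      (modelVertical m n) (c.dTot e) _) (c.tot.left_inv ha) a.cls ?_
    rw [ReducedLambda.pull_pull _ _ _ _ _ _ (c.dTot_vertical hπ ha)
      (c.dTot_inverse_vertical hπ ha), (c.dTot_inv ha).1, ReducedLambda.pull_id]
  right_inv' p (hp : p.1 ∈ c.tot.target) := by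
    have he := c.tot.map_target hp
    refine Prod.ext (c.tot.right_inv hp) ?_
    dsimp only
    rw [ReducedLambda.pull_pull _ _ _ _ _ _ (c.dTot_inverse_vertical hπ he)
      (c.dTot_vertical hπ he), (c.dTot_inv he).2, ReducedLambda.pull_id]

theorem FibredChart.contDiffOn_dualChart (hπ : MDifferentiable (𝓡 (m + n)) (𝓡 m) π)
    (c c' : FibredChart m n π) :
    ContDiffOn ℝ ∞ ((c.dualChart hπ).symm.trans (c'.dualChart hπ))
      ((c.dualChart hπ).symm.trans (c'.dualChart hπ)).source := by
  have hch : ∀ p ∈ Prod.fst ⁻¹' (c.tot.symm.trans c'.tot).source,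
      (c.dTot (c.tot.symm p.1)).comp (c'.dTot (c.tot.symm p.1)).inverse =
        fderiv ℝ (c.tot ∘ c'.tot.symm) ((c'.tot ∘ c.tot.symm) (p : DualJetModel m n).1) := by
    rintro p ⟨hp1, hp2⟩
    exact c'.dTot_change c hp2 (c.tot.map_target hp1)
  have h1 : ContDiffOn ℝ ∞ (fun p : DualJetModel m n => (c'.tot ∘ c.tot.symm) p.1)
      (Prod.fst ⁻¹' (c.tot.symm.trans c'.tot).source) :=
    (c.contDiffOn_tot_change c').comp contDiffOn_fst fun _ h => h
  have h2 : ContDiffOn ℝ ∞ (fun p : DualJetModel m n => fderiv ℝ (c.tot ∘ c'.tot.symm)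
      ((c'.tot ∘ c.tot.symm) p.1)) (Prod.fst ⁻¹' (c.tot.symm.trans c'.tot).source) := by
    refine ((c'.contDiffOn_tot_change c).fderiv_of_isOpen
      (c'.tot.symm.trans c.tot).open_source (by simp)).comp h1 ?_
    rintro p ⟨hp1, hp2⟩
    change c.tot.symm p.1 ∈ c'.tot.source at hp2
    refine ⟨c'.tot.map_source hp2, ?_⟩
    change c'.tot.symm (c'.tot (c.tot.symm p.1)) ∈ c.tot.source
    rw [c'.tot.left_inv hp2]
    exact c.tot.map_target hp1
  have h3 := contDiffOn_pull m (K := modelVertical m n) h2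
    (contDiffOn_snd (s := (Prod.fst ⁻¹' (c.tot.symm.trans c'.tot).source : Set (DualJetModel m n))))
    (by
      intro p hp v hv
      rw [← hch p hp]
      exact c.dTot_vertical hπ (c.tot.map_target hp.1) _ (c'.dTot_inverse_vertical hπ hp.2 v hv))
  refine (h1.prodMk h3).congr ?_
  intro p hp
  refine Prod.ext rfl ?_
  have h4 := ReducedLambda.pull_pull m _ _ _ _ _ (c'.dTot_inverse_vertical hπ hp.2)
      (c.dTot_vertical hπ (c.tot.map_target hp.1)) p.2
  refine h4.trans ?_
  exact congrArg (fun T => ReducedLambda.pull m (modelVertical m n) (modelVertical m n) T p.2)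
    (hch p hp)

variable (π) [IsManifold (𝓡 m) ∞ M] [IsManifold (𝓡 (m + n)) ∞ E] [IsFibredManifold m n π]

/-- The atlas of natural coordinates on `J¹π^*`. -/
def dualAtlas : SmoothAtlas (DualJetModel m n) (DualJet m n π) (FibredChart m n π) where
  chart c := c.dualChart ((IsFibredManifold.contMDiff π).mdifferentiable (by simp))
  indexAt a := (exists_fibredChart π a.pt).choose
  mem_source a := (exists_fibredChart π a.pt).choose_spec
  open_source c c' := (c.tot.symm.trans c'.tot).open_source.preimage continuous_fst
  smooth c c' := c.contDiffOn_dualChart _ c'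

instance : TopologicalSpace (DualJet m n π) := (dualAtlas π).core.toTopologicalSpace
instance : ChartedSpace (DualJetModel m n) (DualJet m n π) := (dualAtlas π).core.toChartedSpace
instance : IsManifold 𝓘(ℝ, DualJetModel m n) ∞ (DualJet m n π) := (dualAtlas π).isManifold

end DualJets

section Forms
variable {V : Type*} [NormedAddCommGroup V] [NormedSpace ℝ V] {V' : Type*} [NormedAddCommGroup V']
  [NormedSpace ℝ V'] {N : Type*} [TopologicalSpace N] [ChartedSpace V N]
  {N' : Type*} [TopologicalSpace N'] [ChartedSpace V' N']

variable (V N) in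
/-- A (not necessarily continuous) differential `k`-form on the manifold `N` modelled on `V`. -/
abbrev DForm (k : ℕ) : Type _ := (p : N) → TangentSpace 𝓘(ℝ, V) p [⋀^Fin k]→L[ℝ] ℝ

/-- The pull-back `f^* η`. -/
def DForm.pullback {k : ℕ} (f : N → N') (η : DForm V' N' k) : DForm V N k := fun p =>
  (η (f p)).compContinuousLinearMap (mfderiv 𝓘(ℝ, V) 𝓘(ℝ, V') f p)

/-- The coordinate expression `(φ⁻¹)^* η` of a form in a chart `φ`. -/
def DForm.inChart {k : ℕ} (η : DForm V N k) (φ : OpenPartialHomeomorph N V) :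
    V → V [⋀^Fin k]→L[ℝ] ℝ := fun z =>
  (η (φ.symm z)).compContinuousLinearMap (mfderiv 𝓘(ℝ, V) 𝓘(ℝ, V) φ.symm z)

/-- A form is smooth if its coordinate expressions are. -/
def DForm.IsSmooth {k : ℕ} (η : DForm V N k) : Prop :=
  ∀ p : N, ContDiffOn ℝ ∞ (η.inChart (chartAt V p)) (chartAt V p).target

/-- The exterior derivative of a form: at `p` it is `φ^* d((φ⁻¹)^* η)`, where `φ` is the preferred
chart at `p` (for forms that are smooth near `p` every chart gives the same result). -/
def DForm.extd {k : ℕ} (η : DForm V N k) : DForm V N (k + 1) := fun p =>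
  (extDeriv (η.inChart (chartAt V p)) (chartAt V p p)).compContinuousLinearMap
    (mfderiv 𝓘(ℝ, V) 𝓘(ℝ, V) (chartAt V p) p)
end Forms

section Distributions
variable (m : ℕ) (V : Type*) [NormedAddCommGroup V] [NormedSpace ℝ V] (V' : Type*)
  [NormedAddCommGroup V'] [NormedSpace ℝ V']
  {N : Type*} [TopologicalSpace N] [ChartedSpace V N]
  {N' : Type*} [TopologicalSpace N'] [ChartedSpace V' N']
  {M : Type*} [TopologicalSpace M] [ChartedSpace (EuclideanSpace ℝ (Fin m)) M]

variable (N) in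
/-- A field of tangent subspaces on the manifold `N` modelled on `V`. -/
abbrev TangentDistribution : Type _ := (p : N) → Submodule ℝ (TangentSpace 𝓘(ℝ, V) p)

variable {V V'} in
/-- The field of subspaces `p ↦ (T_p f)⁻¹ (D_{f(p)})`; it is the image of `D` under `f⁻¹` where
`f` is a local diffeomorphism. -/
def TangentDistribution.comap (f : N → N') (D : TangentDistribution V' N') : TangentDistribution V N := fun p =>
  (D (f p)).comap (mfderiv 𝓘(ℝ, V) 𝓘(ℝ, V') f p).toLinearMap

/-- `D` is a smooth distribution of dimension `k` on the open set `W`: around each point of `W`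
it is spanned by `k` smooth, pointwise independent, vector fields. -/
def TangentDistribution.IsSmoothOn [IsManifold 𝓘(ℝ, V) ∞ N] (D : TangentDistribution V N) (k : ℕ)
    (W : Set N) : Prop :=
  ∀ p ∈ W, ∃ U : Set N, IsOpen U ∧ p ∈ U ∧
    ∃ X : Fin k → (q : N) → TangentSpace 𝓘(ℝ, V) q,
      (∀ i, ContMDiffOn 𝓘(ℝ, V) 𝓘(ℝ, V).tangent ∞
        (fun q => (⟨q, X i q⟩ : TangentBundle 𝓘(ℝ, V) N)) U) ∧
      ∀ q ∈ U, LinearIndependent ℝ (fun i => X i q) ∧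
        Submodule.span ℝ (range fun i => X i q) = D q

/-- `ψ` is a smooth section, on the open set `U`, of the projection `pr : N → N'`. -/
structure IsSectionOn (pr : N → N') (ψ : N' → N) (U : Set N') : Prop where
  isOpen : IsOpen U
  smooth : ContMDiffOn 𝓘(ℝ, V') 𝓘(ℝ, V) ∞ ψ U
  proj : ∀ x ∈ U, pr (ψ x) = x

/-- `ψ` is a (local) section of `pr : N → M` on the open set `U`, with image in `W`, which is an
integral section of `D`: the image of `ψ` has tangent spaces `T_{ψ(x)} Im ψ = D_{ψ(x)}`. -/
structure IsIntegralSection (pr : N → M) (D : TangentDistribution V N) (W : Set N) (ψ : M → N)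
    (U : Set M) : Prop where
  isSection : IsSectionOn V (Base m) pr ψ U
  mapsTo : MapsTo ψ U W
  tangent : ∀ x ∈ U, LinearMap.range (mfderiv (𝓡 m) 𝓘(ℝ, V) ψ x).toLinearMap = D (ψ x)

/-- `D` is, on the open set `W`, a smooth `m`-dimensional distribution which is transverse to
`pr : N → M` (complementary to the `pr`-vertical spaces) and integrable: an integral section passes
through every point. -/
structure IsIntegrableTransverse [IsManifold 𝓘(ℝ, V) ∞ N] (pr : N → M) (D : TangentDistribution V N)
    (W : Set N) : Prop where
  smooth : D.IsSmoothOn V m W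
  transverse : ∀ p ∈ W, IsCompl (D p) (LinearMap.ker (mfderiv 𝓘(ℝ, V) (𝓡 m) pr p).toLinearMap)
  integrable : ∀ p ∈ W, ∃ (ψ : M → N) (U : Set M),
    IsIntegralSection m V pr D W ψ U ∧ pr p ∈ U ∧ ψ (pr p) = p

/-- The field equation `ψ^* i(X) Ω = 0` for all `X`, on `U`. -/
def SolvesFieldEquation (Ω : DForm V N (m + 1)) (ψ : M → N) (U : Set M) : Prop :=
  ∀ x ∈ U, ∀ (X : TangentSpace 𝓘(ℝ, V) (ψ x)) (u : Fin m → TangentSpace (𝓡 m) x),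
    Ω (ψ x) (Fin.cons X fun i => mfderiv (𝓡 m) 𝓘(ℝ, V) ψ x (u i)) = 0

/-- `D` is an integrable `m`-dimensional `pr`-transverse distribution on `W` all of whose integral
sections solve the field equation defined by `Ω`. -/
structure IsFieldSolution [IsManifold 𝓘(ℝ, V) ∞ N] (pr : N → M) (Ω : DForm V N (m + 1))
    (D : TangentDistribution V N) (W : Set N) : Prop where
  distribution : IsIntegrableTransverse m V pr D W
  equation : ∀ ψ U, IsIntegralSection m V pr D W ψ U → SolvesFieldEquation m V Ω ψ U
end Distributions

section Legendre
variable {m n : ℕ} {M E : Type*}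
  [TopologicalSpace M] [ChartedSpace (EuclideanSpace ℝ (Fin m)) M]
  [TopologicalSpace E] [ChartedSpace (EuclideanSpace ℝ (Fin (m + n))) E]
  {π : E → M}

/-- The projection `v ↦ v - σ(dπ v)` of `T_e E` onto the vertical space along the image of the
jet `σ`; in coordinates it is `∂/∂y^α ⊗ (dy^α - y^α_i dx^i)`. -/
def Jet.vertProj (j : Jet m n π) :
    TangentSpace (𝓡 (m + n)) j.pt →L[ℝ] TangentSpace (𝓡 (m + n)) j.pt :=
  .id ℝ _ - j.lin.comp (mfderiv (𝓡 (m + n)) (𝓡 m) π j.pt)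

theorem Jet.mfderiv_vertProj (j : Jet m n π) :
    (mfderiv (𝓡 (m + n)) (𝓡 m) π j.pt).comp j.vertProj = 0 := by
  rw [vertProj, ContinuousLinearMap.comp_sub, ← ContinuousLinearMap.comp_assoc, j.comp_lin]
  ext v : 1
  simp

/-- The jet `σ + τ'` over the same point, where `τ'` is the vertical part of `τ`. -/
def Jet.translate (j : Jet m n π)
    (τ : TangentSpace (𝓡 m) (π j.pt) →L[ℝ] TangentSpace (𝓡 (m + n)) j.pt) : Jet m n π where
  pt := j.pt
  lin := j.lin + j.vertProj.comp τ
  comp_lin := by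
    rw [ContinuousLinearMap.comp_add, ← ContinuousLinearMap.comp_assoc, j.mfderiv_vertProj,
      j.comp_lin]
    simp

/-- The fibre derivative of `L` at the jet `j`: `τ ↦ d/dt L(j + t τ')`, where `τ'` is the vertical
part of `τ`. -/
def Jet.fibreDeriv (L : Jet m n π → ℝ) (j : Jet m n π) :
    (Base m →L[ℝ] Base (m + n)) →L[ℝ] ℝ :=
  fderiv ℝ (fun τ : Base m →L[ℝ] Base (m + n) => L (j.translate τ)) 0

/-- The linear map `T_e E → T_{π(e)} M`, `v ↦ ∑ i, D_j L (dx^i ⊗ v') ∂/∂x^i`, where `v'` is the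
vertical part of `v`: in coordinates `(∂L/∂y^α_i) (dy^α - y^α_k dx^k) ⊗ ∂/∂x^i`. It does not
depend on the basis. -/
def Jet.momentum (L : Jet m n π → ℝ) (j : Jet m n π) : Base (m + n) →L[ℝ] Base m :=
  ∑ i : Fin m, ((j.fibreDeriv L).comp
    (ContinuousLinearMap.smulRightL ℝ (Base m) (Base (m + n))
      (EuclideanSpace.proj i : Base m →L[ℝ] ℝ))).smulRight (EuclideanSpace.single i (1 : ℝ))

/-- The `m`-form `c P^* η + ∑ k, η (P v₁, …, Q v_k, …, P v_m)` on `A`, for an `m`-form `η` on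
`B` and linear maps `P Q : A → B`. -/
def contactForm {A B : Type*} [NormedAddCommGroup A] [NormedSpace ℝ A] [NormedAddCommGroup B]
    [NormedSpace ℝ B] (c : ℝ) (η : B [⋀^Fin m]→L[ℝ] ℝ) (P Q : A →L[ℝ] B) : A [⋀^Fin m]→L[ℝ] ℝ :=
  c • η.compContinuousLinearMap P + η.fderivCompContinuousLinearMap P Q

theorem contactForm_apply {A B : Type*} [NormedAddCommGroup A] [NormedSpace ℝ A]
    [NormedAddCommGroup B] [NormedSpace ℝ B] (c : ℝ) (η : B [⋀^Fin m]→L[ℝ] ℝ) (P Q : A →L[ℝ] B)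
    (v : Fin m → A) :
    contactForm c η P Q v =
      c * η (fun i => P (v i)) + ∑ k, η (Function.update (fun i => P (v i)) k (Q (v k))) := by
  have h : ∀ k : Fin m, (fun i => Function.update (fun _ : Fin m => P) k Q i (v i)) =
      Function.update (fun i => P (v i)) k (Q (v k)) := by
    intro k
    funext i
    by_cases hik : i = k
    · subst hik; simp
    · simp [hik]
  simp only [contactForm, ContinuousAlternatingMap.add_apply, ContinuousAlternatingMap.smul_apply,
    ContinuousAlternatingMap.fderivCompContinuousLinearMap_apply, h, smul_eq_mul]
  rfl

theorem contactForm_mem {A B : Type*} [NormedAddCommGroup A] [NormedSpace ℝ A]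
    [NormedAddCommGroup B] [NormedSpace ℝ B] (c : ℝ) (η : B [⋀^Fin m]→L[ℝ] ℝ) (P Q : A →L[ℝ] B) :
    contactForm c η P Q ∈ Lambda2 m (LinearMap.ker P.toLinearMap) := by
  intro v a b hab ha hb
  have ha' : P (v a) = 0 := ha
  have hb' : P (v b) = 0 := hb
  rw [contactForm_apply, η.map_coord_zero a ha', mul_zero, zero_add]
  refine Finset.sum_eq_zero fun k _ => ?_
  by_cases hk : k = a
  · refine η.map_coord_zero b ?_
    rw [Function.update_of_ne (by rw [hk]; exact hab.symm)]
    exact hb'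
  · refine η.map_coord_zero a ?_
    rw [Function.update_of_ne (Ne.symm hk)]
    exact ha'

/-- The `m`-form on `T_e E` attached by the Lagrangian density `L vol` to a jet at `e`. In
coordinates with `vol = d^m x` it is
`L d^m x + (∂L/∂y^α_i) (dy^α - y^α_k dx^k) ∧ d^{m-1} x_i`, that is,
`(∂L/∂y^α_i) dy^α ∧ d^{m-1} x_i - ((∂L/∂y^α_i) y^α_i - L) d^m x`. -/
def Jet.cartanForm (vol : DForm (Base m) M m) (L : Jet m n π → ℝ) (j : Jet m n π) :
    Base (m + n) [⋀^Fin m]→L[ℝ] ℝ :=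
  contactForm (A := Base (m + n)) (B := Base m) (L j) (vol (π j.pt))
    (mfderiv (𝓡 (m + n)) (𝓡 m) π j.pt) (j.momentum L)

theorem Jet.cartanForm_mem (vol : DForm (Base m) M m) (L : Jet m n π → ℝ) (j : Jet m n π) :
    j.cartanForm vol L ∈
      Lambda2 m (V := TangentSpace (𝓡 (m + n)) j.pt) (verticalSpace m n π j.pt) :=
  contactForm_mem (A := Base (m + n)) (B := Base m) (L j) (vol (π j.pt))
    (mfderiv (𝓡 (m + n)) (𝓡 m) π j.pt) (j.momentum L)

/-- The extended Legendre map `J¹π → Λ^m_2(T^*E)` of the Lagrangian density `L vol`. -/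
def extendedLegendre (vol : DForm (Base m) M m) (L : Jet m n π → ℝ) (j : Jet m n π) :
    ExtendedMomentum m n π := ⟨j.pt, j.cartanForm vol L, j.cartanForm_mem vol L⟩

/-- The Legendre transformation `FL : J¹π → J¹π^*`, in coordinates with `vol = d^m x`:
`(x^i, y^α, y^α_i) ↦ (x^i, y^α, p_α^i = ∂L/∂y^α_i)`. -/
def legendre (vol : DForm (Base m) M m) (L : Jet m n π → ℝ) (j : Jet m n π) : DualJet m n π :=
  (extendedLegendre vol L j).toDualJet

end Legendre

section FieldTheory
variable {m n : ℕ} {M E : Type*}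
  [TopologicalSpace M] [ChartedSpace (EuclideanSpace ℝ (Fin m)) M] [IsManifold (𝓡 m) ∞ M]
  [TopologicalSpace E] [ChartedSpace (EuclideanSpace ℝ (Fin (m + n))) E]
  [IsManifold (𝓡 (m + n)) ∞ E]
  {π : E → M}

/-- The pull-back `f^* Θ` by a map `f` into the bundle `Λ^m_2(T^*E)` of its tautological `m`-form
`Θ_a (w₁, …, w_m) = a (Tρ w₁, …, Tρ w_m)`, where `ρ` is the projection onto `E`. -/
def pullbackTautological {V : Type*} [NormedAddCommGroup V] [NormedSpace ℝ V] {N : Type*}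
    [TopologicalSpace N] [ChartedSpace V N] (f : N → ExtendedMomentum m n π) : DForm V N m :=
  fun p => (f p).form.1.compContinuousLinearMap
    (mfderiv 𝓘(ℝ, V) (𝓡 (m + n)) (fun q => (f q).pt) p)

variable [IsFibredManifold m n π]

/-- The Poincaré-Cartan `m`-form `Θ_L` on `J¹π`. -/
def poincareCartan (vol : DForm (Base m) M m) (L : Jet m n π → ℝ) :
    DForm (JetModel m n) (Jet m n π) m :=
  pullbackTautological (extendedLegendre vol L)

/-- The form `Ω_L = - dΘ_L` on `J¹π`. -/
def omegaL (vol : DForm (Base m) M m) (L : Jet m n π → ℝ) :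
    DForm (JetModel m n) (Jet m n π) (m + 1) :=
  fun j => -((poincareCartan vol L).extd j)

/-- The Hamilton-Cartan form `Ω_h = h^* Ω = - d(h^* Θ)` on `J¹π^*` of a section `h` of `μ`, where `Θ`
is the tautological form of `Λ^m_2(T^*E)`. -/
def omegaH (h : DualJet m n π → ExtendedMomentum m n π) :
    DForm (DualJetModel m n) (DualJet m n π) (m + 1) :=
  fun a => -((pullbackTautological h).extd a)

/-- `L` is regular: `FL` is a local diffeomorphism. -/
def IsRegularLagrangian (vol : DForm (Base m) M m) (L : Jet m n π → ℝ) : Prop :=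
  IsLocalDiffeomorph 𝓘(ℝ, JetModel m n) 𝓘(ℝ, DualJetModel m n) ∞ (legendre vol L)

/-- `L` is hyperregular: `FL` is a global diffeomorphism. -/
def IsHyperregularLagrangian (vol : DForm (Base m) M m) (L : Jet m n π → ℝ) : Prop :=
  ∃ Φ : Diffeomorph 𝓘(ℝ, JetModel m n) 𝓘(ℝ, DualJetModel m n) (Jet m n π) (DualJet m n π) ∞,
    ⇑Φ = legendre vol L

/-- `ψ` is, on `U`, the canonical lift `j¹φ` of its projection `φ` to `E`: its value at `x` is the
jet given by `T_x φ`. The factor `T_x (π ∘ φ)` is the identity when `ψ` is a section on an open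
set `U`; it identifies `T_x M` with `T_{π(φ(x))} M`. -/
def IsHolonomic (ψ : M → Jet m n π) (U : Set M) : Prop :=
  ∀ x ∈ U, (ψ x).lin.comp (mfderiv (𝓡 m) (𝓡 m) (fun x' => π (ψ x').pt) x) =
    mfderiv (𝓡 m) (𝓡 (m + n)) (fun x' => (ψ x').pt) x

/-- `D` is a solution on `W` of the Lagrangian problem: an integrable, transverse, holonomic
distribution whose integral sections solve the Lagrangian field equation. -/
structure IsLagrangianSolution (vol : DForm (Base m) M m) (L : Jet m n π → ℝ)
    (D : TangentDistribution (JetModel m n) (Jet m n π)) (W : Set (Jet m n π)) : Prop where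
  field : IsFieldSolution m (JetModel m n) (fun j : Jet m n π => π j.pt) (omegaL vol L) D W
  holonomic : ∀ ψ U, IsIntegralSection m (JetModel m n) (fun j : Jet m n π => π j.pt) D W ψ U →
    IsHolonomic ψ U

/-- `D` is a solution on `W` of the Hamiltonian problem defined by the Hamiltonian section `h`. -/
def IsHamiltonianSolution (h : DualJet m n π → ExtendedMomentum m n π)
    (D : TangentDistribution (DualJetModel m n) (DualJet m n π)) (W : Set (DualJet m n π)) : Prop :=
  IsFieldSolution m (DualJetModel m n) (fun a : DualJet m n π => π a.pt) (omegaH h) D W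

/-- `(Ψ, D)` solves on `O` the generalized Lagrangian Hamilton-Jacobi problem for the solution `DL`
(on `W`) of the Lagrangian problem: `Ψ` maps integral sections of `D` to integral sections of `DL`. -/
structure SolvesGenLagrangianHJ (vol : DForm (Base m) M m) (L : Jet m n π → ℝ)
    (DL : TangentDistribution (JetModel m n) (Jet m n π)) (W : Set (Jet m n π))
    (Ψ : E → Jet m n π) (D : TangentDistribution (Base (m + n)) E) (O : Set E) : Prop where
  dynamics : IsLagrangianSolution vol L DL W
  isSection : IsSectionOn (JetModel m n) (Base (m + n)) (fun j : Jet m n π => j.pt) Ψ O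
  mapsTo : MapsTo Ψ O W
  distribution : IsIntegrableTransverse m (Base (m + n)) π D O
  integral : ∀ γ U, IsIntegralSection m (Base (m + n)) π D O γ U →
    IsIntegralSection m (JetModel m n) (fun j : Jet m n π => π j.pt) DL W (Ψ ∘ γ) U

/-- `(s, D)` solves on `O` the generalized Hamiltonian Hamilton-Jacobi problem for the solution `Dh`
(on `W`) of the Hamiltonian problem: `s` maps integral sections of `D` to integral sections of
`Dh`. -/
structure SolvesGenHamiltonianHJ (h : DualJet m n π → ExtendedMomentum m n π)
    (Dh : TangentDistribution (DualJetModel m n) (DualJet m n π)) (W : Set (DualJet m n π))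
    (s : E → DualJet m n π) (D : TangentDistribution (Base (m + n)) E) (O : Set E) : Prop where
  dynamics : IsHamiltonianSolution h Dh W
  isSection : IsSectionOn (DualJetModel m n) (Base (m + n)) (fun a : DualJet m n π => a.pt) s O
  mapsTo : MapsTo s O W
  distribution : IsIntegrableTransverse m (Base (m + n)) π D O
  integral : ∀ γ U, IsIntegralSection m (Base (m + n)) π D O γ U →
    IsIntegralSection m (DualJetModel m n) (fun a : DualJet m n π => π a.pt) Dh W (s ∘ γ) U

/-- `Ψ`, with the distribution `D`, solves the Lagrangian Hamilton-Jacobi problem: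
moreover `Ψ^* Ω_L = 0` on `O`. -/
structure SolvesLagrangianHJ (vol : DForm (Base m) M m) (L : Jet m n π → ℝ)
    (DL : TangentDistribution (JetModel m n) (Jet m n π)) (W : Set (Jet m n π))
    (Ψ : E → Jet m n π) (D : TangentDistribution (Base (m + n)) E) (O : Set E) : Prop where
  generalized : SolvesGenLagrangianHJ vol L DL W Ψ D O
  isotropic : ∀ e ∈ O, (omegaL vol L).pullback (V := Base (m + n)) Ψ e = 0

/-- `s`, with the distribution `D`, solves the Hamiltonian Hamilton-Jacobi problem: moreover
`s^* Ω_h = 0` on `O`. -/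
structure SolvesHamiltonianHJ (h : DualJet m n π → ExtendedMomentum m n π)
    (Dh : TangentDistribution (DualJetModel m n) (DualJet m n π)) (W : Set (DualJet m n π))
    (s : E → DualJet m n π) (D : TangentDistribution (Base (m + n)) E) (O : Set E) : Prop where
  generalized : SolvesGenHamiltonianHJ h Dh W s D O
  isotropic : ∀ e ∈ O, (omegaH h).pullback (V := Base (m + n)) s e = 0

end FieldTheory
end Multisymplectic

end

open Multisymplectic

/-! An injective local diffeomorphism is a diffeomorphism onto its open image, so on `W` the
Legendre map identifies `W` with `FL(W)`. It covers the identity of `E`, and the tautological form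
sees tangent vectors only through their projection to `E`; therefore `h^*Θ = (FL⁻¹)^*Θ_L`. Since `d`
is natural, `Ω_h = (FL⁻¹)^*Ω_L` on `FL(W)` (`omegaH_eq_pullback`). Integrable transverse
distributions, their integral sections, the field equation and the vanishing of the pulled-back form
are all natural under diffeomorphisms over `M` (the lemmas on `IsDiffeoOn`), while the distribution
on `E` is the same on both sides.

Holonomy is the one condition without a Hamiltonian counterpart. It has to be deduced from the field
equation and regularity (`isHolonomic_of_solvesFieldEquation`). In coordinates `z = ((x, y), A)` the
form `Θ_L` is semibasic over `E`, with coefficient form `localCartan`. Contracting `dΘ_L` with a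
fibre vector `(0, B)` thus differentiates `localCartan` along `B`. The first-order terms in `L`
cancel, because `tr (p ∘ B) = D_A L (B)` for the momentum `p`, and only the fibre Hessian is left
(`fderiv_localCartan`). On a section with `(x, y)`-tangent map `T`, the contraction is, up to sign,
`Hess (B, Q ∘ T)` times the volume, where `Q ∘ T = ∂y/∂x - A` is the defect of holonomy. The field
equation makes this zero for every `B`.

The Hessian is symmetric, and it is nondegenerate: the derivative of `FL` along `(0, B)` depends on
`B` only through `Hess B`, and `FL` is an immersion (`eq_zero_of_fibreHessian_eq_zero`). Hence `Q ∘
T = 0`. -/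

noncomputable section
namespace Multisymplectic

/-! ### Transport of distributions, integral sections and forms by diffeomorphisms -/

section Diffeo
variable {V : Type*} [NormedAddCommGroup V] [NormedSpace ℝ V] {V' : Type*} [NormedAddCommGroup V']
  [NormedSpace ℝ V'] {N : Type*} [TopologicalSpace N] [ChartedSpace V N]
  {N' : Type*} [TopologicalSpace N'] [ChartedSpace V' N']

variable (V V') in
/-- `f` restricts to a diffeomorphism of the open set `W` onto the open set `W'`, with inverse the
restriction of `g`. -/
structure IsDiffeoOn (f : N → N') (g : N' → N) (W : Set N) (W' : Set N') : Prop where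
  isOpen : IsOpen W
  isOpen' : IsOpen W'
  contMDiffOn : ContMDiffOn 𝓘(ℝ, V) 𝓘(ℝ, V') ∞ f W
  contMDiffOn' : ContMDiffOn 𝓘(ℝ, V') 𝓘(ℝ, V) ∞ g W'
  mapsTo : MapsTo f W W'
  mapsTo' : MapsTo g W' W
  leftInvOn : LeftInvOn g f W
  rightInvOn : LeftInvOn f g W'

/-- A local diffeomorphism is an open map, and near each point of the image `g` agrees with a smooth
local inverse of `f`. The values of `g` off the image are arbitrary; they never matter, because
tangent maps and exterior derivatives depend on germs and the image is open. -/
theorem IsLocalDiffeomorph.isDiffeoOn {f : N → N'} {g : N' → N} {W : Set N}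
    (hf : IsLocalDiffeomorph 𝓘(ℝ, V) 𝓘(ℝ, V') ∞ f) (hW : IsOpen W) (hg : LeftInvOn g f W) :
    IsDiffeoOn V V' f g W (f '' W) where
  isOpen := hW
  isOpen' := hf.isOpenMap _ hW
  contMDiffOn := hf.contMDiff.contMDiffOn
  contMDiffOn' := by
    rintro _ ⟨p, hp, rfl⟩
    obtain ⟨Φ, hpΦ, hΦ⟩ := hf p
    have hfp : f p ∈ Φ.target := by rw [hΦ hpΦ]; exact Φ.map_source hpΦ
    have hopen : IsOpen (f '' (W ∩ Φ.source)) := hf.isOpenMap _ (hW.inter Φ.open_source)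
    have h1 : ContMDiffAt 𝓘(ℝ, V') 𝓘(ℝ, V) ∞ Φ.symm (f p) :=
      Φ.contMDiffOn_invFun.contMDiffAt (Φ.open_target.mem_nhds hfp)
    refine (h1.congr_of_eventuallyEq ?_).contMDiffWithinAt
    filter_upwards [hopen.mem_nhds ⟨p, ⟨hp, hpΦ⟩, rfl⟩]
    rintro _ ⟨q, ⟨hq, hqΦ⟩, rfl⟩
    rw [hg hq, hΦ hqΦ]
    exact (Φ.left_inv hqΦ).symm
  mapsTo := mapsTo_image _ _
  mapsTo' := by
    rintro _ ⟨p, hp, rfl⟩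
    rwa [hg hp]
  leftInvOn := hg
  rightInvOn := by
    rintro _ ⟨p, hp, rfl⟩
    rw [hg hp]

namespace IsDiffeoOn
variable {f : N → N'} {g : N' → N} {W : Set N} {W' : Set N'}

theorem symm (h : IsDiffeoOn V V' f g W W') : IsDiffeoOn V' V g f W' W :=
  ⟨h.isOpen', h.isOpen, h.contMDiffOn', h.contMDiffOn, h.mapsTo', h.mapsTo, h.rightInvOn,
    h.leftInvOn⟩

theorem contMDiffAt (h : IsDiffeoOn V V' f g W W') {p : N} (hp : p ∈ W) :
    ContMDiffAt 𝓘(ℝ, V) 𝓘(ℝ, V') ∞ f p :=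
  h.contMDiffOn.contMDiffAt (h.isOpen.mem_nhds hp)

theorem mdifferentiableAt (h : IsDiffeoOn V V' f g W W') {p : N} (hp : p ∈ W) :
    MDifferentiableAt 𝓘(ℝ, V) 𝓘(ℝ, V') f p :=
  (h.contMDiffAt hp).mdifferentiableAt (by simp)

theorem mfderiv_comp_mfderiv (h : IsDiffeoOn V V' f g W W') {p : N} (hp : p ∈ W) :
    ContinuousLinearMap.comp (mfderiv 𝓘(ℝ, V') 𝓘(ℝ, V) g (f p)) (mfderiv 𝓘(ℝ, V) 𝓘(ℝ, V') f p) =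
      ContinuousLinearMap.id ℝ (TangentSpace 𝓘(ℝ, V) p) := by
  have h1 := HasMFDerivAt.comp p (h.symm.mdifferentiableAt (h.mapsTo hp)).hasMFDerivAt
    (h.mdifferentiableAt hp).hasMFDerivAt
  have h2 : HasMFDerivAt 𝓘(ℝ, V) 𝓘(ℝ, V) (g ∘ f) p (ContinuousLinearMap.id ℝ V) := by
    refine (hasMFDerivAt_id p).congr_of_eventuallyEq ?_
    filter_upwards [h.isOpen.mem_nhds hp] with q hq using h.leftInvOn hq
  exact hasMFDerivAt_unique h1 h2

theorem mfderiv_mfderiv (h : IsDiffeoOn V V' f g W W') {p : N} (hp : p ∈ W)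
    (v : TangentSpace 𝓘(ℝ, V) p) :
    (mfderiv 𝓘(ℝ, V') 𝓘(ℝ, V) g (f p) (mfderiv 𝓘(ℝ, V) 𝓘(ℝ, V') f p v) : V) = v :=
  congrArg (fun T : V →L[ℝ] V => T v) (h.mfderiv_comp_mfderiv hp)

theorem mfderiv_mfderiv' (h : IsDiffeoOn V V' f g W W') {q : N'} (hq : q ∈ W')
    (v : TangentSpace 𝓘(ℝ, V') q) :
    (mfderiv 𝓘(ℝ, V) 𝓘(ℝ, V') f (g q) (mfderiv 𝓘(ℝ, V') 𝓘(ℝ, V) g q v) : V') = v :=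
  h.symm.mfderiv_mfderiv hq v

/-- Here `g` is differentiated at `q` itself rather than at `f (g q)`, which is equal to `q` only
propositionally. -/
theorem mfderiv_mfderiv_of_eq (h : IsDiffeoOn V V' f g W W') {q : N'} (hq : q ∈ W')
    (v : TangentSpace 𝓘(ℝ, V) (g q)) :
    (mfderiv 𝓘(ℝ, V') 𝓘(ℝ, V) g q (mfderiv 𝓘(ℝ, V) 𝓘(ℝ, V') f (g q) v) : V) = v := by
  have := h.mfderiv_mfderiv (h.mapsTo' hq) v
  rwa [h.rightInvOn hq] at this

theorem comap_comap (h : IsDiffeoOn V V' f g W W') (D : TangentDistribution V N) {p : N}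
    (hp : p ∈ W) : (D.comap g : TangentDistribution V' N').comap f p = D p := by
  ext v
  have h1 := h.mfderiv_mfderiv hp v
  simp only [TangentDistribution.comap, Submodule.mem_comap]
  change (mfderiv 𝓘(ℝ, V') 𝓘(ℝ, V) g (f p) (mfderiv 𝓘(ℝ, V) 𝓘(ℝ, V') f p v) : V) ∈
    (D (g (f p)) : Submodule ℝ V) ↔ _
  rw [h1, h.leftInvOn hp]

/-- `D.comap g` is the push-forward of `D` by `f`. -/
theorem comap_eq_map (h : IsDiffeoOn V V' f g W W') (D : TangentDistribution V N) {q : N'}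
    (hq : q ∈ W') : ((D.comap g : TangentDistribution V' N') q : Submodule ℝ V') =
      Submodule.map (mfderiv 𝓘(ℝ, V) 𝓘(ℝ, V') f (g q) : V →L[ℝ] V').toLinearMap
        (D (g q) : Submodule ℝ V) := by
  ext v
  constructor
  · intro hv
    exact ⟨mfderiv 𝓘(ℝ, V') 𝓘(ℝ, V) g q v, hv, h.mfderiv_mfderiv' hq v⟩
  · rintro ⟨w, hw, rfl⟩
    change (mfderiv 𝓘(ℝ, V') 𝓘(ℝ, V) g q (mfderiv 𝓘(ℝ, V) 𝓘(ℝ, V') f (g q) w) : V) ∈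
      (D (g q) : Submodule ℝ V)
    rw [h.mfderiv_mfderiv_of_eq hq]
    exact hw

theorem tangentBundle_mk_congr {q q' : N'} (hq : q = q') (v : V') :
    (⟨q, v⟩ : TangentBundle 𝓘(ℝ, V') N') = ⟨q', v⟩ := by
  subst hq; rfl

/-- A local frame `X i` of `D` is pushed forward to `Tf ∘ X i ∘ g`: smooth as a composite with the
tangent map of `f`, independent because `Tf` is injective, and spanning the image of `D`. -/
theorem isSmoothOn_comap [IsManifold 𝓘(ℝ, V) ∞ N] [IsManifold 𝓘(ℝ, V') ∞ N']
    (h : IsDiffeoOn V V' f g W W') {D : TangentDistribution V N} {k : ℕ} (hD : D.IsSmoothOn V k W) :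
    (D.comap g : TangentDistribution V' N').IsSmoothOn V' k W' := by
  intro q hq
  obtain ⟨U, hU, hpU, X, hX, hXD⟩ := hD (g q) (h.mapsTo' hq)
  refine ⟨W' ∩ g ⁻¹' U, h.contMDiffOn'.continuousOn.isOpen_inter_preimage h.isOpen' hU,
    ⟨hq, hpU⟩, fun i q => (mfderiv 𝓘(ℝ, V) 𝓘(ℝ, V') f (g q) (X i (g q)) : V'), fun i => ?_, ?_⟩
  · have h1 := h.contMDiffOn.contMDiffOn_tangentMapWithin (m := ∞) (by simp) h.isOpen.uniqueMDiffOn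
    have h2 := (hX i).comp (t := U) (h.contMDiffOn'.mono inter_subset_left)
      (s := W' ∩ g ⁻¹' U) (fun q hq => hq.2)
    have h3 := h1.comp h2 (fun q hq => h.mapsTo' hq.1)
    refine h3.congr fun q hq => ?_
    simp only [Function.comp_apply, tangentMapWithin]
    rw [mfderivWithin_of_isOpen h.isOpen (h.mapsTo' hq.1)]
    exact tangentBundle_mk_congr (h.rightInvOn hq.1).symm _
  · rintro q ⟨hq, hqU⟩
    obtain ⟨h1, h2⟩ := hXD (g q) hqU
    constructor
    · refine LinearIndependent.map' (M' := V') h1 (mfderiv 𝓘(ℝ, V) 𝓘(ℝ, V') f (g q)).toLinearMap ?_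
      refine LinearMap.ker_eq_bot.2 fun v w hvw => ?_
      have := congrArg (fun u => (mfderiv 𝓘(ℝ, V') 𝓘(ℝ, V) g q u : V)) hvw
      exact (h.mfderiv_mfderiv_of_eq hq v).symm.trans (this.trans (h.mfderiv_mfderiv_of_eq hq w))
    · refine Eq.trans ?_ (h.comap_eq_map D hq).symm
      rw [← h2]
      refine Eq.trans ?_ (Submodule.map_span _ _).symm
      rw [← range_comp]
      rfl

variable {m : ℕ} {M : Type*} [TopologicalSpace M] [ChartedSpace (EuclideanSpace ℝ (Fin m)) M]
  {pr : N → M} {pr' : N' → M}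

/-- By the chain rule the range of `T(f ∘ ψ)` is the image under `Tf` of the range of `Tψ`, and
`D.comap g` is the image of `D`. The map `f` covers the identity of `M`, so it sends sections to
sections. -/
theorem isIntegralSection_comp (h : IsDiffeoOn V V' f g W W') (hpr : ∀ p ∈ W, pr' (f p) = pr p)
    {D : TangentDistribution V N} {ψ : M → N} {U : Set M}
    (hψ : IsIntegralSection m V pr D W ψ U) :
    IsIntegralSection m V' pr' (D.comap g) W' (f ∘ ψ) U where
  isSection := ⟨hψ.isSection.isOpen, h.contMDiffOn.comp hψ.isSection.smooth hψ.mapsTo,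
    fun x hx => (hpr _ (hψ.mapsTo hx)).trans (hψ.isSection.proj x hx)⟩
  mapsTo := h.mapsTo.comp hψ.mapsTo
  tangent x hx := by
    have hp := hψ.mapsTo hx
    have hψx : MDifferentiableAt (𝓡 m) 𝓘(ℝ, V) ψ x :=
      (hψ.isSection.smooth.contMDiffAt (hψ.isSection.isOpen.mem_nhds hx)).mdifferentiableAt (by simp)
    have h1 := mfderiv_comp x (h.mdifferentiableAt hp) hψx
    rw [h1]
    refine Eq.trans ?_ (h.comap_eq_map D (h.mapsTo hp)).symm
    have h2 : g (f (ψ x)) = ψ x := h.leftInvOn hp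
    simp only [Function.comp_apply]
    rw [h2, ← hψ.tangent x hx]
    exact LinearMap.range_comp (mfderiv (𝓡 m) 𝓘(ℝ, V) ψ x : Base m →L[ℝ] V).toLinearMap
      (mfderiv 𝓘(ℝ, V) 𝓘(ℝ, V') f (ψ x) : V →L[ℝ] V').toLinearMap

theorem isIntegralSection_congr {D D' : TangentDistribution V N} (hD : ∀ p ∈ W, D p = D' p)
    {ψ : M → N} {U : Set M} (hψ : IsIntegralSection m V pr D W ψ U) :
    IsIntegralSection m V pr D' W ψ U :=
  ⟨hψ.isSection, hψ.mapsTo, fun x hx => (hψ.tangent x hx).trans (hD _ (hψ.mapsTo hx))⟩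

/-- The forward statement applied to the inverse diffeomorphism; pushing `D` forth and back returns
`D` on `W`, the only place where an integral section sees it. -/
theorem isIntegralSection_of_comap (h : IsDiffeoOn V V' f g W W')
    (hpr : ∀ p ∈ W, pr' (f p) = pr p) {D : TangentDistribution V N} {ψ : M → N'} {U : Set M}
    (hψ : IsIntegralSection m V' pr' (D.comap g) W' ψ U) :
    IsIntegralSection m V pr D W (g ∘ ψ) U := by
  refine isIntegralSection_congr (fun p hp => h.comap_comap D hp)
    (h.symm.isIntegralSection_comp (fun q hq => ?_) hψ)
  rw [← hpr _ (h.mapsTo' hq), h.rightInvOn hq]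

theorem isIntegrableTransverse_comap [IsManifold 𝓘(ℝ, V) ∞ N] [IsManifold 𝓘(ℝ, V') ∞ N']
    (h : IsDiffeoOn V V' f g W W') (hpr : ∀ p ∈ W, pr' (f p) = pr p)
    (hpr' : ∀ p ∈ W, MDifferentiableAt 𝓘(ℝ, V) (𝓡 m) pr p) {D : TangentDistribution V N}
    (hD : IsIntegrableTransverse m V pr D W) :
    IsIntegrableTransverse m V' pr' (D.comap g) W' where
  smooth := h.isSmoothOn_comap hD.smooth
  transverse q hq := by
    have hp := h.mapsTo' hq
    have h1 : HasMFDerivAt 𝓘(ℝ, V') (𝓡 m) pr' q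
        ((mfderiv 𝓘(ℝ, V) (𝓡 m) pr (g q) : V →L[ℝ] Base m).comp
          (mfderiv 𝓘(ℝ, V') 𝓘(ℝ, V) g q : V' →L[ℝ] V)) := by
      refine (HasMFDerivAt.comp q (hpr' _ hp).hasMFDerivAt
        (h.symm.mdifferentiableAt hq).hasMFDerivAt).congr_of_eventuallyEq ?_
      filter_upwards [h.isOpen'.mem_nhds hq] with q' hq'
      rw [Function.comp_apply, ← hpr _ (h.mapsTo' hq'), h.rightInvOn hq']
    rw [h1.mfderiv]
    -- Both the distribution and the vertical space at `q` are preimages under the isomorphism `T_q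
    -- g`, and taking preimages under an isomorphism preserves complements.
    let T : V' ≃ₗ[ℝ] V :=
      { (mfderiv 𝓘(ℝ, V') 𝓘(ℝ, V) g q : V' →L[ℝ] V).toLinearMap with
        invFun := (mfderiv 𝓘(ℝ, V) 𝓘(ℝ, V') f (g q) : V →L[ℝ] V')
        left_inv := h.mfderiv_mfderiv' hq
        right_inv := h.mfderiv_mfderiv_of_eq hq }
    exact (Submodule.orderIsoMapComap T).symm.isCompl (hD.transverse _ hp)
  integrable q hq := by
    obtain ⟨ψ, U, hψ, hU, hψq⟩ := hD.integrable (g q) (h.mapsTo' hq)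
    have h1 : pr (g q) = pr' q := by rw [← hpr _ (h.mapsTo' hq), h.rightInvOn hq]
    rw [h1] at hU hψq
    exact ⟨f ∘ ψ, U, h.isIntegralSection_comp hpr hψ, hU, by
      rw [Function.comp_apply, hψq, h.rightInvOn hq]⟩

/-- An integral section `ψ` of the pushed distribution gives the integral section `g ∘ ψ` of `D`.
With `Ω' = g^*Ω`, the equation for `ψ` and the vector `X` is the equation for `g ∘ ψ` and the vector
`Tg X`. -/
theorem isFieldSolution_comap [IsManifold 𝓘(ℝ, V) ∞ N] [IsManifold 𝓘(ℝ, V') ∞ N']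
    (h : IsDiffeoOn V V' f g W W') (hpr : ∀ p ∈ W, pr' (f p) = pr p)
    (hpr' : ∀ p ∈ W, MDifferentiableAt 𝓘(ℝ, V) (𝓡 m) pr p) {Ω : DForm V N (m + 1)}
    {Ω' : DForm V' N' (m + 1)} (hΩ : ∀ q ∈ W', Ω' q = Ω.pullback (V := V') g q)
    {D : TangentDistribution V N} (hD : IsFieldSolution m V pr Ω D W) :
    IsFieldSolution m V' pr' Ω' (D.comap g) W' where
  distribution := h.isIntegrableTransverse_comap hpr hpr' hD.distribution
  equation ψ U hψ x hx X u := by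
    have hψx : MDifferentiableAt (𝓡 m) 𝓘(ℝ, V') ψ x :=
      (hψ.isSection.smooth.contMDiffAt (hψ.isSection.isOpen.mem_nhds hx)).mdifferentiableAt (by simp)
    have h1 := hD.equation _ U (h.isIntegralSection_of_comap hpr hψ) x hx
      (mfderiv 𝓘(ℝ, V') 𝓘(ℝ, V) g (ψ x) X) u
    rw [mfderiv_comp x (h.symm.mdifferentiableAt (hψ.mapsTo hx)) hψx] at h1
    rw [hΩ _ (hψ.mapsTo hx)]
    refine Eq.trans ?_ h1
    simp only [DForm.pullback, ContinuousAlternatingMap.compContinuousLinearMap_apply]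
    refine congrArg (Ω (g (ψ x))) ?_
    funext i
    refine Fin.cases ?_ (fun i => ?_) i <;> rfl

/-- Pull-back of forms by the two mutually inverse diffeomorphisms. -/
theorem eq_pullback_symm (h : IsDiffeoOn V V' f g W W') {k : ℕ} {Ω : DForm V N k}
    {Ω' : DForm V' N' k} (hΩ : ∀ q ∈ W', Ω' q = Ω.pullback (V := V') g q) {p : N} (hp : p ∈ W) :
    Ω p = Ω'.pullback (V := V) f p := by
  have h1 : g (f p) = p := h.leftInvOn hp
  ext v
  have h2 : (fun i => (mfderiv 𝓘(ℝ, V') 𝓘(ℝ, V) g (f p) (mfderiv 𝓘(ℝ, V) 𝓘(ℝ, V') f p (v i)) : V))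
      = v := funext fun i => h.mfderiv_mfderiv hp (v i)
  have h3 := congrFun (congrArg DFunLike.coe (hΩ (f p) (h.mapsTo hp)))
    (fun i => mfderiv 𝓘(ℝ, V) 𝓘(ℝ, V') f p (v i))
  refine Eq.trans ?_ h3.symm
  change (Ω p : V [⋀^Fin k]→L[ℝ] ℝ) v = (Ω (g (f p)) : V [⋀^Fin k]→L[ℝ] ℝ)
    (fun i => (mfderiv 𝓘(ℝ, V') 𝓘(ℝ, V) g (f p) (mfderiv 𝓘(ℝ, V) 𝓘(ℝ, V') f p (v i)) : V))
  rw [h2, h1]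

theorem pullback_comp_eq {Y : Type*} [NormedAddCommGroup Y] [NormedSpace ℝ Y] {S : Type*}
    [TopologicalSpace S] [ChartedSpace Y S] (h : IsDiffeoOn V V' f g W W') {k : ℕ}
    {Ω : DForm V N k} {Ω' : DForm V' N' k} (hΩ : ∀ p ∈ W, Ω p = Ω'.pullback (V := V) f p)
    {s : S → N} {x : S} (hs : MDifferentiableAt 𝓘(ℝ, Y) 𝓘(ℝ, V) s x) (hx : s x ∈ W) :
    Ω'.pullback (V := Y) (f ∘ s) x = Ω.pullback (V := Y) s x := by
  simp only [DForm.pullback]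
  rw [mfderiv_comp x (h.mdifferentiableAt hx) hs, hΩ _ hx]
  rfl

/-- Naturality of `d`. Each side is computed in the preferred chart at its own point, so the
statement reduces to naturality of `extDeriv` on normed spaces under `F = χ ∘ g ∘ φ⁻¹`.
Differentiability of the coefficients at the single point `χ (g q)` suffices. -/
theorem extd_pullback [IsManifold 𝓘(ℝ, V) ∞ N] [IsManifold 𝓘(ℝ, V') ∞ N']
    (h : IsDiffeoOn V V' f g W W') {k : ℕ} {η : DForm V N k} {η' : DForm V' N' k}
    (hη : ∀ q ∈ W', η' q = η.pullback (V := V') g q) {q : N'} (hq : q ∈ W')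
    (hd : DifferentiableAt ℝ (η.inChart (chartAt V (g q))) (chartAt V (g q) (g q))) :
    η'.extd q = η.extd.pullback (V := V') g q := by
  set φ := chartAt V' q with hφ
  set χ := chartAt V (g q) with hχ
  have hφm : φ.MDifferentiable 𝓘(ℝ, V') 𝓘(ℝ, V') := mdifferentiable_chart q
  have hχm : χ.MDifferentiable 𝓘(ℝ, V) 𝓘(ℝ, V) := mdifferentiable_chart (g q)
  have hqs : q ∈ φ.source := mem_chart_source V' q
  have hgs : g q ∈ χ.source := mem_chart_source V (g q)
  let F : V' → V := fun z => χ (g (φ.symm z))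
  have hcont : ContinuousAt (fun z => g (φ.symm z)) (φ q) := by
    refine ContinuousAt.comp ?_ (φ.continuousAt_symm (φ.map_source hqs))
    rw [φ.left_inv hqs]
    exact (h.symm.contMDiffAt hq).continuousAt
  have hFq : F (φ q) = χ (g q) := by simp only [F, φ.left_inv hqs]
  -- An exterior derivative depends on the germ of the coefficients, so the two coordinate
  -- expressions must be compared on a neighbourhood of `φ q`.
  have hnear : ∀ᶠ z in nhds (φ q), z ∈ φ.target ∧ φ.symm z ∈ W' ∧ g (φ.symm z) ∈ χ.source := by
    refine Filter.Eventually.and (φ.open_target.mem_nhds (φ.map_source hqs)) (.and ?_ ?_)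
    · exact (φ.continuousAt_symm (φ.map_source hqs)).preimage_mem_nhds
        (h.isOpen'.mem_nhds (by rwa [φ.left_inv hqs]))
    · exact hcont.preimage_mem_nhds (χ.open_source.mem_nhds (by rwa [φ.left_inv hqs]))
  have hFd : ∀ z, z ∈ φ.target → φ.symm z ∈ W' → g (φ.symm z) ∈ χ.source →
      fderiv ℝ F z = (mfderiv 𝓘(ℝ, V) 𝓘(ℝ, V) χ (g (φ.symm z)) : V →L[ℝ] V).comp
        ((mfderiv 𝓘(ℝ, V') 𝓘(ℝ, V) g (φ.symm z) : V' →L[ℝ] V).comp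
          (mfderiv 𝓘(ℝ, V') 𝓘(ℝ, V') φ.symm z : V' →L[ℝ] V')) := by
    intro z h1 h2 h3
    have h4 : HasMFDerivAt 𝓘(ℝ, V') 𝓘(ℝ, V) (fun z => g (φ.symm z)) z _ :=
      (h.symm.mdifferentiableAt h2).hasMFDerivAt.comp z (hφm.mdifferentiableAt_symm h1).hasMFDerivAt
    have h5 : HasMFDerivAt 𝓘(ℝ, V') 𝓘(ℝ, V) F z _ :=
      HasMFDerivAt.comp z (hχm.mdifferentiableAt h3).hasMFDerivAt h4
    refine HasFDerivAt.fderiv ?_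
    exact hasMFDerivAt_iff_hasFDerivAt.1 h5
  have hFs : ContDiffAt ℝ ∞ F (φ q) := by
    rw [← contMDiffAt_iff_contDiffAt]
    have h1 : ContMDiffAt 𝓘(ℝ, V') 𝓘(ℝ, V') ∞ φ.symm (φ q) :=
      (contMDiffOn_chart_symm (x := q)).contMDiffAt (φ.open_target.mem_nhds (φ.map_source hqs))
    have h2 : ContMDiffAt 𝓘(ℝ, V) 𝓘(ℝ, V) ∞ χ (g q) :=
      (contMDiffOn_chart (x := g q)).contMDiffAt (χ.open_source.mem_nhds hgs)
    have h3 : ContMDiffAt 𝓘(ℝ, V') 𝓘(ℝ, V) ∞ (χ ∘ g) q := h2.comp q (h.symm.contMDiffAt hq)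
    exact ContMDiffAt.comp (φ q) (g := χ ∘ g) (by rwa [φ.left_inv hqs]) h1
  have hev : η'.inChart φ =ᶠ[nhds (φ q)]
      fun z => (η.inChart χ (F z)).compContinuousLinearMap (fderiv ℝ F z) := by
    filter_upwards [hnear] with z ⟨h1, h2, h3⟩
    rw [hFd z h1 h2 h3]
    have h4 : χ.symm (F z) = g (φ.symm z) := χ.left_inv h3
    have h5 := hχm.symm_comp_deriv h3
    simp only [DForm.inChart, hη _ h2, DForm.pullback]
    rw [h4]
    ext v
    change (η (g (φ.symm z)) : V [⋀^Fin k]→L[ℝ] ℝ) _ = (η (g (φ.symm z)) : V [⋀^Fin k]→L[ℝ] ℝ) _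
    refine congrArg _ (funext fun i => ?_)
    -- The two arguments of `η` differ by the factor `Tχ⁻¹ ∘ Tχ`, which is the identity.
    exact (congrArg (fun T : V →L[ℝ] V => T (mfderiv 𝓘(ℝ, V') 𝓘(ℝ, V) g (φ.symm z)
      (mfderiv 𝓘(ℝ, V') 𝓘(ℝ, V') φ.symm z (v i)))) h5).symm
  have h6 : DifferentiableAt ℝ (η.inChart χ) (F (φ q)) := by rwa [hFq]
  have h7 := hev.extDeriv_eq.trans
    (extDeriv_pullback h6 hFs (r := ∞) (by
      simpa using WithTop.coe_le_coe.2 (le_top : (2 : ℕ∞) ≤ ⊤)))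
  have h8 : (fderiv ℝ F (φ q)).comp (mfderiv 𝓘(ℝ, V') 𝓘(ℝ, V') φ q : V' →L[ℝ] V') =
      (mfderiv 𝓘(ℝ, V) 𝓘(ℝ, V) χ (g q) : V →L[ℝ] V).comp
        (mfderiv 𝓘(ℝ, V') 𝓘(ℝ, V) g q : V' →L[ℝ] V) := by
    rw [hFd _ (φ.map_source hqs) (by rwa [φ.left_inv hqs]) (by rwa [φ.left_inv hqs]),
      φ.left_inv hqs]
    have := hφm.symm_comp_deriv hqs
    ext v
    exact congrArg (fun w : V' => (mfderiv 𝓘(ℝ, V) 𝓘(ℝ, V) χ (g q) : V →L[ℝ] V)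
      ((mfderiv 𝓘(ℝ, V') 𝓘(ℝ, V) g q : V' →L[ℝ] V) w)) (congrArg (fun T : V' →L[ℝ] V' => T v) this)
  simp only [DForm.extd, DForm.pullback]
  rw [← hφ, ← hχ, h7, hFq]
  ext v
  change extDeriv (η.inChart χ) (χ (g q)) _ = extDeriv (η.inChart χ) (χ (g q)) _
  refine congrArg _ (funext fun i => ?_)
  exact congrArg (fun T : V' →L[ℝ] V => T (v i)) h8

end IsDiffeoOn
end Diffeo

/-! ### Trace pairing, top-degree forms and the Cartan form in coordinates -/

section Flat
variable {m n : ℕ}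

/-- The isomorphism `ℓ ↦ (y ↦ ∑ i, ℓ (dx^i ⊗ y) ∂/∂x^i)`, dual to the trace pairing. -/
def momentumMap (m : ℕ) (Y : Type*) [NormedAddCommGroup Y] [NormedSpace ℝ Y] :
    ((Base m →L[ℝ] Y) →L[ℝ] ℝ) →L[ℝ] (Y →L[ℝ] Base m) :=
  ∑ i : Fin m, ((ContinuousLinearMap.smulRightL ℝ Y (Base m)).flip
    (EuclideanSpace.single i (1 : ℝ))).comp
    ((ContinuousLinearMap.compL ℝ Y (Base m →L[ℝ] Y) ℝ).flip
      (ContinuousLinearMap.smulRightL ℝ (Base m) Y (EuclideanSpace.proj i : Base m →L[ℝ] ℝ)))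

theorem momentumMap_apply {Y : Type*} [NormedAddCommGroup Y] [NormedSpace ℝ Y]
    (l : (Base m →L[ℝ] Y) →L[ℝ] ℝ) : momentumMap m Y l =
      ∑ i : Fin m, (l.comp (ContinuousLinearMap.smulRightL ℝ (Base m) Y
        (EuclideanSpace.proj i : Base m →L[ℝ] ℝ))).smulRight (EuclideanSpace.single i (1 : ℝ)) := by
  simp only [momentumMap, sum_apply]
  rfl

theorem momentumMap_apply_apply {Y : Type*} [NormedAddCommGroup Y] [NormedSpace ℝ Y]
    (l : (Base m →L[ℝ] Y) →L[ℝ] ℝ) (y : Y) (k : Fin m) :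
    momentumMap m Y l y k = l ((EuclideanSpace.proj k : Base m →L[ℝ] ℝ).smulRight y) := by
  rw [momentumMap_apply]
  change (∑ i : Fin m, _ : Y →L[ℝ] Base m) y k = _
  simp [Pi.single_apply, ContinuousLinearMap.smulRightL]

theorem sum_proj_smul_single (x : Base m) :
    ∑ i : Fin m, x i • (EuclideanSpace.single i (1 : ℝ) : Base m) = x := by
  ext k
  simp [Pi.single_apply]

/-- The pairing of `momentumMap l` with a linear form. -/
theorem apply_momentumMap {Y : Type*} [NormedAddCommGroup Y] [NormedSpace ℝ Y]
    (l : (Base m →L[ℝ] Y) →L[ℝ] ℝ) (y : Y) (μ : Base m →L[ℝ] ℝ) :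
    μ (momentumMap m Y l y) = l (μ.smulRight y) := by
  have h : μ.smulRight y = ∑ i : Fin m, μ (EuclideanSpace.single i (1 : ℝ)) •
      (EuclideanSpace.proj i : Base m →L[ℝ] ℝ).smulRight y := by
    ext1 x
    conv_lhs => rw [← sum_proj_smul_single x]
    simp [smul_smul, mul_comm]
  rw [h, map_sum]
  conv_lhs => rw [← sum_proj_smul_single (momentumMap m Y l y)]
  simp [momentumMap_apply_apply, mul_comm]

/-- The left side is the trace of `momentumMap l ∘ B`; expanding `B` as the sum of the maps `dx^k ⊗
B e_k` identifies it with `l B`. This is the identity behind the cancellation in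
`fderiv_localCartan`. -/
theorem sum_momentumMap_comp {Y : Type*} [NormedAddCommGroup Y] [NormedSpace ℝ Y]
    (l : (Base m →L[ℝ] Y) →L[ℝ] ℝ) (B : Base m →L[ℝ] Y) :
    ∑ k : Fin m, momentumMap m Y l (B (EuclideanSpace.single k (1 : ℝ))) k = l B := by
  simp only [momentumMap_apply_apply, ← map_sum]
  congr 1
  ext1 x
  conv_rhs => rw [← sum_proj_smul_single x]
  simp

/-- A top degree form is determined by its value on the standard basis. -/
theorem topForm_ext {η η' : Base m [⋀^Fin m]→L[ℝ] ℝ}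
    (h : η (fun k => EuclideanSpace.single k (1 : ℝ)) = η' fun k => EuclideanSpace.single k (1 : ℝ)) :
    η = η' := by
  apply ContinuousAlternatingMap.toAlternatingMap_injective
  -- Every top-degree form is its value on the basis times the determinant.
  rw [AlternatingMap.eq_smul_basis_det (EuclideanSpace.basisFun (Fin m) ℝ).toBasis η.toAlternatingMap,
    AlternatingMap.eq_smul_basis_det (EuclideanSpace.basisFun (Fin m) ℝ).toBasis η'.toAlternatingMap]
  have hb : ((EuclideanSpace.basisFun (Fin m) ℝ).toBasis : Fin m → Base m) =
      fun k => EuclideanSpace.single k (1 : ℝ) := by funext k; simp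
  rw [hb]
  exact congrArg (· • _) h

theorem topForm_sum_update (η : Base m [⋀^Fin m]→L[ℝ] ℝ) (K : Base m →L[ℝ] Base m) :
    ∑ k, η (Function.update (fun i => EuclideanSpace.single i (1 : ℝ)) k
      (K (EuclideanSpace.single k (1 : ℝ)))) =
    (∑ k, K (EuclideanSpace.single k (1 : ℝ)) k) * η fun k => EuclideanSpace.single k (1 : ℝ) := by
  rw [Finset.sum_mul]
  refine Finset.sum_congr rfl fun k _ => ?_
  conv_lhs => rw [← sum_proj_smul_single (K (EuclideanSpace.single k (1 : ℝ)))]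
  refine (η.toAlternatingMap.map_update_sum Finset.univ k _ _).trans ?_
  change ∑ i, η (Function.update _ _ _) = _
  -- Only the diagonal entry of `K` survives: replacing `e_k` by `e_i` with `i ≠ k` repeats the
  -- vector `e_i`.
  rw [Finset.sum_eq_single k]
  · rw [ContinuousAlternatingMap.map_update_smul]
    simp
  · intro i _ hi
    rw [ContinuousAlternatingMap.map_update_smul]
    have : η (Function.update (fun i => EuclideanSpace.single i (1 : ℝ)) k
        (EuclideanSpace.single i (1 : ℝ))) = 0 :=
      η.map_eq_zero_of_eq _ (i := k) (j := i) (by simp [hi]) hi.symm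
    rw [this, smul_zero]
  · simp

/-- `∑ k, η (u₁, …, K u_k, …, u_m) = tr K · η (u₁, …, u_m)` for top degree forms. -/
theorem topForm_fderivComp (η : Base m [⋀^Fin m]→L[ℝ] ℝ) (K : Base m →L[ℝ] Base m) :
    η.fderivCompContinuousLinearMap (.id ℝ (Base m)) K =
      (∑ k, K (EuclideanSpace.single k (1 : ℝ)) k) • η := by
  refine topForm_ext ?_
  -- The coefficient `0` isolates the sum over slots from `contactForm`.
  have h := contactForm_apply 0 η (.id ℝ (Base m)) K fun k => EuclideanSpace.single k (1 : ℝ)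
  simp only [contactForm, zero_smul, zero_add, zero_mul] at h
  rw [h]
  exact topForm_sum_update η K

/-- The trace formula on `Base m`, pulled back by `P`. It applies to terms whose modified slot still
factors through `P`, that is, to the horizontal part of a contact form. -/
theorem topForm_fderivComp_comp {A : Type*} [NormedAddCommGroup A] [NormedSpace ℝ A]
    (η : Base m [⋀^Fin m]→L[ℝ] ℝ) (K : Base m →L[ℝ] Base m) (P : A →L[ℝ] Base m) :
    η.fderivCompContinuousLinearMap P (K.comp P) =
      (∑ k, K (EuclideanSpace.single k (1 : ℝ)) k) • η.compContinuousLinearMap P := by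
  have h := congrArg (fun α => α.compContinuousLinearMap P) (topForm_fderivComp η K)
  refine Eq.trans ?_ h
  ext v
  simp only [ContinuousAlternatingMap.fderivCompContinuousLinearMap_apply,
    ContinuousAlternatingMap.compContinuousLinearMap_apply]
  refine Finset.sum_congr rfl fun k _ => congrArg η (funext fun i => ?_)
  by_cases hik : i = k
  · subst hik; simp
  · simp [hik]

/-- The coordinate expression of the Cartan form, in fibred coordinates in which the volume form is
`v`. -/
def localCartan (L : JetModel m n → ℝ) (v : Base m → Base m [⋀^Fin m]→L[ℝ] ℝ) (z : JetModel m n) :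
    (Base m × Base n) [⋀^Fin m]→L[ℝ] ℝ :=
  contactForm (L z) (v z.1.1) (.fst ℝ (Base m) (Base n))
    ((momentumMap m (Base n) ((fderiv ℝ L z).comp (.inr ℝ (Base m × Base n) (Base m →L[ℝ] Base n)))).comp
      (.snd ℝ (Base m) (Base n) - z.2.comp (.fst ℝ (Base m) (Base n))))

/-- The Hessian of `L` in the directions of the fibre coordinates `y^α_i`. -/
def fibreHessian (L : JetModel m n → ℝ) (z : JetModel m n) (B : Base m →L[ℝ] Base n) :
    (Base m →L[ℝ] Base n) →L[ℝ] ℝ :=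
  (fderiv ℝ (fderiv ℝ L) z (0, B)).comp (.inr ℝ (Base m × Base n) (Base m →L[ℝ] Base n))

theorem fibreHessian_symm {L : JetModel m n → ℝ} {z : JetModel m n} (hL : ContDiffAt ℝ ∞ L z)
    (B C : Base m →L[ℝ] Base n) : fibreHessian L z B C = fibreHessian L z C B :=
  hL.isSymmSndFDerivAt (by simpa using WithTop.coe_le_coe.2 (le_top : (2 : ℕ∞) ≤ ⊤)) _ _

/-! ### Derivative of the Cartan form along the fibres -/

section Calculus
variable {X Y : Type*} [NormedAddCommGroup X] [NormedSpace ℝ X] [NormedAddCommGroup Y]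
  [NormedSpace ℝ Y] {k : ℕ} {L : (X × Y) × (X →L[ℝ] Y) → ℝ} {v : X → X [⋀^Fin k]→L[ℝ] ℝ}
  {P : (X × Y) × (X →L[ℝ] Y) → Y →L[ℝ] X} {z : (X × Y) × (X →L[ℝ] Y)}

theorem differentiableAt_clm {Z A G : Type*} [NormedAddCommGroup Z] [NormedSpace ℝ Z]
    [NormedAddCommGroup A] [NormedSpace ℝ A] [NormedAddCommGroup G] [NormedSpace ℝ G]
    (Φ : A →L[ℝ] G) {f : Z → A} {z : Z} (hf : DifferentiableAt ℝ f z) :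
    DifferentiableAt ℝ (fun z => Φ (f z)) z :=
  Φ.differentiableAt.comp z hf

theorem differentiableAt_contactForm (hL : DifferentiableAt ℝ L z) (hv : DifferentiableAt ℝ v z.1.1)
    (hP : DifferentiableAt ℝ P z) :
    DifferentiableAt ℝ (fun z : (X × Y) × (X →L[ℝ] Y) => contactForm (L z) (v z.1.1) (.fst ℝ X Y)
      ((P z).comp (.snd ℝ X Y - z.2.comp (.fst ℝ X Y)))) z := by
  have h3 : DifferentiableAt ℝ (fun z : (X × Y) × (X →L[ℝ] Y) => v z.1.1) z :=
    DifferentiableAt.comp (g := v) z hv (differentiableAt_fst.fst)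
  have h5 : DifferentiableAt ℝ (fun z : (X × Y) × (X →L[ℝ] Y) => ContinuousLinearMap.snd ℝ X Y -
      z.2.comp (.fst ℝ X Y)) z :=
    (differentiableAt_const _).sub (differentiableAt_snd.clm_comp (differentiableAt_const _))
  have h6 : DifferentiableAt ℝ (fun z : (X × Y) × (X →L[ℝ] Y) =>
      (v z.1.1).compContinuousLinearMap (.fst ℝ X Y)) z :=
    h3.continuousAlternatingMapCompContinuousLinearMap (differentiableAt_const _)
  have h7 : DifferentiableAt ℝ (fun z : (X × Y) × (X →L[ℝ] Y) =>
      (v z.1.1).fderivCompContinuousLinearMap (.fst ℝ X Y)) z := by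
    let Φ : (X [⋀^Fin k]→L[ℝ] ℝ) →L[ℝ] ((X × Y →L[ℝ] X) →L[ℝ] (X × Y) [⋀^Fin k]→L[ℝ] ℝ) :=
      ContinuousAlternatingMap.fderivCompContinuousLinearMapCLM ℝ (.fst ℝ X Y)
    exact differentiableAt_clm (A := X [⋀^Fin k]→L[ℝ] ℝ) (G := (X × Y →L[ℝ] X) →L[ℝ] (X × Y) [⋀^Fin k]→L[ℝ] ℝ) Φ h3
  exact (hL.smul h6).add (h7.clm_apply (hP.clm_comp h5))

/-- The product rule along the line `t ↦ z + t (0, B)`. The base point does not move on it, so the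
volume form contributes no derivative, and `snd - A ∘ fst` changes at the rate `-B ∘ fst`. -/
theorem fderiv_contactForm (hL : DifferentiableAt ℝ L z) (hv : DifferentiableAt ℝ v z.1.1)
    (hP : DifferentiableAt ℝ P z) (B : X →L[ℝ] Y) :
    fderiv ℝ (fun z : (X × Y) × (X →L[ℝ] Y) => contactForm (L z) (v z.1.1) (.fst ℝ X Y)
      ((P z).comp (.snd ℝ X Y - z.2.comp (.fst ℝ X Y)))) z (0, B) =
      fderiv ℝ L z (0, B) • (v z.1.1).compContinuousLinearMap (.fst ℝ X Y) +
        (v z.1.1).fderivCompContinuousLinearMap (.fst ℝ X Y)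
          ((fderiv ℝ P z (0, B)).comp (.snd ℝ X Y - z.2.comp (.fst ℝ X Y)) -
            ((P z).comp B).comp (.fst ℝ X Y)) := by
  have hγ : HasDerivAt (fun t : ℝ => z + t • ((0, B) : (X × Y) × (X →L[ℝ] Y))) (0, B) 0 := by
    have := ((hasDerivAt_id (0 : ℝ)).smul_const ((0, B) : (X × Y) × (X →L[ℝ] Y))).const_add z
    rwa [one_smul] at this
  have h0 : z = z + (0 : ℝ) • ((0, B) : (X × Y) × (X →L[ℝ] Y)) := by rw [zero_smul, add_zero]
  have h1 := HasFDerivAt.comp_hasDerivAt_of_eq 0 hL.hasFDerivAt hγ h0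
  have h4 := HasFDerivAt.comp_hasDerivAt_of_eq 0 hP.hasFDerivAt hγ h0
  have h3 := HasFDerivAt.comp_hasDerivAt_of_eq 0
    (differentiableAt_contactForm hL hv hP).hasFDerivAt hγ h0
  have h5 : HasDerivAt (fun t : ℝ => ContinuousLinearMap.snd ℝ X Y -
      (z + t • ((0, B) : (X × Y) × (X →L[ℝ] Y))).2.comp (.fst ℝ X Y))
      (-(B.comp (.fst ℝ X Y))) 0 := by
    have h6 : HasDerivAt (fun t : ℝ => (z + t • ((0, B) : (X × Y) × (X →L[ℝ] Y))).2) B 0 :=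
      (ContinuousLinearMap.snd ℝ (X × Y) (X →L[ℝ] Y)).hasFDerivAt.comp_hasDerivAt 0 hγ
    have := (hasDerivAt_const (0 : ℝ) (ContinuousLinearMap.snd ℝ X Y)).fun_sub
      (h6.clm_comp (hasDerivAt_const (0 : ℝ) (ContinuousLinearMap.fst ℝ X Y)))
    simpa using this
  have h6 := h4.clm_comp h5
  have h7 := (h1.smul_const ((v z.1.1).compContinuousLinearMap (.fst ℝ X Y))).add
    (((v z.1.1).fderivCompContinuousLinearMap (.fst ℝ X Y)).hasFDerivAt.comp_hasDerivAt 0 h6)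
  have h8 := h7.congr_of_eventuallyEq (f₁ := (fun z : (X × Y) × (X →L[ℝ] Y) =>
    contactForm (L z) (v z.1.1) (.fst ℝ X Y) ((P z).comp (.snd ℝ X Y - z.2.comp (.fst ℝ X Y)))) ∘
      fun t : ℝ => z + t • ((0, B) : (X × Y) × (X →L[ℝ] Y))) (.of_forall fun t => by
    have : (z + t • ((0, B) : (X × Y) × (X →L[ℝ] Y))).1.1 = z.1.1 := by
      simp only [Prod.fst_add, Prod.smul_fst, smul_zero, add_zero]
    simp only [Function.comp_apply, contactForm, this]
    rfl)
  rw [h3.unique h8]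
  simp only [Function.comp_apply, ← h0]
  rw [ContinuousLinearMap.comp_neg, ← sub_eq_add_neg, ContinuousLinearMap.comp_assoc]

theorem hasFDerivAt_comp_clm {Z F G : Type*} [NormedAddCommGroup Z] [NormedSpace ℝ Z]
    [NormedAddCommGroup F] [NormedSpace ℝ F] [NormedAddCommGroup G] [NormedSpace ℝ G]
    {f : Z → Z →L[ℝ] ℝ} {f' : Z →L[ℝ] Z →L[ℝ] ℝ} {z : Z} (hf : HasFDerivAt f f' z)
    (Λ : (F →L[ℝ] ℝ) →L[ℝ] G) (i : F →L[ℝ] Z) :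
    HasFDerivAt (fun z => Λ ((f z).comp i))
      (Λ.comp (((ContinuousLinearMap.compL ℝ F Z ℝ).flip i).comp f')) z :=
  Λ.hasFDerivAt.comp z (((ContinuousLinearMap.compL ℝ F Z ℝ).flip i).hasFDerivAt.comp z hf)
end Calculus

theorem hasFDerivAt_momentumMap_fderiv {L : JetModel m n → ℝ} {z : JetModel m n}
    (hL : ContDiffAt ℝ ∞ L z) :
    HasFDerivAt (fun z => momentumMap m (Base n) ((fderiv ℝ L z).comp
      (.inr ℝ (Base m × Base n) (Base m →L[ℝ] Base n))))
      ((momentumMap m (Base n)).comp (((ContinuousLinearMap.compL ℝ _ _ _).flip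
        (.inr ℝ (Base m × Base n) (Base m →L[ℝ] Base n))).comp (fderiv ℝ (fderiv ℝ L) z))) z := by
  have h2 : HasFDerivAt (fderiv ℝ L) (fderiv ℝ (fderiv ℝ L) z) z :=
    ((hL.fderiv_right (m := ∞) (by simp)).differentiableAt (by simp)).hasFDerivAt
  exact hasFDerivAt_comp_clm h2 _ _

theorem differentiableAt_localCartan {L : JetModel m n → ℝ}
    {v : Base m → Base m [⋀^Fin m]→L[ℝ] ℝ} {z : JetModel m n} (hL : ContDiffAt ℝ ∞ L z)
    (hv : DifferentiableAt ℝ v z.1.1) : DifferentiableAt ℝ (localCartan L v) z :=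
  differentiableAt_contactForm (hL.differentiableAt (by simp)) hv
    (hasFDerivAt_momentumMap_fderiv hL).differentiableAt

/-- The derivative of the coefficient `L` gives `D_A L (B)` times the volume; the variation of `dy -
A dx` gives minus the trace of `p ∘ B` times the volume, where `p` is the momentum. These are equal
and opposite, so only the variation of the momentum, which is the Hessian, remains. -/
theorem fderiv_localCartan {L : JetModel m n → ℝ} {v : Base m → Base m [⋀^Fin m]→L[ℝ] ℝ}
    {z : JetModel m n} (hL : ContDiffAt ℝ ∞ L z) (hv : DifferentiableAt ℝ v z.1.1)
    (B : Base m →L[ℝ] Base n) : fderiv ℝ (localCartan L v) z (0, B) =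
      (v z.1.1).fderivCompContinuousLinearMap (.fst ℝ (Base m) (Base n))
        ((momentumMap m (Base n) (fibreHessian L z B)).comp
          (.snd ℝ (Base m) (Base n) - z.2.comp (.fst ℝ (Base m) (Base n)))) := by
  have h1 := fderiv_contactForm (hL.differentiableAt (by simp)) hv
    (hasFDerivAt_momentumMap_fderiv hL).differentiableAt B
  refine h1.trans ?_
  have h2 := topForm_fderivComp_comp (v z.1.1) ((momentumMap m (Base n) ((fderiv ℝ L z).comp
    (.inr ℝ (Base m × Base n) (Base m →L[ℝ] Base n)))).comp B) (.fst ℝ (Base m) (Base n))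
  have h3 := sum_momentumMap_comp ((fderiv ℝ L z).comp
    (.inr ℝ (Base m × Base n) (Base m →L[ℝ] Base n))) B
  simp only [ContinuousLinearMap.comp_apply, ContinuousLinearMap.inr_apply] at h2 h3
  rw [h3] at h2
  rw [← h2, (hasFDerivAt_momentumMap_fderiv hL).fderiv, ← map_add, add_sub_cancel]
  rfl

/-- If a semibasic form is `β` in coordinates, then `i(X) d(β)` is the derivative of `β` along `X`,
for `X` in the fibre. -/
theorem extDeriv_semibasic {Z F : Type*} [NormedAddCommGroup Z] [NormedSpace ℝ Z]
    [NormedAddCommGroup F] [NormedSpace ℝ F] {k : ℕ} {β : Z × F → Z [⋀^Fin k]→L[ℝ] ℝ} {z : Z × F}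
    (hβ : DifferentiableAt ℝ β z) (B : F) (w : Fin k → Z × F) :
    extDeriv (fun z => (β z).compContinuousLinearMap (.fst ℝ Z F)) z (Fin.cons (0, B) w) =
      fderiv ℝ β z (0, B) fun i => (w i).1 := by
  have h1 : HasFDerivAt (fun z => (β z).compContinuousLinearMap (.fst ℝ Z F))
      ((ContinuousAlternatingMap.compContinuousLinearMapCLM (.fst ℝ Z F)).comp (fderiv ℝ β z)) z := by
    let Φ : (Z [⋀^Fin k]→L[ℝ] ℝ) →L[ℝ] (Z × F) [⋀^Fin k]→L[ℝ] ℝ :=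
      ContinuousAlternatingMap.compContinuousLinearMapCLM (.fst ℝ Z F)
    exact Φ.hasFDerivAt.comp z hβ.hasFDerivAt
  rw [extDeriv, h1.fderiv, ContinuousAlternatingMap.alternatizeUncurryFin_apply,
    Fin.sum_univ_succ, Finset.sum_eq_zero, add_zero]
  · simp
    rfl
  · intro i _
    cases k with
    | zero => exact i.elim0
    | succ k =>
      -- In every term but the first, the fibre vector `(0, B)` stays among the arguments of a form
      -- pulled back by `fst`, which kills it.
      have h2 : (i.succ.removeNth (Fin.cons (0, B) w : Fin (k + 2) → Z × F)) 0 = (0, B) := by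
        simp [Fin.removeNth]
      rw [ContinuousLinearMap.comp_apply, ContinuousAlternatingMap.compContinuousLinearMapCLM_apply,
        ContinuousAlternatingMap.compContinuousLinearMap_apply,
        ContinuousAlternatingMap.map_coord_zero _ 0 (by simp [h2]), smul_zero]

/-- The fibre Hessian vanishes on the defect of holonomy of a solution of the field equation. -/
theorem apply_eq_zero_of_fderivComp {η : Base m [⋀^Fin m]→L[ℝ] ℝ} (hη : η ≠ 0)
    {l : (Base m →L[ℝ] Base n) →L[ℝ] ℝ} {Q : Base m × Base n →L[ℝ] Base n}
    {T : Base m →L[ℝ] Base m × Base n}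
    (hT : (ContinuousLinearMap.fst ℝ (Base m) (Base n)).comp T = .id ℝ (Base m))
    (h : η.fderivCompContinuousLinearMap (.fst ℝ (Base m) (Base n)) ((momentumMap m (Base n) l).comp Q)
      (fun k => T (EuclideanSpace.single k (1 : ℝ))) = 0) : l (Q.comp T) = 0 := by
  have hT' : ∀ x, (T x).1 = x := fun x => congrArg (fun S => S x) hT
  have h1 := contactForm_apply 0 η (.fst ℝ (Base m) (Base n)) ((momentumMap m (Base n) l).comp Q)
    fun k => T (EuclideanSpace.single k (1 : ℝ))
  simp only [contactForm, zero_smul, zero_add, zero_mul] at h1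
  rw [h] at h1
  have h2 := topForm_sum_update η ((momentumMap m (Base n) l).comp (Q.comp T))
  simp only [ContinuousLinearMap.comp_apply, ContinuousLinearMap.coe_fst', hT'] at h1 h2
  rw [← h1] at h2
  have h3 := sum_momentumMap_comp l (Q.comp T)
  simp only [ContinuousLinearMap.comp_apply] at h3
  rw [h3] at h2
  -- The sum is `l (Q ∘ T)` times the value of `η` on the standard basis, and a nonzero top form
  -- does not vanish on a basis.
  refine (mul_eq_zero.1 h2.symm).resolve_right fun h4 => hη (topForm_ext ?_)
  simpa using h4

end Flat

/-! ### Contact forms under linear maps -/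

section ContactForm
variable {m : ℕ} {A A' B B' : Type*} [NormedAddCommGroup A] [NormedSpace ℝ A]
  [NormedAddCommGroup A'] [NormedSpace ℝ A'] [NormedAddCommGroup B] [NormedSpace ℝ B]
  [NormedAddCommGroup B'] [NormedSpace ℝ B']

theorem contactForm_comp (c : ℝ) (η : B [⋀^Fin m]→L[ℝ] ℝ) (P Q : A →L[ℝ] B) (R : A' →L[ℝ] A) :
    (contactForm c η P Q).compContinuousLinearMap R = contactForm c η (P.comp R) (Q.comp R) := by
  ext v
  rw [ContinuousAlternatingMap.compContinuousLinearMap_apply, contactForm_apply, contactForm_apply]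
  rfl

theorem contactForm_pullback (c : ℝ) (η : B [⋀^Fin m]→L[ℝ] ℝ) (S : B' →L[ℝ] B)
    (P Q : A →L[ℝ] B') : contactForm c (η.compContinuousLinearMap S) P Q =
      contactForm c η (S.comp P) (S.comp Q) := by
  ext v
  rw [contactForm_apply, contactForm_apply]
  simp only [ContinuousAlternatingMap.compContinuousLinearMap_apply]
  congr 1
  refine Finset.sum_congr rfl fun k _ => congrArg η ?_
  exact Function.comp_update S _ k _
end ContactForm

/-! ### Differentiability of smooth forms in arbitrary charts -/

section Pullback
variable {V : Type*} [NormedAddCommGroup V] [NormedSpace ℝ V] {N : Type*} [TopologicalSpace N]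
  [ChartedSpace V N] [IsManifold 𝓘(ℝ, V) ∞ N]

/-- A smooth form is differentiable in every smooth chart. -/
theorem DForm.IsSmooth.differentiableAt_inChart {k : ℕ} {η : DForm V N k} (hη : η.IsSmooth)
    (e : OpenPartialHomeomorph N V) (he : ContMDiffOn 𝓘(ℝ, V) 𝓘(ℝ, V) ∞ e.symm e.target) {z : V}
    (hz : z ∈ e.target) : DifferentiableAt ℝ (η.inChart e) z := by
  -- Smoothness of a form is stated in preferred charts only, whereas the base chart of adapted
  -- coordinates need not be one. The expression in `e` is the pull-back, by the transition map `F`,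
  -- of the expression in `χ`.
  set χ := chartAt V (e.symm z) with hχ
  have hχm : χ.MDifferentiable 𝓘(ℝ, V) 𝓘(ℝ, V) := mdifferentiable_chart _
  have hes : e.symm z ∈ χ.source := mem_chart_source V _
  let F : V → V := fun z => χ (e.symm z)
  have hnear : ∀ᶠ w in nhds z, w ∈ e.target ∧ e.symm w ∈ χ.source :=
    Filter.Eventually.and (e.open_target.mem_nhds hz)
      ((e.continuousAt_symm hz).preimage_mem_nhds (χ.open_source.mem_nhds hes))
  have hes' : ∀ w ∈ e.target, ContMDiffAt 𝓘(ℝ, V) 𝓘(ℝ, V) ∞ e.symm w := fun w hw =>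
    he.contMDiffAt (e.open_target.mem_nhds hw)
  have hF : ContDiffAt ℝ ∞ F z := by
    rw [← contMDiffAt_iff_contDiffAt]
    have h2 : ContMDiffAt 𝓘(ℝ, V) 𝓘(ℝ, V) ∞ χ (e.symm z) :=
      (contMDiffOn_chart (x := e.symm z)).contMDiffAt (χ.open_source.mem_nhds hes)
    exact ContMDiffAt.comp z h2 (hes' z hz)
  have hev : η.inChart e =ᶠ[nhds z]
      fun w => (η.inChart χ (F w)).compContinuousLinearMap (fderiv ℝ F w) := by
    filter_upwards [hnear] with w ⟨h1, h2⟩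
    have h3 : fderiv ℝ F w = (mfderiv 𝓘(ℝ, V) 𝓘(ℝ, V) χ (e.symm w) : V →L[ℝ] V).comp
        (mfderiv 𝓘(ℝ, V) 𝓘(ℝ, V) e.symm w : V →L[ℝ] V) := by
      refine HasFDerivAt.fderiv ?_
      exact hasMFDerivAt_iff_hasFDerivAt.1 (HasMFDerivAt.comp w
        (hχm.mdifferentiableAt h2).hasMFDerivAt
        ((hes' w h1).mdifferentiableAt (by simp)).hasMFDerivAt)
    have h4 : χ.symm (F w) = e.symm w := χ.left_inv h2
    have h5 := hχm.symm_comp_deriv h2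
    rw [h3]
    simp only [DForm.inChart]
    rw [h4]
    ext v
    change (η (e.symm w) : V [⋀^Fin k]→L[ℝ] ℝ) _ = (η (e.symm w) : V [⋀^Fin k]→L[ℝ] ℝ) _
    refine congrArg _ (funext fun i => ?_)
    exact (congrArg (fun T : V →L[ℝ] V => T (mfderiv 𝓘(ℝ, V) 𝓘(ℝ, V) e.symm w (v i))) h5).symm
  have h6 : DifferentiableAt ℝ (η.inChart χ) (F z) :=
    ((hη (e.symm z)).contDiffAt (χ.open_target.mem_nhds (χ.map_source hes))).differentiableAt
      (by simp)
  have h7 : DifferentiableAt ℝ (fderiv ℝ F) z :=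
    (hF.fderiv_right (m := ∞) (by simp)).differentiableAt (by simp)
  have h8 : DifferentiableAt ℝ (fun w => η.inChart χ (F w)) z :=
    DifferentiableAt.comp z h6 (hF.differentiableAt (by simp))
  exact (h8.continuousAlternatingMapCompContinuousLinearMap h7).congr_of_eventuallyEq hev
end Pullback

/-! ### Jets in adapted coordinates -/

section Coordinates
variable {m n : ℕ} {M E : Type*}
  [TopologicalSpace M] [ChartedSpace (EuclideanSpace ℝ (Fin m)) M]
  [TopologicalSpace E] [ChartedSpace (EuclideanSpace ℝ (Fin (m + n))) E]
  {π : E → M}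

namespace FibredChart
variable (c : FibredChart m n π)

theorem dTot_dTot_inverse {e : E} (he : e ∈ c.tot.source) (v : Base m × Base n) :
    c.dTot e ((c.dTot e).inverse v) = v :=
  congrArg (fun T : Base m × Base n →L[ℝ] Base m × Base n => T v) (c.dTot_inv he).2

theorem dTot_inverse_dTot {e : E} (he : e ∈ c.tot.source) (v : TangentSpace (𝓡 (m + n)) e) :
    (c.dTot e).inverse (c.dTot e v) = v :=
  congrArg (fun T => T v) (c.dTot_inv he).1

theorem dBase_dBase_inverse {x : M} (hx : x ∈ c.base.source) (v : Base m) :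
    c.dBase x ((c.dBase x).inverse v) = v :=
  congrArg (fun T : Base m →L[ℝ] Base m => T v) (c.dBase_inv hx).2

theorem dBase_inverse_dBase {x : M} (hx : x ∈ c.base.source) (v : TangentSpace (𝓡 m) x) :
    (c.dBase x).inverse (c.dBase x v) = v :=
  congrArg (fun T => T v) (c.dBase_inv hx).1

theorem mfderiv_tot_symm {e : E} (he : e ∈ c.tot.source) :
    mfderiv 𝓘(ℝ, Base m × Base n) (𝓡 (m + n)) c.tot.symm (c.tot e) = (c.dTot e).inverse := by
  have h1 : ∀ w : Base (m + n), (mfderiv 𝓘(ℝ, Base m × Base n) (𝓡 (m + n)) c.tot.symm (c.tot e)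
      (c.dTot e w) : Base (m + n)) = w := fun w =>
    congrArg (fun T : Base (m + n) →L[ℝ] Base (m + n) => T w) (c.mdiff_tot.symm_comp_deriv he)
  ext1 v
  have h4 := h1 ((c.dTot e).inverse v)
  rw [c.dTot_dTot_inverse he v] at h4
  exact h4

theorem inChart_base {k : ℕ} (η : DForm (Base m) M k) {x : M} (hx : x ∈ c.base.source) :
    η.inChart c.base (c.base x) = (η x : Base m [⋀^Fin k]→L[ℝ] ℝ).compContinuousLinearMap
      ((c.dBase x).inverse : Base m →L[ℝ] Base m) := by
  have h1 : ∀ w : Base m, (mfderiv (𝓡 m) (𝓡 m) c.base.symm (c.base x)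
      (c.dBase x w) : Base m) = w := fun w =>
    congrArg (fun T : Base m →L[ℝ] Base m => T w) (c.mdiff_base.symm_comp_deriv hx)
  have h5 : mfderiv (𝓡 m) (𝓡 m) c.base.symm (c.base x) = (c.dBase x).inverse := by
    ext1 v
    have h4 := h1 ((c.dBase x).inverse v)
    rw [c.dBase_dBase_inverse hx v] at h4
    exact h4
  rw [DForm.inChart, h5, c.base.left_inv hx]

/-- In adapted coordinates the submersion is the linear projection `(x, y) ↦ x`, and so is its
differential. -/
theorem mfderiv_comp_dTot_inverse (hπ : MDifferentiable (𝓡 (m + n)) (𝓡 m) π) {e : E}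
    (he : e ∈ c.tot.source) :
    (mfderiv (𝓡 (m + n)) (𝓡 m) π e).comp (c.dTot e).inverse =
      (c.dBase (π e)).inverse.comp (.fst ℝ (Base m) (Base n)) := by
  have h1 := c.fst_dTot hπ he
  have h2 := (c.dBase_inv (c.proj_mem e he)).1
  have h3 := (c.dTot_inv he).2
  calc _ = ((c.dBase (π e)).inverse.comp (c.dBase (π e))).comp
        ((mfderiv (𝓡 (m + n)) (𝓡 m) π e).comp (c.dTot e).inverse) := by rw [h2]; rfl
    _ = ((c.dBase (π e)).inverse).comp (((c.dBase (π e)).comp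
        (mfderiv (𝓡 (m + n)) (𝓡 m) π e)).comp (c.dTot e).inverse) := rfl
    _ = _ := by
      rw [← h1, ContinuousLinearMap.comp_assoc (.fst ℝ (Base m) (Base n)), h3]
      rfl

/-- The coordinates of the vertical projection defined by a jet. -/
theorem snd_dTot_vertProj (hπ : MDifferentiable (𝓡 (m + n)) (𝓡 m) π) (j : Jet m n π)
    (hj : j.pt ∈ c.tot.source) :
    (ContinuousLinearMap.snd ℝ (Base m) (Base n)).comp ((c.dTot j.pt).comp j.vertProj) =
      (.snd ℝ (Base m) (Base n) - (c.jetCoord j.pt j.lin).comp (.fst ℝ (Base m) (Base n))).comp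
        (c.dTot j.pt) := by
  have h1 := c.fst_dTot hπ hj
  have h2 := c.snd_dTot_jetLin (c.jetCoord j.pt j.lin) hj
  rw [c.jetLin_jetCoord hπ j hj] at h2
  ext1 v
  have h3 := congrArg (fun T => T v) h1
  have h4 := congrArg (fun T => T (mfderiv (𝓡 (m + n)) (𝓡 m) π j.pt v)) h2
  simp only [ContinuousLinearMap.comp_apply, ContinuousLinearMap.prod_apply] at h3 h4
  change (c.dTot j.pt (v - j.lin (mfderiv (𝓡 (m + n)) (𝓡 m) π j.pt v))).2 =
    (c.dTot j.pt v).2 - c.jetCoord j.pt j.lin (c.dTot j.pt v).1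
  rw [map_sub, h4]
  change (c.dTot j.pt v).2 - _ = _
  have h5 : (c.dTot j.pt v).1 = c.dBase (π j.pt) (mfderiv (𝓡 (m + n)) (𝓡 m) π j.pt v) := h3
  rw [h5]

theorem fst_dTot_vertProj (hπ : MDifferentiable (𝓡 (m + n)) (𝓡 m) π) (j : Jet m n π)
    (hj : j.pt ∈ c.tot.source) :
    (ContinuousLinearMap.fst ℝ (Base m) (Base n)).comp ((c.dTot j.pt).comp j.vertProj) = 0 := by
  rw [← ContinuousLinearMap.comp_assoc, c.fst_dTot hπ hj, ContinuousLinearMap.comp_assoc,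
    j.mfderiv_vertProj, ContinuousLinearMap.comp_zero]

/-- Translation of jets in coordinates. -/
theorem translate_eq_toJet (hπ : MDifferentiable (𝓡 (m + n)) (𝓡 m) π) (j₀ j : Jet m n π)
    (hj : j.pt ∈ c.tot.source)
    (τ : TangentSpace (𝓡 m) (π j.pt) →L[ℝ] TangentSpace (𝓡 (m + n)) j.pt) :
    j.translate τ = c.toJet hπ j₀ (c.tot j.pt, c.jetCoord j.pt j.lin +
      (.snd ℝ (Base m) (Base n) - (c.jetCoord j.pt j.lin).comp (.fst ℝ (Base m) (Base n))).comp
        ((c.dTot j.pt).comp (τ.comp (c.dBase (π j.pt)).inverse))) := by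
  -- A jet in the chart domain is recovered from its coordinates, so only the `y^α_i` of the
  -- translate have to be computed.
  have h1 := (c.jetChart hπ j₀).left_inv (x := j.translate τ) hj
  refine h1.symm.trans (congrArg (c.toJet hπ j₀) (Prod.ext rfl ?_))
  have h2 := c.snd_dTot_vertProj hπ j hj
  change (ContinuousLinearMap.snd ℝ (Base m) (Base n)).comp
    ((c.dTot j.pt).comp ((j.lin + j.vertProj.comp τ).comp (c.dBase (π j.pt)).inverse)) = _
  rw [ContinuousLinearMap.add_comp, ContinuousLinearMap.comp_add, ContinuousLinearMap.comp_add]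
  congr 1
  change (((ContinuousLinearMap.snd ℝ (Base m) (Base n)).comp
    ((c.dTot j.pt).comp j.vertProj)).comp τ).comp (c.dBase (π j.pt)).inverse = _
  rw [h2]
  rfl
end FibredChart
end Coordinates

/-- Translation of jets is affine in natural coordinates; this turns the intrinsic fibre derivative
into a partial derivative of the coordinate Lagrangian. -/
theorem fderiv_comp_const_add {A Z : Type*} [NormedAddCommGroup A] [NormedSpace ℝ A]
    [NormedAddCommGroup Z] [NormedSpace ℝ Z] {f : Z → ℝ} {z : Z} (hf : DifferentiableAt ℝ f z)
    (T : A →L[ℝ] Z) : fderiv ℝ (fun τ => f (z + T τ)) 0 = (fderiv ℝ f z).comp T := by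
  have h : HasFDerivAt f (fderiv ℝ f z) (z + T 0) := by
    rw [map_zero, add_zero]
    exact hf.hasFDerivAt
  exact (HasFDerivAt.comp 0 h (T.hasFDerivAt.const_add z)).fderiv

theorem mdifferentiable_proj {m n : ℕ} {M E : Type*}
    [TopologicalSpace M] [ChartedSpace (EuclideanSpace ℝ (Fin m)) M]
    [TopologicalSpace E] [ChartedSpace (EuclideanSpace ℝ (Fin (m + n))) E]
    (π : E → M) [IsFibredManifold m n π] : MDifferentiable (𝓡 (m + n)) (𝓡 m) π :=
  (IsFibredManifold.contMDiff π).mdifferentiable (by simp)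

/-! ### Lagrangian, momenta and Cartan form in natural coordinates -/

section JetCoordinates
variable {m n : ℕ} {M E : Type*}
  [TopologicalSpace M] [ChartedSpace (EuclideanSpace ℝ (Fin m)) M] [IsManifold (𝓡 m) ∞ M]
  [TopologicalSpace E] [ChartedSpace (EuclideanSpace ℝ (Fin (m + n))) E]
  [IsManifold (𝓡 (m + n)) ∞ E]
  {π : E → M} [IsFibredManifold m n π]

variable (π) in
/-- The adapted coordinates which define the preferred charts of `J¹π` and `J¹π^*` over a point. -/
def fibredChartAt (e : E) : FibredChart m n π := (exists_fibredChart π e).choose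

variable (j₀ : Jet m n π)

theorem chartAt_jet_apply (j : Jet m n π) : chartAt (JetModel m n) j₀ j =
    ((fibredChartAt π j₀.pt).tot j.pt, (fibredChartAt π j₀.pt).jetCoord j.pt j.lin) := rfl

theorem chartAt_jet_symm_apply (z : JetModel m n) : (chartAt (JetModel m n) j₀).symm z =
    (fibredChartAt π j₀.pt).toJet (mdifferentiable_proj π) j₀ z := rfl

/-- `T pt` in coordinates. -/
theorem hasMFDerivAt_pt {j : Jet m n π} (hj : j ∈ (chartAt (JetModel m n) j₀).source) :
    HasMFDerivAt 𝓘(ℝ, JetModel m n) (𝓡 (m + n)) (fun j : Jet m n π => j.pt) j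
      (((fibredChartAt (m := m) (n := n) π j₀.pt).dTot j.pt).inverse.comp
        ((ContinuousLinearMap.fst ℝ (Base m × Base n) (Base m →L[ℝ] Base n)).comp
          (mfderiv 𝓘(ℝ, JetModel m n) 𝓘(ℝ, JetModel m n) (chartAt (JetModel m n) j₀) j :
            JetModel m n →L[ℝ] JetModel m n))) := by
  set c := fibredChartAt (m := m) (n := n) π j₀.pt with hc
  set φ := chartAt (JetModel m n) j₀ with hφ
  have hφm : φ.MDifferentiable 𝓘(ℝ, JetModel m n) 𝓘(ℝ, JetModel m n) := mdifferentiable_chart j₀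
  have hj' : j.pt ∈ c.tot.source := hj
  have h1 : HasMFDerivAt 𝓘(ℝ, JetModel m n) 𝓘(ℝ, Base m × Base n) (fun j => (φ j).1) j
      ((ContinuousLinearMap.fst ℝ (Base m × Base n) (Base m →L[ℝ] Base n)).comp
          (mfderiv 𝓘(ℝ, JetModel m n) 𝓘(ℝ, JetModel m n) φ j : JetModel m n →L[ℝ] JetModel m n)) :=
    HasMFDerivAt.comp j (ContinuousLinearMap.hasMFDerivAt
      (ContinuousLinearMap.fst ℝ (Base m × Base n) (Base m →L[ℝ] Base n)))
      (hφm.mdifferentiableAt hj).hasMFDerivAt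
  have h2 : HasMFDerivAt 𝓘(ℝ, Base m × Base n) (𝓡 (m + n)) c.tot.symm (φ j).1
      (c.dTot j.pt).inverse := by
    rw [← c.mfderiv_tot_symm hj']
    exact (c.mdiff_tot.mdifferentiableAt_symm (c.tot.map_source hj')).hasMFDerivAt
  refine (HasMFDerivAt.comp j h2 h1).congr_of_eventuallyEq ?_
  filter_upwards [φ.open_source.mem_nhds hj] with q hq
  exact (c.tot.left_inv hq).symm

theorem mdifferentiableAt_pt (j : Jet m n π) :
    MDifferentiableAt 𝓘(ℝ, JetModel m n) (𝓡 (m + n)) (fun j : Jet m n π => j.pt) j :=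
  (hasMFDerivAt_pt j (mem_chart_source _ j)).mdifferentiableAt

theorem mdifferentiableAt_proj_pt (j : Jet m n π) :
    MDifferentiableAt 𝓘(ℝ, JetModel m n) (𝓡 m) (fun j : Jet m n π => π j.pt) j :=
  MDifferentiableAt.comp (g := π) j (mdifferentiable_proj (m := m) (n := n) π j.pt)
    (mdifferentiableAt_pt j)

/-- The coordinate expression of the Lagrangian function. -/
def chartLagrangian (L : Jet m n π → ℝ) : JetModel m n → ℝ :=
  L ∘ (chartAt (JetModel m n) j₀).symm

theorem contDiffAt_chartLagrangian {L : Jet m n π → ℝ}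
    (hL : ContMDiff 𝓘(ℝ, JetModel m n) 𝓘(ℝ, ℝ) ∞ L) {z : JetModel m n}
    (hz : z ∈ (chartAt (JetModel m n) j₀).target) : ContDiffAt ℝ ∞ (chartLagrangian j₀ L) z := by
  rw [← contMDiffAt_iff_contDiffAt]
  exact ContMDiffAt.comp z (hL _) ((contMDiffOn_chart_symm (x := j₀)).contMDiffAt
    ((chartAt (JetModel m n) j₀).open_target.mem_nhds hz))

/-- The fibre derivative in coordinates. -/
theorem fibreDeriv_apply {L : Jet m n π → ℝ} (hL : ContMDiff 𝓘(ℝ, JetModel m n) 𝓘(ℝ, ℝ) ∞ L)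
    {j : Jet m n π} (hj : j ∈ (chartAt (JetModel m n) j₀).source) (τ : Base m →L[ℝ] Base (m + n)) :
    j.fibreDeriv L τ = fderiv ℝ (chartLagrangian j₀ L) (chartAt (JetModel m n) j₀ j) (0,
      (.snd ℝ (Base m) (Base n) -
        ((fibredChartAt π j₀.pt).jetCoord j.pt j.lin).comp (.fst ℝ (Base m) (Base n))).comp
        (((fibredChartAt (m := m) (n := n) π j₀.pt).dTot j.pt : Base (m + n) →L[ℝ] Base m × Base n).comp
          (τ.comp ((fibredChartAt (m := m) (n := n) π j₀.pt).dBase (π j.pt)).inverse))) := by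
  set c := fibredChartAt (m := m) (n := n) π j₀.pt with hc
  have hj' : j.pt ∈ c.tot.source := hj
  let A : Base m →L[ℝ] Base n := c.jetCoord j.pt j.lin
  let S : Base m →L[ℝ] Base m := (c.dBase (π j.pt)).inverse
  let R : Base (m + n) →L[ℝ] Base n := (ContinuousLinearMap.snd ℝ (Base m) (Base n) -
    A.comp (.fst ℝ (Base m) (Base n))).comp (c.dTot j.pt : Base (m + n) →L[ℝ] Base m × Base n)
  let T : (Base m →L[ℝ] Base (m + n)) →L[ℝ] JetModel m n :=
    (ContinuousLinearMap.inr ℝ (Base m × Base n) (Base m →L[ℝ] Base n)).comp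
      ((ContinuousLinearMap.compL ℝ (Base m) (Base (m + n)) (Base n) R).comp
        ((ContinuousLinearMap.compL ℝ (Base m) (Base m) (Base (m + n))).flip S))
  have h1 : (fun τ : Base m →L[ℝ] Base (m + n) => L (j.translate τ)) =
      fun τ => chartLagrangian j₀ L (chartAt (JetModel m n) j₀ j + T τ) := by
    funext τ
    rw [c.translate_eq_toJet (mdifferentiable_proj π) j₀ j hj' τ, chartLagrangian,
      Function.comp_apply, chartAt_jet_symm_apply, chartAt_jet_apply]
    refine congrArg (fun w => L (c.toJet (mdifferentiable_proj π) j₀ w)) ?_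
    refine Prod.ext ?_ rfl
    exact (add_zero _).symm
  rw [Jet.fibreDeriv, h1, fderiv_comp_const_add ((contDiffAt_chartLagrangian j₀ hL
    ((chartAt (JetModel m n) j₀).map_source hj)).differentiableAt (by simp))]
  rfl

/-- The momenta in coordinates. -/
theorem dBase_momentum {L : Jet m n π → ℝ} (hL : ContMDiff 𝓘(ℝ, JetModel m n) 𝓘(ℝ, ℝ) ∞ L)
    {j : Jet m n π} (hj : j ∈ (chartAt (JetModel m n) j₀).source) (w : Base m × Base n) :
    (fibredChartAt (m := m) (n := n) π j₀.pt).dBase (π j.pt)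
      (j.momentum L (((fibredChartAt (m := m) (n := n) π j₀.pt).dTot j.pt).inverse w)) =
    momentumMap m (Base n) ((fderiv ℝ (chartLagrangian j₀ L) (chartAt (JetModel m n) j₀ j)).comp
      (.inr ℝ (Base m × Base n) (Base m →L[ℝ] Base n)))
      (w.2 - (fibredChartAt π j₀.pt).jetCoord j.pt j.lin w.1) := by
  set c := fibredChartAt (m := m) (n := n) π j₀.pt with hc
  have hj' : j.pt ∈ c.tot.source := hj
  have h0 : j.momentum L = momentumMap m (Base (m + n)) (j.fibreDeriv L) :=
    (momentumMap_apply _).symm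
  ext k
  rw [momentumMap_apply_apply, h0]
  -- The momentum is defined with the standard basis of the model of `T_{π(e)} M`, which `dBase`
  -- need not preserve. Pairing with the covector `dx^k ∘ dBase` avoids any change of basis.
  have h1 := apply_momentumMap (j.fibreDeriv L) ((c.dTot j.pt).inverse w)
    ((EuclideanSpace.proj k : Base m →L[ℝ] ℝ).comp
      (c.dBase (π j.pt) : Base m →L[ℝ] Base m))
  refine h1.trans ?_
  rw [fibreDeriv_apply j₀ hL hj]
  simp only [ContinuousLinearMap.comp_apply, ContinuousLinearMap.inr_apply]
  congr 2
  ext1 x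
  change ((c.dTot j.pt) ((c.dBase (π j.pt) ((c.dBase (π j.pt)).inverse x)) k •
    (c.dTot j.pt).inverse w)).2 - c.jetCoord j.pt j.lin ((c.dTot j.pt)
      ((c.dBase (π j.pt) ((c.dBase (π j.pt)).inverse x)) k • (c.dTot j.pt).inverse w)).1 = x k • (_ - _)
  rw [c.dBase_dBase_inverse (c.proj_mem _ hj'), map_smul, c.dTot_dTot_inverse hj', Prod.smul_snd,
    Prod.smul_fst, map_smul, smul_sub]

/-- The Cartan form in coordinates. -/
theorem cartanForm_comp_inverse (vol : DForm (Base m) M m) {L : Jet m n π → ℝ}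
    (hL : ContMDiff 𝓘(ℝ, JetModel m n) 𝓘(ℝ, ℝ) ∞ L)
    {j : Jet m n π} (hj : j ∈ (chartAt (JetModel m n) j₀).source) :
    (j.cartanForm vol L).compContinuousLinearMap
      (((fibredChartAt (m := m) (n := n) π j₀.pt).dTot j.pt).inverse :
        Base m × Base n →L[ℝ] Base (m + n)) =
    localCartan (chartLagrangian j₀ L) (vol.inChart (fibredChartAt (m := m) (n := n) π j₀.pt).base)
      (chartAt (JetModel m n) j₀ j) := by
  set c := fibredChartAt (m := m) (n := n) π j₀.pt with hc
  have hj' : j.pt ∈ c.tot.source := hj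
  have h1 : (chartAt (JetModel m n) j₀ j).1.1 = c.base (π j.pt) := c.fst_tot _ hj'
  have h2 : chartLagrangian j₀ L (chartAt (JetModel m n) j₀ j) = L j := by
    rw [chartLagrangian, Function.comp_apply, (chartAt (JetModel m n) j₀).left_inv hj]
  rw [localCartan, h1, c.inChart_base vol (c.proj_mem _ hj'), h2]
  refine (contactForm_comp (A := Base (m + n)) (B := Base m) _ _ _ _ _).trans
    (Eq.trans ?_ (contactForm_pullback (B := Base m) _ _ _ _ _).symm)
  have h3 := c.mfderiv_comp_dTot_inverse (mdifferentiable_proj π) hj'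
  refine congrArg₂ (contactForm (A := Base m × Base n) (B := Base m) (L j) (vol (π j.pt))) h3 ?_
  refine ContinuousLinearMap.ext fun w => ?_
  -- The momenta are known after applying `dBase`, and the volume form in the chart carries the
  -- inverse of `dBase`; the two cancel.
  refine (c.dBase_inverse_dBase (c.proj_mem _ hj') _).symm.trans ?_
  exact congrArg ((c.dBase (π j.pt)).inverse) (dBase_momentum j₀ hL hj w)

end JetCoordinates

/-! ### The Poincaré-Cartan form and its contraction with fibre vectors -/

section PoincareCartan
variable {m n : ℕ} {M E : Type*}
  [TopologicalSpace M] [ChartedSpace (EuclideanSpace ℝ (Fin m)) M] [IsManifold (𝓡 m) ∞ M]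
  [TopologicalSpace E] [ChartedSpace (EuclideanSpace ℝ (Fin (m + n))) E]
  [IsManifold (𝓡 (m + n)) ∞ E]
  {π : E → M} [IsFibredManifold m n π]

/-- The coordinate expression of the volume form at the jet `j₀`. -/
def chartVol (vol : DForm (Base m) M m) (j₀ : Jet m n π) : Base m → Base m [⋀^Fin m]→L[ℝ] ℝ :=
  vol.inChart (fibredChartAt (m := m) (n := n) π j₀.pt).base

theorem differentiableAt_chartVol {vol : DForm (Base m) M m} (hvol : vol.IsSmooth)
    (j₀ : Jet m n π) {z : JetModel m n} (hz : z ∈ (chartAt (JetModel m n) j₀).target) :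
    DifferentiableAt ℝ (chartVol vol j₀) z.1.1 := by
  set c := fibredChartAt (m := m) (n := n) π j₀.pt with hc
  have h1 : c.tot.symm z.1 ∈ c.tot.source := c.tot.map_target hz
  have h2 : z.1.1 = c.base (π (c.tot.symm z.1)) := by
    rw [← c.fst_tot _ h1, c.tot.right_inv hz]
  refine hvol.differentiableAt_inChart c.base c.contMDiffOn_base_symm ?_
  rw [h2]
  exact c.base.map_source (c.proj_mem _ h1)

/-- The Poincaré-Cartan form in coordinates. -/
theorem poincareCartan_inChart (vol : DForm (Base m) M m) {L : Jet m n π → ℝ}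
    (hL : ContMDiff 𝓘(ℝ, JetModel m n) 𝓘(ℝ, ℝ) ∞ L) (j₀ : Jet m n π) {z : JetModel m n}
    (hz : z ∈ (chartAt (JetModel m n) j₀).target) :
    (poincareCartan vol L).inChart (chartAt (JetModel m n) j₀) z =
      (localCartan (chartLagrangian j₀ L) (chartVol vol j₀) z).compContinuousLinearMap
        (.fst ℝ (Base m × Base n) (Base m →L[ℝ] Base n)) := by
  set φ := chartAt (JetModel m n) j₀ with hφ
  set c := fibredChartAt (m := m) (n := n) π j₀.pt with hc
  have hφm : φ.MDifferentiable 𝓘(ℝ, JetModel m n) 𝓘(ℝ, JetModel m n) := mdifferentiable_chart j₀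
  have hj : φ.symm z ∈ φ.source := φ.map_target hz
  have h1 := cartanForm_comp_inverse j₀ vol hL hj
  rw [← hφ, φ.right_inv hz] at h1
  rw [chartVol, ← h1]
  have h2 := (hasMFDerivAt_pt j₀ hj).mfderiv
  have h3 : ∀ w : JetModel m n, (mfderiv 𝓘(ℝ, JetModel m n) 𝓘(ℝ, JetModel m n) φ (φ.symm z)
      (mfderiv 𝓘(ℝ, JetModel m n) 𝓘(ℝ, JetModel m n) φ.symm z w) : JetModel m n) = w := fun w =>
    congrArg (fun T : JetModel m n →L[ℝ] JetModel m n => T w) (hφm.comp_symm_deriv hz)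
  ext w
  change ((φ.symm z).cartanForm vol L) (fun i => (mfderiv 𝓘(ℝ, JetModel m n) (𝓡 (m + n))
      (fun q : Jet m n π => q.pt) (φ.symm z) (mfderiv 𝓘(ℝ, JetModel m n) 𝓘(ℝ, JetModel m n)
        φ.symm z (w i)) : Base (m + n))) =
    ((φ.symm z).cartanForm vol L) (fun i => (c.dTot (φ.symm z).pt).inverse (w i).1)
  refine congrArg _ (funext fun i => ?_)
  rw [h2]
  change (c.dTot (φ.symm z).pt).inverse (mfderiv 𝓘(ℝ, JetModel m n) 𝓘(ℝ, JetModel m n) φ (φ.symm z)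
      (mfderiv 𝓘(ℝ, JetModel m n) 𝓘(ℝ, JetModel m n) φ.symm z (w i)) : JetModel m n).1 = _
  rw [h3]

theorem eventually_poincareCartan_inChart (vol : DForm (Base m) M m) {L : Jet m n π → ℝ}
    (hL : ContMDiff 𝓘(ℝ, JetModel m n) 𝓘(ℝ, ℝ) ∞ L) (j₀ : Jet m n π) :
    (poincareCartan vol L).inChart (chartAt (JetModel m n) j₀)
      =ᶠ[nhds (chartAt (JetModel m n) j₀ j₀)] fun z =>
      (localCartan (chartLagrangian j₀ L) (chartVol vol j₀) z).compContinuousLinearMap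
        (.fst ℝ (Base m × Base n) (Base m →L[ℝ] Base n)) := by
  filter_upwards [(chartAt (JetModel m n) j₀).open_target.mem_nhds
    ((chartAt (JetModel m n) j₀).map_source (mem_chart_source _ j₀))] with z hz
  exact poincareCartan_inChart vol hL j₀ hz

theorem differentiableAt_localCartan_chart {vol : DForm (Base m) M m} (hvol : vol.IsSmooth)
    {L : Jet m n π → ℝ} (hL : ContMDiff 𝓘(ℝ, JetModel m n) 𝓘(ℝ, ℝ) ∞ L) (j₀ : Jet m n π) :
    DifferentiableAt ℝ (localCartan (chartLagrangian j₀ L) (chartVol vol j₀))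
      (chartAt (JetModel m n) j₀ j₀) := by
  have hz := (chartAt (JetModel m n) j₀).map_source (mem_chart_source _ j₀)
  exact differentiableAt_localCartan (contDiffAt_chartLagrangian j₀ hL hz)
    (differentiableAt_chartVol hvol j₀ hz)

theorem differentiableAt_poincareCartan_inChart {vol : DForm (Base m) M m} (hvol : vol.IsSmooth)
    {L : Jet m n π → ℝ} (hL : ContMDiff 𝓘(ℝ, JetModel m n) 𝓘(ℝ, ℝ) ∞ L) (j₀ : Jet m n π) :
    DifferentiableAt ℝ ((poincareCartan vol L).inChart (chartAt (JetModel m n) j₀))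
      (chartAt (JetModel m n) j₀ j₀) :=
  ((differentiableAt_localCartan_chart hvol hL
    j₀).continuousAlternatingMapCompContinuousLinearMap
      (differentiableAt_const _)).congr_of_eventuallyEq (eventually_poincareCartan_inChart vol hL j₀)

/-- The volume is recovered from its chart expression by pulling back along the isomorphism `dBase`,
so neither vanishes without the other. -/
theorem chartVol_ne_zero {vol : DForm (Base m) M m} (hvol0 : ∀ x, vol x ≠ 0) (j₀ : Jet m n π) :
    chartVol vol j₀ (chartAt (JetModel m n) j₀ j₀).1.1 ≠ 0 := by
  set c := fibredChartAt (m := m) (n := n) π j₀.pt with hc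
  have hj : j₀.pt ∈ c.tot.source := mem_chart_source (JetModel m n) j₀
  have hx := c.proj_mem _ hj
  have h1 : (chartAt (JetModel m n) j₀ j₀).1.1 = c.base (π j₀.pt) := c.fst_tot _ hj
  have h2 : chartVol vol j₀ (c.base (π j₀.pt)) = _ := c.inChart_base vol hx
  rw [h1, h2]
  intro h
  refine hvol0 (π j₀.pt) ?_
  ext v
  have h3 := congrArg (fun η : Base m [⋀^Fin m]→L[ℝ] ℝ => η fun i => c.dBase (π j₀.pt) (v i)) h
  simp only [ContinuousAlternatingMap.compContinuousLinearMap_apply] at h3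
  refine Eq.trans (congrArg (vol (π j₀.pt)) (funext fun i => ?_)) h3
  exact (c.dBase_inverse_dBase hx (v i)).symm

/-- The contraction of `Ω_L` with a vector of the fibre of `J¹π → E`. -/
theorem omegaL_apply_cons {vol : DForm (Base m) M m} (hvol : vol.IsSmooth)
    {L : Jet m n π → ℝ} (hL : ContMDiff 𝓘(ℝ, JetModel m n) 𝓘(ℝ, ℝ) ∞ L) (j : Jet m n π)
    (B : Base m →L[ℝ] Base n) (w : Fin m → TangentSpace 𝓘(ℝ, JetModel m n) j) :
    omegaL vol L j (Fin.cons (mfderiv 𝓘(ℝ, JetModel m n) 𝓘(ℝ, JetModel m n)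
      (chartAt (JetModel m n) j).symm (chartAt (JetModel m n) j j) ((0, B) : JetModel m n) :
        JetModel m n) w) =
      -((chartVol vol j (chartAt (JetModel m n) j j).1.1).fderivCompContinuousLinearMap
        (.fst ℝ (Base m) (Base n))
        ((momentumMap m (Base n) (fibreHessian (chartLagrangian j L) (chartAt (JetModel m n) j j) B)).comp
          (.snd ℝ (Base m) (Base n) -
            (chartAt (JetModel m n) j j).2.comp (.fst ℝ (Base m) (Base n))))
        fun i => (mfderiv 𝓘(ℝ, JetModel m n) 𝓘(ℝ, JetModel m n) (chartAt (JetModel m n) j) j (w i) :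
          JetModel m n).1) := by
  set φ := chartAt (JetModel m n) j with hφ
  have hφm : φ.MDifferentiable 𝓘(ℝ, JetModel m n) 𝓘(ℝ, JetModel m n) := mdifferentiable_chart j
  have hj : j ∈ φ.source := mem_chart_source _ j
  have hz : φ j ∈ φ.target := φ.map_source hj
  have h3 : ∀ w : JetModel m n, (mfderiv 𝓘(ℝ, JetModel m n) 𝓘(ℝ, JetModel m n) φ j
      (mfderiv 𝓘(ℝ, JetModel m n) 𝓘(ℝ, JetModel m n) φ.symm (φ j) w) : JetModel m n) = w := by
    intro w
    have := congrArg (fun T : JetModel m n →L[ℝ] JetModel m n => T w) (hφm.comp_symm_deriv hz)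
    rw [φ.left_inv hj] at this
    exact this
  -- Near the point `Θ_L` is pulled back from the coordinates `(x, y)`, so contraction of its
  -- differential with `(0, B)` is the derivative of its coefficients, given by the Hessian formula.
  have h5 := extDeriv_semibasic (differentiableAt_localCartan_chart hvol hL j) B fun i =>
    (mfderiv 𝓘(ℝ, JetModel m n) 𝓘(ℝ, JetModel m n) φ j (w i) : JetModel m n)
  rw [← (eventually_poincareCartan_inChart vol hL j).extDeriv_eq,
    fderiv_localCartan (contDiffAt_chartLagrangian j hL hz)
      (differentiableAt_chartVol hvol j hz) B] at h5
  refine Eq.trans ?_ (congrArg Neg.neg h5)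
  change -(extDeriv ((poincareCartan vol L).inChart φ) (φ j) _) = _
  refine congrArg Neg.neg (congrArg _ (funext fun i => ?_))
  refine Fin.cases ?_ (fun i => ?_) i
  · exact h3 _
  · rfl

end PoincareCartan

/-! ### Diffeomorphisms in charts -/

section Generic
variable {V : Type*} [NormedAddCommGroup V] [NormedSpace ℝ V] {V' : Type*} [NormedAddCommGroup V']
  [NormedSpace ℝ V'] {N : Type*} [TopologicalSpace N] [ChartedSpace V N]
  {N' : Type*} [TopologicalSpace N'] [ChartedSpace V' N'] [IsManifold 𝓘(ℝ, V) ∞ N]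
  [IsManifold 𝓘(ℝ, V') ∞ N']

/-- In charts the derivative is `Tχ ∘ Tf ∘ Tφ⁻¹`, and each factor has a left inverse; these are
applied to `F v = 0` one after the other. -/
theorem IsDiffeoOn.eq_zero_of_fderiv_chart {f : N → N'} {g : N' → N} {W : Set N} {W' : Set N'}
    (h : IsDiffeoOn V V' f g W W') {p : N} (hp : p ∈ W) {F : V →L[ℝ] V'}
    (hF : HasFDerivAt (chartAt V' (f p) ∘ f ∘ (chartAt V p).symm) F (chartAt V p p)) {v : V}
    (hv : F v = 0) : v = 0 := by
  set φ := chartAt V p with hφ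
  set χ := chartAt V' (f p) with hχ
  have hφm : φ.MDifferentiable 𝓘(ℝ, V) 𝓘(ℝ, V) := mdifferentiable_chart p
  have hχm : χ.MDifferentiable 𝓘(ℝ, V') 𝓘(ℝ, V') := mdifferentiable_chart _
  have hjs : p ∈ φ.source := mem_chart_source _ p
  have hz : φ p ∈ φ.target := φ.map_source hjs
  have hs : f p ∈ χ.source := mem_chart_source _ _
  have h0 : φ.symm (φ p) = p := φ.left_inv hjs
  have h1 : HasMFDerivAt 𝓘(ℝ, V) 𝓘(ℝ, V) φ.symm (φ p) _ :=
    (hφm.mdifferentiableAt_symm hz).hasMFDerivAt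
  have h2 : HasMFDerivAt 𝓘(ℝ, V) 𝓘(ℝ, V') f (φ.symm (φ p)) (mfderiv 𝓘(ℝ, V) 𝓘(ℝ, V') f p) := by
    rw [h0]; exact (h.mdifferentiableAt hp).hasMFDerivAt
  have h3 : HasMFDerivAt 𝓘(ℝ, V') 𝓘(ℝ, V') χ (f (φ.symm (φ p)))
      (mfderiv 𝓘(ℝ, V') 𝓘(ℝ, V') χ (f p)) := by
    rw [h0]; exact (hχm.mdifferentiableAt hs).hasMFDerivAt
  have h4 := hasMFDerivAt_unique (HasMFDerivAt.comp (φ p) h3 (HasMFDerivAt.comp (φ p) h2 h1))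
    hF.hasMFDerivAt
  have h9 : (mfderiv 𝓘(ℝ, V') 𝓘(ℝ, V') χ (f p) (mfderiv 𝓘(ℝ, V) 𝓘(ℝ, V') f p
      (mfderiv 𝓘(ℝ, V) 𝓘(ℝ, V) φ.symm (φ p) v)) : V') = 0 :=
    (congrArg (fun T : V →L[ℝ] V' => T v) h4).trans hv
  have h10 : ∀ w : V', (mfderiv 𝓘(ℝ, V') 𝓘(ℝ, V') χ.symm (χ (f p))
      (mfderiv 𝓘(ℝ, V') 𝓘(ℝ, V') χ (f p) w) : V') = w := fun w =>
    congrArg (fun T : V' →L[ℝ] V' => T w) (hχm.symm_comp_deriv hs)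
  have h11 : (mfderiv 𝓘(ℝ, V) 𝓘(ℝ, V') f p (mfderiv 𝓘(ℝ, V) 𝓘(ℝ, V) φ.symm (φ p) v) : V') = 0 := by
    refine (h10 _).symm.trans ?_
    exact (congrArg (mfderiv 𝓘(ℝ, V') 𝓘(ℝ, V') χ.symm (χ (f p))) h9).trans (map_zero _)
  have h12 : (mfderiv 𝓘(ℝ, V) 𝓘(ℝ, V) φ.symm (φ p) v : V) = 0 := by
    refine (h.mfderiv_mfderiv hp (mfderiv 𝓘(ℝ, V) 𝓘(ℝ, V) φ.symm (φ p) v : V)).symm.trans ?_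
    exact (congrArg (mfderiv 𝓘(ℝ, V') 𝓘(ℝ, V) g (f p)) h11).trans (map_zero _)
  have h13 : (mfderiv 𝓘(ℝ, V) 𝓘(ℝ, V) φ p (mfderiv 𝓘(ℝ, V) 𝓘(ℝ, V) φ.symm (φ p) v) : V) = v := by
    have := congrArg (fun T : V →L[ℝ] V => T v) (hφm.comp_symm_deriv hz)
    rw [h0] at this
    exact this
  exact h13.symm.trans ((congrArg (mfderiv 𝓘(ℝ, V) 𝓘(ℝ, V) φ p) h12).trans (map_zero _))

theorem hasFDerivAt_fst_prodMk {X Y A B : Type*} [NormedAddCommGroup X] [NormedSpace ℝ X]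
    [NormedAddCommGroup Y] [NormedSpace ℝ Y] [NormedAddCommGroup A] [NormedSpace ℝ A]
    [NormedAddCommGroup B] [NormedSpace ℝ B] {f : X × Y → A} {z : X × Y}
    (hf : DifferentiableAt ℝ f z) (μ : A →L[ℝ] B) :
    HasFDerivAt (fun z => (z.1, μ (f z)))
      ((ContinuousLinearMap.fst ℝ X Y).prod (μ.comp (fderiv ℝ f z))) z :=
  hasFDerivAt_fst.prodMk (μ.hasFDerivAt.comp z hf.hasFDerivAt)
end Generic

/-! ### Regularity, nondegeneracy of the Hessian and holonomy -/

section Regularity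
variable {m n : ℕ} {M E : Type*}
  [TopologicalSpace M] [ChartedSpace (EuclideanSpace ℝ (Fin m)) M] [IsManifold (𝓡 m) ∞ M]
  [TopologicalSpace E] [ChartedSpace (EuclideanSpace ℝ (Fin (m + n))) E]
  [IsManifold (𝓡 (m + n)) ∞ E]
  {π : E → M} [IsFibredManifold m n π]

/-- The Legendre map keeps the point of `E`, so the preferred charts at `j₀` and at its image come
from the same adapted coordinates. In them it fixes `(x, y)`, and its momentum part is the class of
the Cartan form. -/
theorem exists_chart_legendre (vol : DForm (Base m) M m) {L : Jet m n π → ℝ}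
    (hL : ContMDiff 𝓘(ℝ, JetModel m n) 𝓘(ℝ, ℝ) ∞ L) (j₀ : Jet m n π) :
    ∃ μ : ((Base m × Base n) [⋀^Fin m]→L[ℝ] ℝ) →L[ℝ] ReducedLambda m (modelVertical m n),
      ∀ j ∈ (chartAt (JetModel m n) j₀).source,
        chartAt (DualJetModel m n) (legendre vol L j₀) (legendre vol L j) =
          ((chartAt (JetModel m n) j₀ j).1, μ (localCartan (chartLagrangian j₀ L) (chartVol vol j₀)
            (chartAt (JetModel m n) j₀ j))) := by
  -- The quotient map lives on `Lambda2` only. A linear retraction onto it extends the map to all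
  -- forms, so that `μ` is a fixed continuous linear map through which `localCartan` can be
  -- differentiated.
  obtain ⟨r, hr⟩ := SubQuot.exists_retraction (Lambda2 m (modelVertical m n))
  refine ⟨LinearMap.toContinuousLinearMap ((ReducedLambda.mk m (modelVertical m n)).comp r),
    fun j hj => ?_⟩
  set c := fibredChartAt (m := m) (n := n) π j₀.pt with hc
  have hj' : j.pt ∈ c.tot.source := hj
  have h1 : chartAt (DualJetModel m n) (legendre vol L j₀) (legendre vol L j) =
      (c.tot j.pt, ReducedLambda.pull m (modelVertical m n) (verticalSpace m n π j.pt)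
        (c.dTot j.pt).inverse (ReducedLambda.mk m _ ⟨j.cartanForm vol L, j.cartanForm_mem vol L⟩)) :=
    rfl
  have h2 := ReducedLambda.pull_mk m _ (c.dTot_inverse_vertical (mdifferentiable_proj π) hj')
    ⟨j.cartanForm vol L, j.cartanForm_mem vol L⟩
  have h3 : (Lambda2.pull m _ (c.dTot_inverse_vertical (mdifferentiable_proj π) hj')
      ⟨j.cartanForm vol L, j.cartanForm_mem vol L⟩).1 = _ := cartanForm_comp_inverse j₀ vol hL hj
  rw [h1, h2]
  refine Prod.ext rfl (congrArg (ReducedLambda.mk m (modelVertical m n)) ?_)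
  refine (hr _).symm.trans (congrArg r h3)

/-- The fibre Hessian of a regular Lagrangian is nondegenerate. -/
theorem eq_zero_of_fibreHessian_eq_zero {vol : DForm (Base m) M m} (hvol : vol.IsSmooth)
    {L : Jet m n π → ℝ} (hL : ContMDiff 𝓘(ℝ, JetModel m n) 𝓘(ℝ, ℝ) ∞ L)
    {G : DualJet m n π → Jet m n π} {W : Set (Jet m n π)} {W' : Set (DualJet m n π)}
    (h : IsDiffeoOn (JetModel m n) (DualJetModel m n) (legendre vol L) G W W') {j : Jet m n π}
    (hj : j ∈ W) {B : Base m →L[ℝ] Base n}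
    (hB : fibreHessian (chartLagrangian j L) (chartAt (JetModel m n) j j) B = 0) : B = 0 := by
  obtain ⟨μ, hμ⟩ := exists_chart_legendre vol hL j
  have hz := (chartAt (JetModel m n) j).map_source (mem_chart_source _ j)
  have h1 := (hasFDerivAt_fst_prodMk (differentiableAt_localCartan_chart hvol hL j)
    μ).congr_of_eventuallyEq (f₁ := chartAt (DualJetModel m n) (legendre vol L j) ∘ legendre vol L ∘
      (chartAt (JetModel m n) j).symm) (by
    filter_upwards [(chartAt (JetModel m n) j).open_target.mem_nhds hz] with z hz'
    rw [Function.comp_apply, Function.comp_apply,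
      hμ _ ((chartAt (JetModel m n) j).map_target hz'), (chartAt (JetModel m n) j).right_inv hz'])
  -- Along `(0, B)` the Legendre map does not move `(x, y)`, and its momentum part varies only
  -- through `Hess B`. If that is zero, then `(0, B)` lies in the kernel of an injective derivative.
  refine congrArg Prod.snd (h.eq_zero_of_fderiv_chart hj h1 (v := (0, B)) (Prod.ext rfl ?_))
  change μ (fderiv ℝ (localCartan (chartLagrangian j L) (chartVol vol j))
    (chartAt (JetModel m n) j j) (0, B)) = 0
  rw [fderiv_localCartan (contDiffAt_chartLagrangian j hL hz) (differentiableAt_chartVol hvol j hz),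
    hB, map_zero, ContinuousLinearMap.zero_comp, map_zero, map_zero]

/-- A tangent map which solves the field equation and is a section of `J¹π → M` is holonomic. -/
theorem vertProj_comp_eq_zero {vol : DForm (Base m) M m} (hvol : vol.IsSmooth)
    (hvol0 : ∀ x, vol x ≠ 0)
    {L : Jet m n π → ℝ} (hL : ContMDiff 𝓘(ℝ, JetModel m n) 𝓘(ℝ, ℝ) ∞ L)
    {G : DualJet m n π → Jet m n π} {W : Set (Jet m n π)} {W' : Set (DualJet m n π)}
    (h : IsDiffeoOn (JetModel m n) (DualJetModel m n) (legendre vol L) G W W') {j : Jet m n π}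
    (hj : j ∈ W) {τ : Base m →L[ℝ] TangentSpace 𝓘(ℝ, JetModel m n) j}
    (hτ : ∀ u, (mfderiv (𝓡 (m + n)) (𝓡 m) π j.pt
      (mfderiv 𝓘(ℝ, JetModel m n) (𝓡 (m + n)) (fun j : Jet m n π => j.pt) j (τ u)) : Base m) = u)
    (hΩ : ∀ (X : TangentSpace 𝓘(ℝ, JetModel m n) j) (u : Fin m → Base m),
      omegaL vol L j (Fin.cons X fun i => τ (u i)) = 0) (u : Base m) :
    j.vertProj (mfderiv 𝓘(ℝ, JetModel m n) (𝓡 (m + n)) (fun j : Jet m n π => j.pt) j (τ u)) = 0 := by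
  set φ := chartAt (JetModel m n) j with hφ
  set c := fibredChartAt (m := m) (n := n) π j.pt with hc
  have hjs : j ∈ φ.source := mem_chart_source _ j
  have hz : φ j ∈ φ.target := φ.map_source hjs
  have hjc : j.pt ∈ c.tot.source := hjs
  have hjb := c.proj_mem _ hjc
  let S : Base m →L[ℝ] Base m := (c.dBase (π j.pt)).inverse
  -- `T` is the `(x, y)`-part of the given tangent map, reparametrized by `S` so that its `x`-part
  -- is the identity. With `Q = dy - A dx`, the composite `Q ∘ T` is the defect of holonomy.
  let T : Base m →L[ℝ] Base m × Base n :=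
    (ContinuousLinearMap.fst ℝ (Base m × Base n) (Base m →L[ℝ] Base n)).comp
      ((mfderiv 𝓘(ℝ, JetModel m n) 𝓘(ℝ, JetModel m n) φ j : JetModel m n →L[ℝ] JetModel m n).comp
        ((τ : Base m →L[ℝ] JetModel m n).comp S))
  have hpt : ∀ v : TangentSpace 𝓘(ℝ, JetModel m n) j, c.dTot j.pt
      (mfderiv 𝓘(ℝ, JetModel m n) (𝓡 (m + n)) (fun j : Jet m n π => j.pt) j v) =
        (mfderiv 𝓘(ℝ, JetModel m n) 𝓘(ℝ, JetModel m n) φ j v : JetModel m n).1 := by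
    intro v
    rw [(hasMFDerivAt_pt j hjs).mfderiv]
    exact c.dTot_dTot_inverse hjc _
  have hT : (ContinuousLinearMap.fst ℝ (Base m) (Base n)).comp T = .id ℝ (Base m) := by
    ext1 x
    have h1 := congrArg (fun R => R (mfderiv 𝓘(ℝ, JetModel m n) (𝓡 (m + n))
      (fun j : Jet m n π => j.pt) j (τ (S x)))) (c.fst_dTot (mdifferentiable_proj π) hjc)
    have h2 : (c.dTot j.pt (mfderiv 𝓘(ℝ, JetModel m n) (𝓡 (m + n))
      (fun j : Jet m n π => j.pt) j (τ (S x)))).1 = c.dBase (π j.pt)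
        (mfderiv (𝓡 (m + n)) (𝓡 m) π j.pt (mfderiv 𝓘(ℝ, JetModel m n) (𝓡 (m + n))
          (fun j : Jet m n π => j.pt) j (τ (S x)))) := h1
    rw [hpt] at h2
    refine h2.trans ((congrArg (c.dBase (π j.pt)) (hτ (S x))).trans ?_)
    exact c.dBase_dBase_inverse hjb x
  let Q : Base m × Base n →L[ℝ] Base n := .snd ℝ (Base m) (Base n) -
    (φ j).2.comp (.fst ℝ (Base m) (Base n))
  have hH : ∀ B, fibreHessian (chartLagrangian j L) (φ j) B (Q.comp T) = 0 := by
    intro B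
    refine apply_eq_zero_of_fderivComp (chartVol_ne_zero hvol0 j) hT ?_
    -- The field equation is tested on the coordinate fibre vector `(0, B)` and on the tangent
    -- vectors whose `(x, y)`-parts are `T e_i`.
    have h1 := omegaL_apply_cons hvol hL j B fun i => τ (S (EuclideanSpace.single i (1 : ℝ)))
    have h2 := h1.symm.trans (hΩ _ _)
    exact neg_eq_zero.1 h2
  have hQ : Q.comp T = 0 := by
    refine eq_zero_of_fibreHessian_eq_zero hvol hL h hj ?_
    ext1 B
    -- The equation places the defect in the second argument of the Hessian, while nondegeneracy
    -- concerns the first.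
    rw [fibreHessian_symm (contDiffAt_chartLagrangian j hL hz)]
    exact hH B
  have h1 : c.dTot j.pt (j.vertProj (mfderiv 𝓘(ℝ, JetModel m n) (𝓡 (m + n))
      (fun j : Jet m n π => j.pt) j (τ u))) = 0 := by
    refine Prod.ext ?_ ?_
    · exact congrArg (fun R => R (mfderiv 𝓘(ℝ, JetModel m n) (𝓡 (m + n))
        (fun j : Jet m n π => j.pt) j (τ u)))
        (c.fst_dTot_vertProj (mdifferentiable_proj π) j hjc)
    · have h2 := congrArg (fun R => R (mfderiv 𝓘(ℝ, JetModel m n) (𝓡 (m + n))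
        (fun j : Jet m n π => j.pt) j (τ u))) (c.snd_dTot_vertProj (mdifferentiable_proj π) j hjc)
      refine h2.trans ?_
      change Q (c.dTot j.pt (mfderiv 𝓘(ℝ, JetModel m n) (𝓡 (m + n))
        (fun j : Jet m n π => j.pt) j (τ u))) = 0
      rw [hpt]
      have h3 := congrArg (fun R : Base m →L[ℝ] Base n => R (c.dBase (π j.pt) u)) hQ
      have h4 : S (c.dBase (π j.pt) u) = u := c.dBase_inverse_dBase hjb u
      change Q (mfderiv 𝓘(ℝ, JetModel m n) 𝓘(ℝ, JetModel m n) φ j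
        (τ (S (c.dBase (π j.pt) u))) : JetModel m n).1 = 0 at h3
      rwa [h4] at h3
  rw [← c.dTot_inverse_dTot hjc (j.vertProj _), h1, map_zero]

end Regularity

/-! ### Equivalence of the Lagrangian and Hamiltonian problems -/

section HamiltonJacobi
variable {m n : ℕ} {M E : Type*}
  [TopologicalSpace M] [ChartedSpace (EuclideanSpace ℝ (Fin m)) M] [IsManifold (𝓡 m) ∞ M]
  [TopologicalSpace E] [ChartedSpace (EuclideanSpace ℝ (Fin (m + n))) E]
  [IsManifold (𝓡 (m + n)) ∞ E]
  {π : E → M} [IsFibredManifold m n π]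
  {vol : DForm (Base m) M m} {L : Jet m n π → ℝ}
  {G : DualJet m n π → Jet m n π} {W : Set (Jet m n π)} {W' : Set (DualJet m n π)}

theorem pt_eq_of_isDiffeoOn
    (h : IsDiffeoOn (JetModel m n) (DualJetModel m n) (legendre vol L) G W W') {a : DualJet m n π}
    (ha : a ∈ W') : (G a).pt = a.pt :=
  congrArg DualJet.pt (h.rightInvOn ha)

/-- Both sides evaluate the Cartan form at `G a` on projections to `E`. The map `h = F̃L ∘ G` has
the same base point as `G`, so the chain rule for `pt ∘ G` is all that is needed. -/
theorem pullbackTautological_comp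
    (h : IsDiffeoOn (JetModel m n) (DualJetModel m n) (legendre vol L) G W W')
    {a : DualJet m n π} (ha : a ∈ W') :
    pullbackTautological (V := DualJetModel m n) (extendedLegendre vol L ∘ G) a =
      (poincareCartan vol L).pullback (V := DualJetModel m n) G a := by
  have h1 := HasMFDerivAt.comp (g := fun j : Jet m n π => j.pt) a
    (mdifferentiableAt_pt (G a)).hasMFDerivAt (h.symm.mdifferentiableAt ha).hasMFDerivAt
  ext v
  exact congrArg (fun T : DualJetModel m n →L[ℝ] Base (m + n) =>
    ((G a).cartanForm vol L : Base (m + n) [⋀^Fin m]→L[ℝ] ℝ) fun i => T (v i)) h1.mfderiv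

/-- The Hamilton-Cartan form is the pull-back of `Ω_L` by the inverse Legendre map. -/
theorem omegaH_eq_pullback (hvol : vol.IsSmooth) (hL : ContMDiff 𝓘(ℝ, JetModel m n) 𝓘(ℝ, ℝ) ∞ L)
    (h : IsDiffeoOn (JetModel m n) (DualJetModel m n) (legendre vol L) G W W')
    {a : DualJet m n π} (ha : a ∈ W') :
    omegaH (extendedLegendre vol L ∘ G) a =
      (omegaL vol L).pullback (V := DualJetModel m n) G a := by
  have h1 := h.extd_pullback (fun _ => pullbackTautological_comp h) ha
    (differentiableAt_poincareCartan_inChart hvol hL (G a))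
  exact congrArg Neg.neg h1

/-- Near `a` the projection to `M` factors through `G` and the projection of `J¹π`, whose
differentiability is already known. -/
theorem mdifferentiableAt_proj_dualJet_pt
    (h : IsDiffeoOn (JetModel m n) (DualJetModel m n) (legendre vol L) G W W')
    {a : DualJet m n π} (ha : a ∈ W') :
    MDifferentiableAt 𝓘(ℝ, DualJetModel m n) (𝓡 m) (fun a : DualJet m n π => π a.pt) a := by
  refine (MDifferentiableAt.comp (g := fun j : Jet m n π => π j.pt) a
    (mdifferentiableAt_proj_pt (G a)) (h.symm.mdifferentiableAt ha)).congr_of_eventuallyEq ?_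
  filter_upwards [h.isOpen'.mem_nhds ha] with b hb
  exact congrArg π (pt_eq_of_isDiffeoOn h hb).symm

/-- For a regular Lagrangian, integral sections which solve the field equation are holonomic. -/
theorem isHolonomic_of_solvesFieldEquation (hvol : vol.IsSmooth) (hvol0 : ∀ x, vol x ≠ 0)
    (hL : ContMDiff 𝓘(ℝ, JetModel m n) 𝓘(ℝ, ℝ) ∞ L)
    (h : IsDiffeoOn (JetModel m n) (DualJetModel m n) (legendre vol L) G W W')
    {ψ : M → Jet m n π} {U : Set M}
    (hψ : IsSectionOn (JetModel m n) (Base m) (fun j : Jet m n π => π j.pt) ψ U)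
    (hW : MapsTo ψ U W) (hΩ : SolvesFieldEquation m (JetModel m n) (omegaL vol L) ψ U) :
    IsHolonomic ψ U := by
  intro x hx
  have hψx : MDifferentiableAt (𝓡 m) 𝓘(ℝ, JetModel m n) ψ x :=
    (hψ.smooth.contMDiffAt (hψ.isOpen.mem_nhds hx)).mdifferentiableAt (by simp)
  have h1 := HasMFDerivAt.comp (g := fun j : Jet m n π => j.pt) x
    (mdifferentiableAt_pt (ψ x)).hasMFDerivAt hψx.hasMFDerivAt
  have h2 := HasMFDerivAt.comp (g := π) (f := fun x => (ψ x).pt) x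
    (mdifferentiable_proj (m := m) (n := n) π (ψ x).pt).hasMFDerivAt h1
  -- On the open set `U` the section property makes this map the identity, so the tangent vectors of
  -- `ψ` project to `u`, as the pointwise holonomy lemma requires.
  have h3 : HasMFDerivAt (𝓡 m) (𝓡 m) (fun x => π (ψ x).pt) x (ContinuousLinearMap.id ℝ (Base m)) := by
    refine (hasMFDerivAt_id x).congr_of_eventuallyEq ?_
    filter_upwards [hψ.isOpen.mem_nhds hx] with y hy using hψ.proj y hy
  have hτ := fun u : Base m =>
    congrArg (fun T : Base m →L[ℝ] Base m => T u) (hasMFDerivAt_unique h2 h3)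
  have h4 := vertProj_comp_eq_zero hvol hvol0 hL h (hW hx)
    (τ := (mfderiv (𝓡 m) 𝓘(ℝ, JetModel m n) ψ x : Base m →L[ℝ] JetModel m n)) hτ (hΩ x hx)
  have h5 : ∀ u : Base m, (mfderiv (𝓡 m) (𝓡 (m + n)) (fun x => (ψ x).pt) x u : Base (m + n)) =
      mfderiv 𝓘(ℝ, JetModel m n) (𝓡 (m + n)) (fun j : Jet m n π => j.pt) (ψ x)
        (mfderiv (𝓡 m) 𝓘(ℝ, JetModel m n) ψ x u) := fun u =>
    congrArg (fun T : Base m →L[ℝ] Base (m + n) => T u) h1.mfderiv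
  have h6 : ∀ u : Base m, (mfderiv (𝓡 m) (𝓡 m) (fun x => π (ψ x).pt) x u : Base m) = u := fun u =>
    congrArg (fun T : Base m →L[ℝ] Base m => T u) h3.mfderiv
  refine ContinuousLinearMap.ext fun u => ?_
  -- A vector `w` with zero vertical part equals `lin (dπ w)`; here `w` is the derivative of the
  -- projected section along `u`, with `dπ w = u`.
  refine Eq.trans (congrArg (ψ x).lin ((h6 u).trans (hτ u).symm)) ?_
  exact (sub_eq_zero.1 (h4 u)).symm.trans (h5 u).symm

theorem isHamiltonianSolution_comap (hvol : vol.IsSmooth)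
    (hL : ContMDiff 𝓘(ℝ, JetModel m n) 𝓘(ℝ, ℝ) ∞ L)
    (h : IsDiffeoOn (JetModel m n) (DualJetModel m n) (legendre vol L) G W W')
    {D : TangentDistribution (JetModel m n) (Jet m n π)} (hD : IsLagrangianSolution vol L D W) :
    IsHamiltonianSolution (extendedLegendre vol L ∘ G) (D.comap G) W' :=
  h.isFieldSolution_comap (fun _ _ => rfl) (fun j _ => mdifferentiableAt_proj_pt j)
    (fun _ => omegaH_eq_pullback hvol hL h) hD.field

/-- Transport along `G` yields the field equation for `Ω_L = FL^*Ω_h`. Holonomy is not transported;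
it follows from that equation by regularity, and this is where the volume must be nowhere zero. -/
theorem isLagrangianSolution_comap (hvol : vol.IsSmooth) (hvol0 : ∀ x, vol x ≠ 0)
    (hL : ContMDiff 𝓘(ℝ, JetModel m n) 𝓘(ℝ, ℝ) ∞ L)
    (h : IsDiffeoOn (JetModel m n) (DualJetModel m n) (legendre vol L) G W W')
    {D : TangentDistribution (DualJetModel m n) (DualJet m n π)}
    (hD : IsHamiltonianSolution (extendedLegendre vol L ∘ G) D W') :
    IsLagrangianSolution vol L (D.comap (legendre vol L)) W := by
  have h1 : IsFieldSolution m (JetModel m n) (fun j : Jet m n π => π j.pt) (omegaL vol L)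
      (D.comap (legendre vol L)) W :=
    h.symm.isFieldSolution_comap (fun _ ha => congrArg π (pt_eq_of_isDiffeoOn h ha))
      (fun _ ha => mdifferentiableAt_proj_dualJet_pt h ha)
      (fun _ hp => h.eq_pullback_symm (fun _ => omegaH_eq_pullback hvol hL h) hp) hD
  exact ⟨h1, fun ψ U hψ => isHolonomic_of_solvesFieldEquation hvol hvol0 hL h hψ.isSection
    hψ.mapsTo (h1.equation ψ U hψ)⟩

variable {D : TangentDistribution (Base (m + n)) E} {O : Set E}

theorem solvesGenHamiltonianHJ_comp (hvol : vol.IsSmooth)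
    (hL : ContMDiff 𝓘(ℝ, JetModel m n) 𝓘(ℝ, ℝ) ∞ L)
    (h : IsDiffeoOn (JetModel m n) (DualJetModel m n) (legendre vol L) G W W')
    {DL : TangentDistribution (JetModel m n) (Jet m n π)} {Ψ : E → Jet m n π}
    (hΨ : SolvesGenLagrangianHJ vol L DL W Ψ D O) :
    SolvesGenHamiltonianHJ (extendedLegendre vol L ∘ G) (DL.comap G) W' (legendre vol L ∘ Ψ) D O where
  dynamics := isHamiltonianSolution_comap hvol hL h hΨ.dynamics
  isSection := ⟨hΨ.isSection.isOpen, h.contMDiffOn.comp hΨ.isSection.smooth hΨ.mapsTo,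
    hΨ.isSection.proj⟩
  mapsTo := h.mapsTo.comp hΨ.mapsTo
  distribution := hΨ.distribution
  integral γ U hγ := h.isIntegralSection_comp (fun _ _ => rfl) (hΨ.integral γ U hγ)

/-- Since `FL^*Ω_h = Ω_L` on `W`, one has `(FL ∘ Ψ)^*Ω_h = Ψ^*Ω_L` on `O`. -/
theorem solvesHamiltonianHJ_comp (hvol : vol.IsSmooth)
    (hL : ContMDiff 𝓘(ℝ, JetModel m n) 𝓘(ℝ, ℝ) ∞ L)
    (h : IsDiffeoOn (JetModel m n) (DualJetModel m n) (legendre vol L) G W W')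
    {DL : TangentDistribution (JetModel m n) (Jet m n π)} {Ψ : E → Jet m n π}
    (hΨ : SolvesLagrangianHJ vol L DL W Ψ D O) :
    SolvesHamiltonianHJ (extendedLegendre vol L ∘ G) (DL.comap G) W' (legendre vol L ∘ Ψ) D O where
  generalized := solvesGenHamiltonianHJ_comp hvol hL h hΨ.generalized
  isotropic e he := by
    have h1 := hΨ.generalized.isSection
    refine (h.pullback_comp_eq
      (fun _ hp => h.eq_pullback_symm (fun _ => omegaH_eq_pullback hvol hL h) hp) ?_
      (hΨ.generalized.mapsTo he)).trans (hΨ.isotropic e he)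
    exact (h1.smooth.contMDiffAt (h1.isOpen.mem_nhds he)).mdifferentiableAt (by simp)

theorem solvesGenLagrangianHJ_comp (hvol : vol.IsSmooth) (hvol0 : ∀ x, vol x ≠ 0)
    (hL : ContMDiff 𝓘(ℝ, JetModel m n) 𝓘(ℝ, ℝ) ∞ L)
    (h : IsDiffeoOn (JetModel m n) (DualJetModel m n) (legendre vol L) G W W')
    {Dh : TangentDistribution (DualJetModel m n) (DualJet m n π)} {s : E → DualJet m n π}
    (hs : SolvesGenHamiltonianHJ (extendedLegendre vol L ∘ G) Dh W' s D O) :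
    SolvesGenLagrangianHJ vol L (Dh.comap (legendre vol L)) W (G ∘ s) D O where
  dynamics := isLagrangianSolution_comap hvol hvol0 hL h hs.dynamics
  isSection := ⟨hs.isSection.isOpen, h.contMDiffOn'.comp hs.isSection.smooth hs.mapsTo,
    fun e he => (pt_eq_of_isDiffeoOn h (hs.mapsTo he)).trans (hs.isSection.proj e he)⟩
  mapsTo := h.mapsTo'.comp hs.mapsTo
  distribution := hs.distribution
  integral γ U hγ := h.symm.isIntegralSection_comp
    (fun _ ha => congrArg π (pt_eq_of_isDiffeoOn h ha)) (hs.integral γ U hγ)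

/-- Since `G^*Ω_L = Ω_h` on `W'`, one has `(G ∘ s)^*Ω_L = s^*Ω_h` on `O`. -/
theorem solvesLagrangianHJ_comp (hvol : vol.IsSmooth) (hvol0 : ∀ x, vol x ≠ 0)
    (hL : ContMDiff 𝓘(ℝ, JetModel m n) 𝓘(ℝ, ℝ) ∞ L)
    (h : IsDiffeoOn (JetModel m n) (DualJetModel m n) (legendre vol L) G W W')
    {Dh : TangentDistribution (DualJetModel m n) (DualJet m n π)} {s : E → DualJet m n π}
    (hs : SolvesHamiltonianHJ (extendedLegendre vol L ∘ G) Dh W' s D O) :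
    SolvesLagrangianHJ vol L (Dh.comap (legendre vol L)) W (G ∘ s) D O where
  generalized := solvesGenLagrangianHJ_comp hvol hvol0 hL h hs.generalized
  isotropic e he := by
    have h1 := hs.generalized.isSection
    refine (h.symm.pullback_comp_eq (fun _ ha => omegaH_eq_pullback hvol hL h ha) ?_
      (hs.generalized.mapsTo he)).trans (hs.isotropic e he)
    exact (h1.smooth.contMDiffAt (h1.isOpen.mem_nhds he)).mdifferentiableAt (by simp)
end HamiltonJacobi

end Multisymplectic

end

/-! ### The regular and the hyperregular case -/

theorem mainTheorem12 {m n : ℕ} {M E : Type*}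
    [TopologicalSpace M] [T2Space M] [SecondCountableTopology M]
    [ChartedSpace (EuclideanSpace ℝ (Fin m)) M] [IsManifold (𝓡 m) ∞ M]
    [TopologicalSpace E] [T2Space E] [SecondCountableTopology E]
    [ChartedSpace (EuclideanSpace ℝ (Fin (m + n))) E] [IsManifold (𝓡 (m + n)) ∞ E]
    (π : E → M) [IsFibredManifold m n π]
    (vol : DForm (EuclideanSpace ℝ (Fin m)) M m) (_hvol : vol.IsSmooth) (_hvol0 : ∀ x, vol x ≠ 0)
    (L : Jet m n π → ℝ) (_hL : ContMDiff 𝓘(ℝ, JetModel m n) 𝓘(ℝ, ℝ) ∞ L) :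
    -- `L` regular; `W` is any open set on which `FL` is injective, `G` its inverse on `FL(W)`
    (IsRegularLagrangian vol L →
      ∀ (W : Set (Jet m n π)) (G : DualJet m n π → Jet m n π),
        IsOpen W → Set.LeftInvOn G (legendre vol L) W →
      ∀ (O : Set E) (D : TangentDistribution (EuclideanSpace ℝ (Fin (m + n))) E),
        (∀ (DL : TangentDistribution (JetModel m n) (Jet m n π)) (Ψ : E → Jet m n π),
          (SolvesGenLagrangianHJ vol L DL W Ψ D O →
            SolvesGenHamiltonianHJ (extendedLegendre vol L ∘ G) (DL.comap G) (legendre vol L '' W)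
              (legendre vol L ∘ Ψ) D O) ∧
          (SolvesLagrangianHJ vol L DL W Ψ D O →
            SolvesHamiltonianHJ (extendedLegendre vol L ∘ G) (DL.comap G) (legendre vol L '' W)
              (legendre vol L ∘ Ψ) D O)) ∧
        (∀ (Dh : TangentDistribution (DualJetModel m n) (DualJet m n π)) (s : E → DualJet m n π),
          (SolvesGenHamiltonianHJ (extendedLegendre vol L ∘ G) Dh (legendre vol L '' W) s D O →
            SolvesGenLagrangianHJ vol L (Dh.comap (legendre vol L)) W (G ∘ s) D O) ∧
          (SolvesHamiltonianHJ (extendedLegendre vol L ∘ G) Dh (legendre vol L '' W) s D O →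
            SolvesLagrangianHJ vol L (Dh.comap (legendre vol L)) W (G ∘ s) D O))) ∧
    -- `L` hyperregular; everything is global, `G` is the inverse of `FL`
    (IsHyperregularLagrangian vol L →
      ∀ G : DualJet m n π → Jet m n π,
        Function.LeftInverse G (legendre vol L) → Function.RightInverse G (legendre vol L) →
      ∀ D : TangentDistribution (EuclideanSpace ℝ (Fin (m + n))) E,
        (∀ (DL : TangentDistribution (JetModel m n) (Jet m n π)) (Ψ : E → Jet m n π),
          (SolvesGenLagrangianHJ vol L DL Set.univ Ψ D Set.univ →
            SolvesGenHamiltonianHJ (extendedLegendre vol L ∘ G) (DL.comap G) Set.univ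
              (legendre vol L ∘ Ψ) D Set.univ) ∧
          (SolvesLagrangianHJ vol L DL Set.univ Ψ D Set.univ →
            SolvesHamiltonianHJ (extendedLegendre vol L ∘ G) (DL.comap G) Set.univ
              (legendre vol L ∘ Ψ) D Set.univ)) ∧
        (∀ (Dh : TangentDistribution (DualJetModel m n) (DualJet m n π)) (s : E → DualJet m n π),
          (SolvesGenHamiltonianHJ (extendedLegendre vol L ∘ G) Dh Set.univ s D Set.univ →
            SolvesGenLagrangianHJ vol L (Dh.comap (legendre vol L)) Set.univ (G ∘ s) D Set.univ) ∧
          (SolvesHamiltonianHJ (extendedLegendre vol L ∘ G) Dh Set.univ s D Set.univ →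
            SolvesLagrangianHJ vol L (Dh.comap (legendre vol L)) Set.univ (G ∘ s) D
              Set.univ))) := by
  constructor
  · intro hreg W G hW hG O D
    have h := IsLocalDiffeomorph.isDiffeoOn (V := JetModel m n) (V' := DualJetModel m n) hreg hW hG
    exact ⟨fun DL Ψ => ⟨solvesGenHamiltonianHJ_comp _hvol _hL h, solvesHamiltonianHJ_comp _hvol _hL h⟩,
      fun Dh s => ⟨solvesGenLagrangianHJ_comp _hvol _hvol0 _hL h,
        solvesLagrangianHJ_comp _hvol _hvol0 _hL h⟩⟩
  · rintro ⟨Φ, hΦ⟩ G hG hG' D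
    have hreg : IsLocalDiffeomorph 𝓘(ℝ, JetModel m n) 𝓘(ℝ, DualJetModel m n) ∞ (legendre vol L) := by
      rw [← hΦ]
      exact Φ.isLocalDiffeomorph
    have h := IsLocalDiffeomorph.isDiffeoOn (V := JetModel m n) (V' := DualJetModel m n) hreg
      isOpen_univ (hG.leftInvOn univ)
    -- The global case is the local one with `W` the whole jet bundle; surjectivity of `FL`
    -- identifies its image with all of `J¹π^*`.
    rw [image_univ, hG'.surjective.range_eq] at h
    exact ⟨fun DL Ψ => ⟨solvesGenHamiltonianHJ_comp _hvol _hL h, solvesHamiltonianHJ_comp _hvol _hL h⟩,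
      fun Dh s => ⟨solvesGenLagrangianHJ_comp _hvol _hvol0 _hL h,
        solvesLagrangianHJ_comp _hvol _hvol0 _hL h⟩⟩
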